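/- Let $N\ge 3$, $h_1:=h:=2N-2$, $h_2:=2$, $\mathbf i=\sqrt{-1}$, $\eta=e^{2\pi\mathbf i/h}$, and let $\mathbf t^a=(t^a_m)_{m\in\mathbb Z^+_{\rm odd}}$ ($a=1,2$) be two sequences of formal variables indexed by the positive odd integers. On $\mathbb C[\![\mathbf t^1,\mathbf t^2]\!]$ put $J^a_{-m}=m\,t^a_m$, $J^a_m=2\,\partial/\partial t^a_m$ ($m\in\mathbb Z^+_{\rm odd}$) and $$\Gamma(\mathbf t^a,z)=\exp\Big(\sum_{m\in\mathbb Z^+_{\rm odd}}t^a_mz^m\Big)\exp\Big(-\sum_{m\in\mathbb Z^+_{\rm odd}}2\,\partial_{t^a_m}\frac{z^{-m}}{m}\Big),$$ $$\Omega_m=\operatorname{Res}_{z_1=0}\frac{dz_1}{z_1}z_1^{mh}\,\Gamma(\mathbf t^1,z_1)\otimes\Gamma(\mathbf t^1,-z_1)-\operatorname{Res}_{z_2=0}\frac{dz_2}{z_2}z_2^{2m}\,\Gamma(\mathbf t^2,z_2)\otimes\Gamma(\mathbf t^2,-z_2)\qquad(m\in\mathbb Z).$$ **The Kac--Wakimoto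 hierarchy.** Let $v_1,\dots,v_N$ be the standard basis of $\mathbb Z^N$ with the Euclidean pairing $(\cdot|\cdot)$, $\Delta=\{\pm(v_i\pm v_j)\mid i\ne j\}$ the root system of type $D_N$, and $\sigma$ the Coxeter transformation $v_1\mapsto v_2\mapsto\cdots\mapsto v_{N-1}\mapsto -v_1$, $v_N\mapsto -v_N$. Let $\epsilon$ be the bimultiplicative function with $\epsilon(v_i,v_j)=-1$ if $i\le j$ and $1$ if $i>j$, and $B(\alpha,\beta)=h^{-(\alpha|\beta)}\prod_{k=1}^{h-1}(1-\eta^k)^{(\sigma^k\alpha|\beta)}$. Consider the principal realization of the basic representation of the affine Lie algebra $\widehat{so}_{2N}(\mathbb C)$, completed to $\mathbb C[\![\mathbf t^1,\mathbf t^2]\!]$, in which $$Y(v_i,\lambda)=\sum_{n\in\frac1h\mathbb Z}(v_i)_{(n)}\lambda^{-n-1}=\frac1{h\lambda}\sum_{m\in\mathbb Z_{\rm odd}}J^1_{-m}(\lambda^{1/h}\eta^i)^m\ (i<N),\qquad Y(v_N,\lambda)=\frac1{2\lambda}\sum_{m\in\mathbb Z_{\rm odd}}J^2_{-m}\lambda^{m/2},$$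 $$Y(e^\alpha,\lambda)=\sum_{n\in\frac1h\mathbb Z}(e^\alpha)_{(n)}\lambda^{-n-1}=U_\alpha\lambda^{-1}\,{:}\exp\Big(\sum_{n\in\frac1h\mathbb Z\setminus\{0\}}\alpha_{(-n)}\frac{\lambda^n}{n}\Big){:}\quad(\alpha\in\Delta),$$ where $\alpha_{(n)}=\sum_i c_i(v_i)_{(n)}$ for $\alpha=\sum_ic_iv_i$, and the $U_\alpha$ are scalars with $U_\alpha U_{-\alpha}=\epsilon(\alpha,-\alpha)B(\alpha,-\alpha)^{-1}$. Let $$\nu_{(1)}=\frac{N(h+1)}{24h}+\sum_{a=1,2}\frac1{4h_a}\sum_{m\in\mathbb Z_{\rm odd}}{:}J^a_mJ^a_{-m}{:}\,.$$ The principal Kac--Wakimoto hierarchy of type $D_N$ is the equation $\Omega_{\rm KW}(\tau\otimes\tau)=0$ with the Casimir $$\Omega_{\rm KW}=-\sum_{\alpha\in\Delta}\sum_{n\in\frac1h\mathbb Z}(e^\alpha)_{(n)}\otimes(e^{-\alpha})_{(-n)}+\sum_{i=1}^N\sum_{n\in\frac1h\mathbb Z}(v_i)_{(n)}\otimes(v_i)_{(-n)}-\nu_{(1)}\otimes1-1\otimes\nu_{(1)}.$$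 **The Grassmannian.** Let $V=\mathbb C(\!(z_1^{-1})\!)e_1\oplus\mathbb C(\!(z_2^{-1})\!)e_2$ with the pairing $(f,g)=\sum_{a=1,2}\operatorname{Res}_{z_a=0}\frac{dz_a}{z_a}f_a(z_a)g_a(-z_a)$. Write $V=U_0\oplus V_0$ with $U_0=\mathbb C(e_1+\mathbf ie_2)+\mathbb C[z_1]z_1e_1+\mathbb C[z_2]z_2e_2$ and $V_0=\mathbb C(e_1-\mathbf ie_2)+\mathbb C[\![z_1^{-1}]\!]z_1^{-1}e_1+\mathbb C[\![z_2^{-1}]\!]z_2^{-1}e_2$, and let $\pi:V\to U_0$ be the projection along $V_0$. Then $\operatorname{Gr}_2^{I,(0)}$ is the set of subspaces $U\subset V$ such that $\pi|_U:U\to U_0$ is an isomorphism and $U$ is maximally isotropic (it is isotropic and for every $u'\notin U$ there is $u\in U$ with $(u,u')\ne0$). A series $\tau$ is a tau-function of the 2-component BKP hierarchy if $\Omega_0(\tau\otimes\tau)=0$. If $\tau(0)\ne0$, let $U_\tau\subset V$ be the span of the Taylor coefficients at $x_1=x_2=0$ of the wave function $\Psi=\Psi^{(1)}e_1+\mathbf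 i\Psi^{(2)}e_2$, where $\Psi^{(a)}$ is $\tau^{-1}\,\Gamma(\mathbf t^a,z_a)\tau$ restricted to $t^1_1=x_1$, $t^2_1=x_2$, $t^b_m=0$ for $m>1$. **Corollary 1.** Let $\tau\in\mathbb C[\![\mathbf t^1,\mathbf t^2]\!]$. a) $\Omega_{\rm KW}(\tau\otimes\tau)=0$ if and only if $\Omega_m(\tau\otimes\tau)=0$ for all integers $m\ge0$. b) Suppose $\tau(0)\neq0$. If $\tau$ is a tau-function of the 2-component BKP hierarchy, then $U_\tau\in\operatorname{Gr}_2^{I,(0)}$. Moreover, $\Omega_{\rm KW}(\tau\otimes\tau)=0$ if and only if $\tau$ is a tau-function of the 2-component BKP hierarchy and $(z_1^h,z_2^2)\,U_\tau\subset U_\tau$, where $(z_1^h,z_2^2)(f_1,f_2)=(z_1^hf_1,z_2^2f_2)$. -/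

import Mathlib

noncomputable section

namespace KacWakimotoD

/-! ### Formal series -/

/-- Formal Laurent series `ℂ((z⁻¹))`: the coefficient of index `n` is the coefficient of `z⁻ⁿ`. -/
abbrev LaurentInv : Type := LaurentSeries ℂ

/-- `f(z) ↦ f(-z)`. -/
def negVar (f : LaurentInv) : LaurentInv where
  coeff n := (-1 : ℂ) ^ n * f.coeff n
  isPWO_support' := f.isPWO_support'.mono fun n hn h0 => hn (by simp [h0])

/-- The residue of `z ^ k f(z) dz / z`, i.e. the coefficient of `z ^ (-k)` in `f`. -/
def res (k : ℤ) (f : LaurentInv) : ℂ := f.coeff k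

/-- The dynamical variables: `(a, k)` is `t^{a+1}_{2k+1}`, so `a = 0, 1` stand for the two
components and the second entry runs over the positive odd integers `2k + 1`. -/
abbrev Var : Type := Fin 2 × ℕ

/-- The positive odd integer `m` of the variable `t^a_m`. -/
def Var.idx (s : Var) : ℕ := 2 * s.2 + 1

/-- `ℂ[[𝐭¹, 𝐭²]]`. -/
abbrev Fock : Type := MvPowerSeries Var ℂ

/-- The product `F(𝐭') G(𝐭'')` of series in two independent copies of the variables;
for scalar coefficients this is `F ⊗ G` in the completed tensor square. -/
def tensor {R : Type*} [Mul R] (F G : MvPowerSeries Var R) : MvPowerSeries (Var ⊕ Var) R :=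
  fun d => F (d.comapDomain Sum.inl Sum.inl_injective.injOn) *
    G (d.comapDomain Sum.inr Sum.inr_injective.injOn)

/-- `exp (∑ₛ pₛ tₛ z ^ wₛ)`, expanded in the variables `tₛ`. -/
def expMul (w : Var → ℕ) (p : Var → ℂ) : MvPowerSeries Var LaurentInv :=
  fun d => HahnSeries.single (-(Finsupp.weight w d : ℤ))
    (d.prod fun s n => p s ^ n / (n.factorial : ℂ))

/-- `exp (∑ₛ qₛ z ^ (-wₛ) ∂ₛ) f`. The coefficient of `z ^ (-n)` is the sum over all multi-indices
`e` of weight `n` of `(∏ₛ qₛ ^ eₛ / eₛ!) ∂ᵉ f`, and the coefficient of `tᵈ` in `∂ᵉ f` is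
`(∏ₛ (dₛ + eₛ)! / dₛ!) f_{d+e}`. For the weights used below (positive, each value taken finitely
often) there are only finitely many such `e`. -/
def expDer (w : Var → ℕ) (q : Var → ℂ) (f : Fock) : MvPowerSeries Var LaurentInv :=
  fun d => HahnSeries.ofPowerSeries ℤ ℂ (PowerSeries.mk fun n =>
    ∑ᶠ e : {e : Var →₀ ℕ // Finsupp.weight w e = n},
      (e.1.prod fun s j => q s ^ j / (j.factorial : ℂ) * ((d s + j).descFactorial j : ℂ)) *
        MvPowerSeries.coeff (d + e.1) f)

/-- The vertex operator `exp (∑ₛ pₛ tₛ z ^ wₛ) exp (∑ₛ qₛ z ^ (-wₛ) ∂ₛ)` applied to `f`. -/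
def vertexOp (w : Var → ℕ) (p q : Var → ℂ) (f : Fock) : MvPowerSeries Var LaurentInv :=
  expMul w p * expDer w q f

/-! ### The 2-component BKP hierarchy and its reductions -/

/-- `Γ(𝐭ᵃ, z) f`, where
`Γ(𝐭ᵃ, z) = exp (∑ tᵃₘ zᵐ) exp (- ∑ 2 ∂_{tᵃₘ} z⁻ᵐ / m)`, the sums over odd `m > 0`. -/
def Gam (a : Fin 2) (f : Fock) : MvPowerSeries Var LaurentInv :=
  vertexOp Var.idx (fun s => if s.1 = a then 1 else 0)
    (fun s => if s.1 = a then -2 / (s.idx : ℂ) else 0) f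

/-- `Res (dz / z) z ^ k (Γ(𝐭ᵃ, z) f ⊗ Γ(𝐭ᵃ, -z) g)`. -/
def gamRes (a : Fin 2) (k : ℤ) (f g : Fock) : MvPowerSeries (Var ⊕ Var) ℂ :=
  fun d => res k (tensor (Gam a f) (fun e => negVar (Gam a g e)) d)

/-- The Coxeter number `h = 2N - 2` of `D_N`. -/
def cox (N : ℕ) : ℕ := 2 * N - 2

/-- `Ω_m (f ⊗ g)`, where
`Ω_m = Res (dz₁/z₁) z₁^{mh} Γ(𝐭¹,z₁) ⊗ Γ(𝐭¹,-z₁) - Res (dz₂/z₂) z₂^{2m} Γ(𝐭²,z₂) ⊗ Γ(𝐭²,-z₂)`. -/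
def Omega (N : ℕ) (m : ℤ) (f g : Fock) : MvPowerSeries (Var ⊕ Var) ℂ :=
  gamRes 0 (m * cox N) f g - gamRes 1 (2 * m) f g

/-- The Hirota bilinear equations of the 2-component BKP hierarchy. -/
def IsBKPTau (τ : Fock) : Prop := gamRes 0 0 τ τ - gamRes 1 0 τ τ = 0

/-! ### Shiota's Grassmannian -/

/-- `V = ℂ((z₁⁻¹)) ⊕ ℂ((z₂⁻¹))`. -/
abbrev VV : Type := LaurentInv × LaurentInv

/-- `(f, g) = ∑ₐ Res (dzₐ / zₐ) fₐ(zₐ) gₐ(-zₐ)`. -/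
def pairing (f g : VV) : ℂ := res 0 (f.1 * negVar g.1) + res 0 (f.2 * negVar g.2)

/-- `U₀ = ℂ (e₁ + i e₂) + z₁ ℂ[z₁] e₁ + z₂ ℂ[z₂] e₂`. -/
def U0 : Submodule ℂ VV where
  carrier := {f | (∀ n : ℤ, 0 < n → f.1.coeff n = 0 ∧ f.2.coeff n = 0) ∧
    f.2.coeff 0 = Complex.I * f.1.coeff 0}
  zero_mem' := by simp
  add_mem' := by
    rintro f g ⟨hf, hf'⟩ ⟨hg, hg'⟩
    refine ⟨fun n hn => ?_, ?_⟩
    · simp [hf n hn, hg n hn]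
    · simp [hf', hg', mul_add]
  smul_mem' := by
    rintro c f ⟨hf, hf'⟩
    refine ⟨fun n hn => ?_, ?_⟩
    · simp [hf n hn]
    · simp [hf', mul_left_comm]

/-- `V₀ = ℂ (e₁ - i e₂) + z₁⁻¹ ℂ[[z₁⁻¹]] e₁ + z₂⁻¹ ℂ[[z₂⁻¹]] e₂`. -/
def V0 : Submodule ℂ VV where
  carrier := {f | (∀ n : ℤ, n < 0 → f.1.coeff n = 0 ∧ f.2.coeff n = 0) ∧
    f.2.coeff 0 = -Complex.I * f.1.coeff 0}
  zero_mem' := by simp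
  add_mem' := by
    rintro f g ⟨hf, hf'⟩ ⟨hg, hg'⟩
    refine ⟨fun n hn => ?_, ?_⟩
    · simp [hf n hn, hg n hn]
    · simp [hf', hg', mul_add]
  smul_mem' := by
    rintro c f ⟨hf, hf'⟩
    refine ⟨fun n hn => ?_, ?_⟩
    · simp [hf n hn]
    · simp [hf', mul_left_comm]

/-- The part of a series with powers `z ^ k`, `k > 0`, plus the constant `c`. -/
def polPart (f : LaurentInv) (c : ℂ) : LaurentInv where
  coeff n := if n < 0 then f.coeff n else if n = 0 then c else 0
  isPWO_support' := by
    refine (f.isPWO_support'.union (Set.isPWO_singleton (0 : ℤ))).mono fun n hn => ?_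
    by_cases h : n < 0
    · left; simpa [h] using hn
    · by_cases h0 : n = 0
      · right; simp [h0]
      · simp [h, h0] at hn

theorem isCompl_U0_V0 : IsCompl U0 V0 := by
  constructor
  · rw [Submodule.disjoint_def]
    rintro f ⟨hf, hf'⟩ ⟨hg, hg'⟩
    have h1 : f.1.coeff 0 = 0 := by
      have : (2 * Complex.I) * f.1.coeff 0 = 0 := by linear_combination hg' - hf'
      simpa using this
    have h2 : f.2.coeff 0 = 0 := by rw [hf', h1, mul_zero]
    refine Prod.ext (HahnSeries.ext (funext fun n => ?_)) (HahnSeries.ext (funext fun n => ?_))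
    · rcases lt_trichotomy n 0 with h | h | h
      · exact (hg n h).1
      · rw [h]; exact h1
      · exact (hf n h).1
    · rcases lt_trichotomy n 0 with h | h | h
      · exact (hg n h).2
      · rw [h]; exact h2
      · exact (hf n h).2
  · rw [codisjoint_iff, eq_top_iff]
    rintro f -
    set c : ℂ := (f.1.coeff 0 - Complex.I * f.2.coeff 0) / 2 with hc
    refine Submodule.mem_sup.2 ⟨(polPart f.1 c, polPart f.2 (Complex.I * c)), ⟨?_, ?_⟩,
      f - (polPart f.1 c, polPart f.2 (Complex.I * c)), ⟨?_, ?_⟩, by simp⟩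
    · intro n hn
      simp [polPart, not_lt.2 hn.le, hn.ne']
    · simp [polPart]
    · intro n hn
      simp [polPart, hn]
    · simp [polPart]
      rw [hc]
      linear_combination f.2.coeff 0 * Complex.I_sq

/-- The projection `π : V → U₀` along `V₀`. -/
def projU0 : VV →ₗ[ℂ] U0 := U0.projectionOnto V0 isCompl_U0_V0

/-- The big cell `Gr_2^{I,(0)}`: subspaces `U ⊂ V` such that `π|_U : U → U₀` is an isomorphism
and `U` is maximally isotropic. -/
def Gr : Set (Submodule ℂ VV) :=
  {U | Function.Bijective (projU0 ∘ₗ U.subtype) ∧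
    (∀ u ∈ U, ∀ u' ∈ U, pairing u u' = 0) ∧
    ∀ u' ∉ U, ∃ u ∈ U, pairing u u' ≠ 0}

/-- The component `Ψ^{(a)}(x, z_a)` of the wave function: `(Γ(𝐭ᵃ, z_a) τ) / τ` with all variables
other than `x₁ = t¹₁`, `x₂ = t²₁` set to zero. It is meaningful if `τ(0) ≠ 0`. -/
def waveComp (τ : Fock) (a : Fin 2) : MvPowerSeries (Fin 2) LaurentInv :=
  fun e => (Gam a τ * MvPowerSeries.map (HahnSeries.C : ℂ →+* LaurentInv) τ⁻¹)
    (e.mapDomain fun b => ((b, 0) : Var))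

/-- The coefficient of `xᵉ` in the wave function `Ψ = Ψ^{(1)} e₁ + i Ψ^{(2)} e₂`. -/
def waveCoeff (τ : Fock) (e : Fin 2 →₀ ℕ) : VV :=
  (waveComp τ 0 e, Complex.I • waveComp τ 1 e)

/-- The point of the Grassmannian that corresponds to `τ`: the span of the Taylor coefficients
of the wave function at `x = 0`. -/
def grPoint (τ : Fock) : Submodule ℂ VV := Submodule.span ℂ (Set.range (waveCoeff τ))

/-- Multiplication by `(z₁ ^ h, z₂ ^ 2)` on `V`. -/
def mulZ (N : ℕ) (f : VV) : VV :=
  (HahnSeries.single (-(cox N : ℤ)) 1 * f.1, HahnSeries.single (-2 : ℤ) 1 * f.2)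

/-! ### The Kac–Wakimoto hierarchy

The Casimir of the affine Lie algebra of type `D_N`, twisted by the Coxeter transformation `σ`,
acting on the tensor square of the principal realization `ℂ[[𝐭¹, 𝐭²]]` of the basic
representation. Vectors of the lattice `ℤ^N` are functions `Fin N → ℤ`; the index `i : Fin N`
stands for the basis vector `v_{i+1}`. We write `λ = ζ ^ h`, so that `λ ^ {1/2} = ζ ^ (N-1)`. -/

/-- The root system `Δ = {± (v_i ± v_j) | i ≠ j}`. -/
def roots (N : ℕ) : Finset (Fin N → ℤ) :=
  ((Finset.univ : Finset (Fin N × Fin N × ℤˣ × ℤˣ)).filter fun x => x.1 ≠ x.2.1).image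
    fun x => Pi.single x.1 (x.2.2.1 : ℤ) + Pi.single x.2.1 (x.2.2.2 : ℤ)

/-- The Euclidean pairing `(α | β)`. -/
def ip {N : ℕ} (α β : Fin N → ℤ) : ℤ := ∑ i, α i * β i

/-- The Coxeter transformation
`v₁ ↦ v₂ ↦ ⋯ ↦ v_{N-1} ↦ -v₁`, `v_N ↦ -v_N`. -/
def coxeter {N : ℕ} (α : Fin N → ℤ) : Fin N → ℤ := fun j =>
  if j.1 + 1 = N then -α j
  else if j.1 = 0 then -α ⟨N - 2, by have := j.2; omega⟩
  else α ⟨j.1 - 1, by have := j.2; omega⟩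

/-- `η = exp (2πi / h)`. -/
def eta (N : ℕ) : ℂ := Complex.exp (2 * Real.pi * Complex.I / (cox N : ℂ))

/-- The bimultiplicative cocycle `ε` with `ε(v_i, v_j) = -1` for `i ≤ j` and `1` for `i > j`. -/
def eps {N : ℕ} (α β : Fin N → ℤ) : ℂ :=
  ∏ i, ∏ j, (if i ≤ j then (-1 : ℂ) else 1) ^ (α i * β j)

/-- `B(α, β) = h ^ {-(α|β)} ∏_{k=1}^{h-1} (1 - η ^ k) ^ {(σ^k α | β)}`. -/
def bFun {N : ℕ} (α β : Fin N → ℤ) : ℂ :=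
  (cox N : ℂ) ^ (-ip α β) *
    ∏ k ∈ Finset.Icc 1 (cox N - 1), (1 - eta N ^ k) ^ ip (coxeter^[k] α) β

/-- The scalar by which `U_α U_{-α}` acts, where the operators `U_α` (`α ∈ ℤ^N`), which commute with
the Heisenberg algebra, satisfy `U_α U_β = ε(α, β) B(α, β)⁻¹ U_{α+β}` and `U_0 = 1`. For a root `α`
each of `U_{±α}` acts on the basic representation by a scalar. -/
def uProd {N : ℕ} (α : Fin N → ℤ) : ℂ := eps α (-α) / bFun α (-α)

/-- The Heisenberg operators `J^{a+1}_m`, `m` odd: multiplication by `-m t_{-m}` if `m < 0`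
and `2 ∂ / ∂ t_m` if `m > 0`. For even `m` we put `0`. -/
def JJ (a : Fin 2) (m : ℤ) (f : Fock) : Fock :=
  if Odd m then
    if 0 < m then (2 : ℂ) • MvPowerSeries.pderiv ℂ ((a, m.natAbs / 2) : Var) f
    else (-(m : ℂ)) • (MvPowerSeries.X ((a, m.natAbs / 2) : Var) * f)
  else 0

/-- The mode `(v_{i+1})_{(m/h)}` of the twisted field of `v_{i+1}`, where
`Y(v_i, λ) = (1 / (hλ)) ∑ J¹_{-m} (λ^{1/h} η^i)^m` for `i < N`,
`Y(v_N, λ) = (1 / (2λ)) ∑ J²_{-m} (λ^{1/2})^m`, both sums over all odd integers `m`, and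
`Y(v, λ) = ∑ v_{(n)} λ^{-n-1}`. -/
def vMode (N : ℕ) (i : Fin N) (m : ℤ) (f : Fock) : Fock :=
  if i.1 + 1 < N then (eta N ^ (-((i.1 + 1 : ℕ) : ℤ) * m) / (cox N : ℂ)) • JJ 0 m f
  else if ((N - 1 : ℕ) : ℤ) ∣ m then (1 / 2 : ℂ) • JJ 1 (m / ((N - 1 : ℕ) : ℤ)) f
  else 0

/-- The exponent of `ζ = λ^{1/h}` that accompanies `t^a_m`: it is `m` for `a = 1` and
`m (N-1)` for `a = 2`. -/
def kwWeight (N : ℕ) (s : Var) : ℕ := if s.1 = 0 then s.idx else s.idx * (N - 1)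

/-- For `α = ∑ c_i v_i` and sign `e = ±1`: the number `∑_{i<N} c_i η^{e i m}` for the variable
`t¹_m` and `c_N` for the variables `t²_m`. -/
def rootCoeff {N : ℕ} (α : Fin N → ℤ) (e : ℤ) (s : Var) : ℂ :=
  if s.1 = 0 then
    ∑ i : Fin N, if i.1 + 1 < N then (α i : ℂ) * eta N ^ (e * ((i.1 + 1 : ℕ) : ℤ) * (s.idx : ℤ))
      else 0
  else ∑ i : Fin N, if i.1 + 1 = N then (α i : ℂ) else 0

/-- `: exp (∑_{n ∈ (1/h) ℤ, n ≠ 0} α_{(-n)} λ^n / n) :  f`, as a series in `ζ = λ^{1/h}`, so that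
`Y(e^α, λ) = U_α λ⁻¹ : exp (∑ α_{(-n)} λ^n / n) :` for every root `α`. -/
def rootVertex {N : ℕ} (α : Fin N → ℤ) (f : Fock) : MvPowerSeries Var LaurentInv :=
  vertexOp (kwWeight N) (rootCoeff α 1) (fun s => -2 / (s.idx : ℂ) * rootCoeff α (-1) s) f

/-- `h₁ = h`, `h₂ = 2`. -/
def hh (N : ℕ) (a : Fin 2) : ℕ := if a = 0 then cox N else 2

/-- The mode `ν_{(1)}` of the conformal vector `ν = (1/2) ∑ v_{i(-1)} v_i`, i.e. the operator
`D₀ = N(h+1)/(24h) + ∑ₐ (1/(4hₐ)) ∑_{m odd} :Jᵃₘ Jᵃ_{-m}:`. The terms of `m` and `-m` of the normally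
ordered sum are equal and are added up. -/
def D0 (N : ℕ) (f : Fock) : Fock :=
  fun d => (N * (cox N + 1) / (24 * cox N) : ℂ) * MvPowerSeries.coeff d f +
    ∑ᶠ s : Var, (1 / (2 * hh N s.1) : ℂ) *
      MvPowerSeries.coeff d (JJ s.1 (-(s.idx : ℤ)) (JJ s.1 (s.idx : ℤ) f))

/-- `Ω_KW (f ⊗ g)` for the Casimir `Ω_KW` of the Kac–Wakimoto hierarchy of type `D_N`:
`-∑_{α ∈ Δ} ∑_n (e^α)_{(n)} ⊗ (e^{-α})_{(-n)} + ∑_i ∑_n (v_i)_{(n)} ⊗ (v_i)_{(-n)}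
  - ν_{(1)} ⊗ 1 - 1 ⊗ ν_{(1)}`, with `n ∈ (1/h) ℤ`. The sum over `n` in the first term is the
coefficient of `ζ⁰` in the product of the two fields. -/
def casimirKW (N : ℕ) (f g : Fock) : MvPowerSeries (Var ⊕ Var) ℂ :=
  fun d =>
    -(∑ α ∈ roots N, uProd α * res 0 (tensor (rootVertex α f) (rootVertex (-α) g) d)) +
      (∑ i : Fin N, ∑ᶠ m : ℤ, tensor (vMode N i m f) (vMode N i (-m) g) d) -
      tensor (D0 N f) g d - tensor f (D0 N g) d

end KacWakimotoD

end

noncomputable section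

set_option linter.unusedSectionVars false

namespace KacWakimotoD

open MvPolynomial

open ComplexConjugate

open Finset.HasAntidiagonal (antidiagonal)

/-! ### Graded pieces of vertex operators on polynomials -/

section Graded

variable {σ : Type*}

/-! Part a) rests on an operator identity and a positivity argument. On `τ ⊗ τ` the Casimir equals
`-1/4` times the sum of `Ω_{-m} Ω_m` over `m ≥ 0`, the term `m = 0` being halved
(`coeff_sum_omegaPoly`). On polynomials in the doubled variables there is a positive definite
hermitian form for which `Ω_{-m}` is the adjoint of `Ω_m` (`hermForm_omegaPoly`). If the sum kills
`F`, pairing with `F` gives a sum of squared norms of the `Ω_m F` with positive weights, so every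
`Ω_m F` vanishes (`omegaPoly_eq_zero_of_sum`). A power series has no norm, but all operators are
homogeneous for the principal gradation `kw2`: the Casimir has degree `0` and `Ω_m` has degree `-m
h`. The argument therefore runs on each homogeneous component of `τ ⊗ τ`, which is a polynomial
because each weight has finitely many monomials.

The identity is obtained by normal ordering. Two modes from the same component multiply to normally
ordered modes weighted by the coefficients of `((1 - x)/(1 + x))²`. Summing over `m` multiplies this
series by `(1/2)(1 + x^h)/(1 - x^h)`, and the `κ`-th coefficient of the product is `(2/h)(-1)^κ κ²`
plus an `h`-periodic function, up to a correction at `κ = 0` (`sum_halfOne_sqCoeff`). The quadratic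
part is a second moment that collapses to the quadratic Heisenberg operator (`sum_sq_normalPair`).
The discrete Fourier series of the periodic part (`sum_fourier`) is a combination of vertex
operators at the pairs of points `(η^j z, z)`; these belong to the roots `±v_i ± v_j` with `i, j <
N`, and the Fourier coefficients `((1 - η^j)/(1 + η^j))²` are matched by the scalars `U_α U_{-α}`
(`uProd_inner`). The frequency `η^j = -1` contributes a scalar, which accounts for the constant of
`ν_{(1)}`. Modes from different components do not contract; their sum over `m` is an average over
roots of unity and gives the roots that involve `v_N`. `sum_omegaPoly` and `sum_roots` carry out the
two sides of this comparison.

For part b), the coefficients of `Ω_m (τ ⊗ τ)` are the numbers `(z^m u, v)`, where `z = (z₁^h, z₂²)`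
and `u`, `v` run over the coefficients of `(Γ(𝐭¹, z₁)τ, i Γ(𝐭², z₂)τ)` (`Omega_sumElim`). The BKP
equation thus says that the span of these coefficients is isotropic. The span contains `U_τ`, and
`U_τ` already surjects onto `V / V₀` (`grPoint_surj`). Since `V₀` is isotropic and the pairing is
nondegenerate, an isotropic space that surjects onto `V / V₀` is maximal isotropic and a complement
of `V₀`. Hence the span is `U_τ`, which lies in the big cell, and `Ω₁ = 0` says that `z U_τ` is
orthogonal to `U_τ`, i.e. contained in it. -/

/-- A weight function is admissible if all weights are positive and each value is taken only
finitely often. -/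
class IsGrading (w : σ → ℕ) : Prop where
  pos : ∀ s, 0 < w s
  fin : ∀ n, {s | w s = n}.Finite

theorem finite_weight_le (w : σ → ℕ) [hw : IsGrading w] (n : ℕ) :
    {e : σ →₀ ℕ | Finsupp.weight w e ≤ n}.Finite := by
  classical
  have hfin : {s | w s ≤ n}.Finite := by
    refine ((Set.finite_Iic n).biUnion fun i _ => hw.fin i).subset fun s hs => ?_
    simp only [Set.mem_iUnion]
    exact ⟨w s, hs, rfl⟩
  refine (hfin.toFinset.finsupp fun _ => Finset.range (n + 1)).finite_toSet.subset fun e he => ?_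
  simp only [Finset.mem_coe, Finset.mem_finsupp_iff]
  have he' : Finsupp.weight w e ≤ n := he
  refine ⟨fun s hs => ?_, fun s _ => ?_⟩
  · have := Finsupp.le_weight_of_ne_zero' w (Finsupp.mem_support_iff.1 hs)
    simp only [Set.Finite.mem_toFinset, Set.mem_ofPred_eq]
    omega
  · have := Finsupp.le_weight w (hw.pos s).ne' e
    simp only [Finset.mem_range]
    omega

theorem finite_weight_eq (w : σ → ℕ) [IsGrading w] (n : ℤ) :
    {e : σ →₀ ℕ | (Finsupp.weight w e : ℤ) = n}.Finite :=
  (finite_weight_le w n.toNat).subset fun e he => by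
    have he' : (Finsupp.weight w e : ℤ) = n := he
    simp only [Set.mem_ofPred_eq]
    omega

/-- The multi-indices of weight `n`. -/
def wtSet (w : σ → ℕ) [IsGrading w] (n : ℤ) : Finset (σ →₀ ℕ) := (finite_weight_eq w n).toFinset

/-- The variables of weight `n`. -/
def fiber (w : σ → ℕ) [hw : IsGrading w] (n : ℕ) : Finset σ := (hw.fin n).toFinset

@[simp] theorem mem_wtSet {w : σ → ℕ} [IsGrading w] {n : ℤ} {e : σ →₀ ℕ} :
    e ∈ wtSet w n ↔ (Finsupp.weight w e : ℤ) = n := by simp [wtSet]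

@[simp] theorem mem_fiber {w : σ → ℕ} [IsGrading w] {n : ℕ} {s : σ} :
    s ∈ fiber w n ↔ w s = n := by simp [fiber]

/-- The coefficient of `tᵃ` in `exp (∑ₛ pₛ tₛ)`. -/
def expCoeff (p : σ → ℂ) (a : σ →₀ ℕ) : ℂ := a.prod fun s n => p s ^ n / (n.factorial : ℂ)

/-- The coefficient with which `f_{d+e}` enters the coefficient of `tᵈ` in
`exp (∑ₛ qₛ ∂ₛ) f`. -/
def shiftCoeff (q : σ → ℂ) (d e : σ →₀ ℕ) : ℂ :=
  e.prod fun s j => q s ^ j * ((d s + j).choose j : ℂ)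

@[simp] theorem expCoeff_zero (p : σ → ℂ) : expCoeff p 0 = 1 := by simp [expCoeff]

@[simp] theorem shiftCoeff_zero (q : σ → ℂ) (d : σ →₀ ℕ) : shiftCoeff q d 0 = 1 := by
  simp [shiftCoeff]

theorem prod_erase_mul (e : σ →₀ ℕ) (s : σ) (φ : σ → ℕ → ℂ) (h : ∀ s, φ s 0 = 1) :
    e.prod φ = φ s (e s) * (e.erase s).prod φ := (Finsupp.mul_prod_erase' e s φ h).symm

theorem prod_erase_congr (e : σ →₀ ℕ) (s : σ) (φ ψ : σ → ℕ → ℂ) (h : ∀ s', s' ≠ s → φ s' = ψ s') :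
    (e.erase s).prod φ = (e.erase s).prod ψ := by
  classical
  refine Finsupp.prod_congr fun x hx => ?_
  rw [h x]
  rintro rfl
  simp at hx

theorem erase_add_single (a : σ →₀ ℕ) (s : σ) (n : ℕ) :
    (a + Finsupp.single s n).erase s = a.erase s := by
  classical
  ext x
  by_cases h : x = s
  · simp [h]
  · simp [Finsupp.erase_ne h]

theorem expCoeff_add_single (p : σ → ℂ) (a : σ →₀ ℕ) (s : σ) :
    ((a s : ℂ) + 1) * expCoeff p (a + Finsupp.single s 1) = p s * expCoeff p a := by
  unfold expCoeff
  rw [prod_erase_mul _ s _ (by simp), prod_erase_mul a s _ (by simp), erase_add_single]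
  simp only [Finsupp.add_apply, Finsupp.single_eq_same, Nat.factorial_succ]
  have : (a s : ℂ) + 1 ≠ 0 := Nat.cast_add_one_ne_zero _
  have h2 : ((a s).factorial : ℂ) ≠ 0 := Nat.cast_ne_zero.2 (Nat.factorial_ne_zero _)
  push_cast
  field_simp
  ring

theorem weight_add_single (w : σ → ℕ) (a : σ →₀ ℕ) (s : σ) :
    Finsupp.weight w (a + Finsupp.single s 1) = Finsupp.weight w a + w s := by
  simp [Finsupp.weight_single]

/-- The component of degree `n` of `exp (∑ₛ pₛ tₛ)`. -/
def expPoly (w : σ → ℕ) [IsGrading w] (p : σ → ℂ) (n : ℤ) : MvPolynomial σ ℂ :=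
  ∑ a ∈ wtSet w n, monomial a (expCoeff p a)

/-- `exp (∑ₛ qₛ T ^ wₛ ∂ₛ)`, acting on polynomials. -/
def shiftHom (w : σ → ℕ) (q : σ → ℂ) : MvPolynomial σ ℂ →ₐ[ℂ] Polynomial (MvPolynomial σ ℂ) :=
  aeval fun s => Polynomial.C (X s) + Polynomial.C (C (q s)) * Polynomial.X ^ w s

theorem shiftHom_X (w : σ → ℕ) (q : σ → ℂ) (s : σ) : shiftHom w q (X s) =
    Polynomial.C (X s) + Polynomial.C (C (q s)) * Polynomial.X ^ w s := by simp [shiftHom]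

theorem shiftHom_C (w : σ → ℕ) (q : σ → ℂ) (c : ℂ) :
    shiftHom w q (C c) = Polynomial.C (C c) := by
  simp [shiftHom]

/-- Pascal's rule in the single variable `s`. It is the inductive step of Taylor's formula for `F ·
tₛ`: the two summands come from the two terms of the translated variable `tₛ + qₛ T ^ wₛ`. -/
theorem shiftCoeff_pascal (q : σ → ℂ) (d e : σ →₀ ℕ) (s : σ) (F : MvPolynomial σ ℂ) :
    shiftCoeff q d e * coeff (d + e) (F * X s) =
      (if d s ≠ 0 then shiftCoeff q (d - Finsupp.single s 1) e *
        coeff (d - Finsupp.single s 1 + e) F else 0) +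
      (if e s ≠ 0 then q s * shiftCoeff q d (e - Finsupp.single s 1) *
        coeff (d + (e - Finsupp.single s 1)) F else 0) := by
  classical
  obtain ⟨d', hd'⟩ : ∃ d' : σ →₀ ℕ, d' = d - Finsupp.single s 1 := ⟨_, rfl⟩
  obtain ⟨e', he'⟩ : ∃ e' : σ →₀ ℕ, e' = e - Finsupp.single s 1 := ⟨_, rfl⟩
  rw [coeff_mul_X', ← hd', ← he']
  have hd : d s ≠ 0 → d = d' + Finsupp.single s 1 := fun h => by
    rw [hd', tsub_add_cancel_of_le]
    simpa using Nat.one_le_iff_ne_zero.2 h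
  have he : e s ≠ 0 → e = e' + Finsupp.single s 1 := fun h => by
    rw [he', tsub_add_cancel_of_le]
    simpa using Nat.one_le_iff_ne_zero.2 h
  have hsub : ∀ x y : σ →₀ ℕ, x = y + Finsupp.single s 1 → x - Finsupp.single s 1 = y := by
    rintro x y rfl; simp
  by_cases h1 : d s = 0
  · by_cases h2 : e s = 0
    · simp [h1, h2]
    · have h3 : d + e - Finsupp.single s 1 = d + e' := hsub _ _ (by rw [he h2]; abel)
      have h4 : s ∈ (d + e).support := by simp [h2]
      rw [if_pos h4, h3, if_neg (by simpa using h1), if_pos h2, zero_add]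
      congr 1
      rw [he h2]
      unfold shiftCoeff
      rw [prod_erase_mul _ s _ (by simp), prod_erase_mul e' s _ (by simp), erase_add_single]
      simp [h1]
      ring
  · by_cases h2 : e s = 0
    · have h3 : d + e - Finsupp.single s 1 = d' + e := hsub _ _ (by rw [hd h1]; abel)
      have h4 : s ∈ (d + e).support := by simp [h1]
      rw [if_pos h4, h3, if_pos h1, if_neg (by simpa using h2), add_zero]
      congr 1
      unfold shiftCoeff
      rw [prod_erase_mul e s _ (by simp), prod_erase_mul e s _ (by simp)]
      simp only [h2]
      simp only [pow_zero, add_zero, Nat.choose_zero_right, Nat.cast_one, mul_one, one_mul]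
      refine prod_erase_congr _ _ _ _ fun x hx => ?_
      rw [hd']
      simp [Finsupp.single_eq_of_ne hx]
    · have h3 : d + e - Finsupp.single s 1 = d' + e := hsub _ _ (by rw [hd h1]; abel)
      have h5 : d + e' = d' + e := by
        rw [he h2]; conv_lhs => rw [hd h1]
        abel
      have h4 : s ∈ (d + e).support := by simp [h1]
      rw [if_pos h4, h3, if_pos h1, if_pos h2, h5, ← add_mul]
      congr 1
      unfold shiftCoeff
      rw [prod_erase_mul e s _ (by simp), prod_erase_mul e s _ (by simp),
        prod_erase_mul e' s _ (by simp)]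
      have h6 : e'.erase s = e.erase s := by rw [he h2, erase_add_single]
      rw [h6, prod_erase_congr e s (fun x j => q x ^ j * ((d' x + j).choose j : ℂ))
        (fun x j => q x ^ j * ((d x + j).choose j : ℂ)) (fun x hx => by
          rw [hd']
          simp [Finsupp.single_eq_of_ne hx])]
      obtain ⟨i, hi⟩ : ∃ i, d s = i + 1 := Nat.exists_eq_succ_of_ne_zero h1
      obtain ⟨j, hj⟩ : ∃ j, e s = j + 1 := Nat.exists_eq_succ_of_ne_zero h2
      have hdi : d' s = i := by rw [hd']; simp [hi]
      have hei : e' s = j := by rw [he']; simp [hj]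
      rw [hdi, hei, hi, hj]
      have : (i + 1 + (j + 1)).choose (j + 1) = (i + (j + 1)).choose (j + 1) + (i + 1 + j).choose j := by
        rw [show i + 1 + (j + 1) = (i + 1 + j) + 1 by ring, Nat.choose_succ_succ,
          show i + (j + 1) = i + 1 + j by ring]
        ring
      rw [this]
      push_cast
      ring

variable (w : σ → ℕ) [IsGrading w] (p q : σ → ℂ)

theorem coeff_expPoly (n : ℤ) (a : σ →₀ ℕ) :
    coeff a (expPoly w p n) = if (Finsupp.weight w a : ℤ) = n then expCoeff p a else 0 := by
  classical
  simp [expPoly, coeff_sum, coeff_monomial]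

theorem expPoly_of_neg {n : ℤ} (hn : n < 0) : expPoly w p n = 0 := by
  ext a
  rw [coeff_expPoly, if_neg (by omega), coeff_zero]

theorem expPoly_zero : expPoly w p 0 = 1 := by
  classical
  ext a
  rw [coeff_expPoly, coeff_one]
  by_cases h : a = 0
  · simp [h]
  · rw [if_neg, if_neg (Ne.symm h)]
    intro h0
    apply h
    ext s
    have := Finsupp.le_weight w (IsGrading.pos (w := w) s).ne' a
    simp
    omega

theorem sum_wtSet_sub_single {M : Type*} [AddCommMonoid M] (n : ℤ) (s : σ) (φ : (σ →₀ ℕ) → M) :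
    (∑ e ∈ wtSet w n, if e s ≠ 0 then φ (e - Finsupp.single s 1) else 0) =
      ∑ e ∈ wtSet w (n - w s), φ e := by
  classical
  rw [← Finset.sum_filter]
  have key : ∀ e : σ →₀ ℕ, e s ≠ 0 → e - Finsupp.single s 1 + Finsupp.single s 1 = e := fun e h =>
    tsub_add_cancel_of_le (by simpa using Nat.one_le_iff_ne_zero.2 h)
  refine Finset.sum_nbij' (fun e => e - Finsupp.single s 1) (fun e => e + Finsupp.single s 1)
    ?_ ?_ ?_ ?_ ?_
  · intro e he
    simp only [Finset.mem_filter, mem_wtSet] at he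
    have := weight_add_single w (e - Finsupp.single s 1) s
    rw [key e he.2] at this
    simp only [mem_wtSet]
    omega
  · intro e he
    simp only [mem_wtSet] at he
    simp only [Finset.mem_filter, mem_wtSet, weight_add_single]
    refine ⟨by push_cast; omega, by simp⟩
  · intro e he
    simp only [Finset.mem_filter, mem_wtSet] at he
    exact key e he.2
  · intro e _
    simp
  · intro e _
    rfl

/-- Taylor's formula: the coefficients of `exp (∑ₛ qₛ T ^ wₛ ∂ₛ) F`. -/
theorem coeff_shiftHom (F : MvPolynomial σ ℂ) (n : ℕ) (d : σ →₀ ℕ) :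
    coeff d ((shiftHom w q F).coeff n) =
      ∑ e ∈ wtSet w n, shiftCoeff q d e * coeff (d + e) F := by
  classical
  induction F using MvPolynomial.induction_on generalizing n d with
  | C c =>
    rw [shiftHom_C, Polynomial.coeff_C]
    by_cases hn : n = 0
    · subst hn
      have h0 : wtSet w ((0 : ℕ) : ℤ) = {0} := by
        ext e
        simp only [mem_wtSet, Finset.mem_singleton]
        constructor
        · intro h
          ext s
          have := Finsupp.le_weight w (IsGrading.pos (w := w) s).ne' e
          simp
          omega
        · rintro rfl; simp
      rw [h0]
      simp
    · rw [if_neg hn, coeff_zero, Finset.sum_eq_zero]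
      intro e he
      rw [coeff_C, if_neg, mul_zero]
      intro h
      have h1 : e = 0 := by
        ext s
        have := DFunLike.congr_fun h s
        simp at this ⊢
        omega
      simp [h1] at he
      omega
  | add F G hF hG => simp [hF, hG, mul_add, Finset.sum_add_distrib]
  | mul_X F s hF =>
    simp_rw [shiftCoeff_pascal q d _ s F]
    rw [Finset.sum_add_distrib]
    rw [sum_wtSet_sub_single w n s (fun e => q s * shiftCoeff q d e * coeff (d + e) F)]
    rw [map_mul, shiftHom_X, mul_add, Polynomial.coeff_add, coeff_add, Polynomial.coeff_mul_C]
    congr 1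
    · rw [coeff_mul_X', hF]
      by_cases h : d s = 0
      · simp [h]
      · simp [h]
    · rw [mul_left_comm, Polynomial.coeff_C_mul, coeff_C_mul, Polynomial.coeff_mul_X_pow']
      split_ifs with h
      · rw [hF, Nat.cast_sub h, Finset.mul_sum]
        refine Finset.sum_congr rfl fun e _ => by ring
      · rw [coeff_zero, mul_zero, Finset.sum_eq_zero]
        intro e he
        simp only [mem_wtSet] at he
        omega

end Graded

/-! ### Euler recurrences for exponentials and translations. -/

section Euler

variable {σ : Type*} (w : σ → ℕ) [IsGrading w] (p q : σ → ℂ)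

theorem weight_eq_sum_of_le (e : σ →₀ ℕ) (n : ℕ) (he : Finsupp.weight w e ≤ n) :
    (Finsupp.weight w e : ℂ) =
      ∑ i ∈ Finset.range (n + 1), ∑ s ∈ fiber w i, (w s : ℂ) * (e s : ℂ) := by
  classical
  rw [Finset.sum_sigma', Finsupp.weight_apply, Finsupp.sum]
  push_cast
  refine Finset.sum_bij_ne_zero (fun s _ _ => ⟨w s, s⟩) ?_ ?_ ?_ ?_
  · intro s hs _
    have := Finsupp.le_weight_of_ne_zero' w (Finsupp.mem_support_iff.1 hs)
    simp
    omega
  · rintro s _ _ s' _ _ h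
    simpa using congrArg Sigma.snd h
  · rintro ⟨i, s⟩ hs h
    simp only [Finset.mem_sigma, mem_fiber] at hs
    refine ⟨s, ?_, ?_, ?_⟩
    · rw [Finsupp.mem_support_iff]
      rintro h0
      simp [h0] at h
    · simpa [mul_comm] using h
    · simp [hs.2]
  · intro s _ _
    simp [mul_comm]

/-- The component of degree `n` of `∑ₛ wₛ pₛ tₛ`. -/
def linPoly (n : ℕ) : MvPolynomial σ ℂ := ∑ s ∈ fiber w n, C ((w s : ℂ) * p s) * X s

/-- The component of degree `-n` of `∑ₛ wₛ qₛ ∂ₛ`. -/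
def linDer (n : ℕ) : MvPolynomial σ ℂ →ₗ[ℂ] MvPolynomial σ ℂ :=
  ∑ s ∈ fiber w n, ((w s : ℂ) * q s) • (pderiv s).toLinearMap

theorem linDer_apply (n : ℕ) (F : MvPolynomial σ ℂ) :
    linDer w q n F = ∑ s ∈ fiber w n, ((w s : ℂ) * q s) • pderiv s F := by
  simp [linDer]

/-- The Euler operator `∑ wₛ tₛ ∂ₛ` multiplies the component of degree `n` by `n`, and it multiplies
`exp (∑ pₛ tₛ)` by `∑ wₛ pₛ tₛ`. With the initial value this recurrence determines all components,
which spares multinomial expansions later. -/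
theorem expPoly_euler (n : ℕ) :
    (n : MvPolynomial σ ℂ) * expPoly w p n =
      ∑ i ∈ Finset.range (n + 1), linPoly w p i * expPoly w p ((n : ℤ) - i) := by
  classical
  ext a
  rw [← map_natCast (C : ℂ →+* MvPolynomial σ ℂ), coeff_C_mul, coeff_expPoly]
  have key : ∀ i : ℕ, coeff a (linPoly w p i * expPoly w p ((n : ℤ) - i)) =
      if (Finsupp.weight w a : ℤ) = n then
        ∑ s ∈ fiber w i, (w s : ℂ) * (a s : ℂ) * expCoeff p a else 0 := by
    intro i
    rw [linPoly, Finset.sum_mul, coeff_sum]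
    have : ∀ s ∈ fiber w i, coeff a (C ((w s : ℂ) * p s) * X s * expPoly w p ((n : ℤ) - i)) =
        if (Finsupp.weight w a : ℤ) = n then (w s : ℂ) * (a s : ℂ) * expCoeff p a else 0 := by
      intro s hs
      rw [mem_fiber] at hs
      rw [mul_assoc, coeff_C_mul, mul_comm (X s), coeff_mul_X']
      by_cases h : a s = 0
      · simp [h]
      · obtain ⟨b, rfl⟩ : ∃ b, a = b + Finsupp.single s 1 :=
          ⟨a - Finsupp.single s 1, (tsub_add_cancel_of_le
            (by simpa using Nat.one_le_iff_ne_zero.2 h)).symm⟩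
        rw [if_pos (by simp), add_tsub_cancel_right, coeff_expPoly, weight_add_single]
        by_cases h2 : (Finsupp.weight w b : ℤ) = n - i
        · rw [if_pos h2, if_pos (by push_cast; omega)]
          have := expCoeff_add_single p b s
          simp only [Finsupp.add_apply, Finsupp.single_eq_same]
          push_cast
          linear_combination -(w s : ℂ) * this
        · rw [if_neg h2, if_neg (by push_cast; omega), mul_zero]
    rw [Finset.sum_congr rfl this]
    split_ifs <;> simp
  rw [coeff_sum, Finset.sum_congr rfl fun i _ => key i]
  split_ifs with h
  · simp_rw [← Finset.sum_mul]
    rw [← weight_eq_sum_of_le w a n (by omega)]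
    have : Finsupp.weight w a = n := by omega
    rw [this]
  · simp

theorem shiftCoeff_add_single (d e : σ →₀ ℕ) (s : σ) :
    ((e s : ℂ) + 1) * shiftCoeff q d (e + Finsupp.single s 1) =
      q s * ((d s : ℂ) + e s + 1) * shiftCoeff q d e := by
  unfold shiftCoeff
  rw [prod_erase_mul _ s _ (by simp), prod_erase_mul e s _ (by simp), erase_add_single]
  simp only [Finsupp.add_apply, Finsupp.single_eq_same]
  have h := Nat.add_one_mul_choose_eq (d s + e s) (e s)
  have h' : ((d s : ℂ) + e s + 1) * ((d s + e s).choose (e s) : ℂ) =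
      ((d s + (e s + 1)).choose (e s + 1) : ℂ) * ((e s : ℂ) + 1) := by
    rw [← add_assoc]; exact_mod_cast h
  rw [pow_succ]
  linear_combination (-(q s ^ e s * q s) * (e.erase s).prod
    (fun s j => q s ^ j * ((d s + j).choose j : ℂ))) * h'

/-- Applying `T d/dT` to `exp (∑ qₛ T ^ wₛ ∂ₛ) F` brings down `∑ wₛ qₛ T ^ wₛ ∂ₛ`, which commutes
with the exponential. -/
theorem shiftHom_euler (F : MvPolynomial σ ℂ) (n : ℕ) :
    (n : MvPolynomial σ ℂ) * (shiftHom w q F).coeff n =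
      ∑ i ∈ Finset.range (n + 1), (shiftHom w q (linDer w q i F)).coeff (n - i) := by
  classical
  ext d
  rw [← map_natCast (C : ℂ →+* MvPolynomial σ ℂ), coeff_C_mul, coeff_shiftHom, coeff_sum]
  have key : ∀ i ∈ Finset.range (n + 1),
      coeff d ((shiftHom w q (linDer w q i F)).coeff (n - i)) =
      ∑ e ∈ wtSet w n, ∑ s ∈ fiber w i, (w s : ℂ) * (e s : ℂ) *
        (shiftCoeff q d e * coeff (d + e) F) := by
    intro i hi
    rw [linDer_apply, map_sum, Polynomial.finsetSum_coeff, coeff_sum, Finset.sum_comm]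
    refine Finset.sum_congr rfl fun s hs => ?_
    rw [mem_fiber] at hs
    rw [map_smul, Polynomial.coeff_smul, coeff_smul, coeff_shiftHom, Finset.smul_sum]
    have hn : ((n - i : ℕ) : ℤ) = (n : ℤ) - w s := by
      rw [Finset.mem_range] at hi; omega
    rw [hn, ← sum_wtSet_sub_single w n s (fun e => ((w s : ℂ) * q s) •
      (shiftCoeff q d e * coeff (d + e) (pderiv s F)))]
    refine Finset.sum_congr rfl fun e _ => ?_
    by_cases h : e s = 0
    · simp [h]
    · obtain ⟨b, rfl⟩ : ∃ b, e = b + Finsupp.single s 1 :=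
          ⟨e - Finsupp.single s 1, (tsub_add_cancel_of_le
            (by simpa using Nat.one_le_iff_ne_zero.2 h)).symm⟩
      rw [if_pos (by simp), add_tsub_cancel_right, coeff_pderiv]
      have := shiftCoeff_add_single q d b s
      simp only [Finsupp.add_apply, Finsupp.single_eq_same, smul_eq_mul, ← add_assoc]
      push_cast
      linear_combination (-(w s : ℂ) * coeff (d + b + Finsupp.single s 1) F) * this
  rw [Finset.sum_congr rfl key, Finset.sum_comm, Finset.mul_sum]
  refine Finset.sum_congr rfl fun e he => ?_
  simp_rw [← Finset.sum_mul]
  rw [mem_wtSet] at he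
  rw [← weight_eq_sum_of_le w e n (by omega)]
  have : Finsupp.weight w e = n := by omega
  rw [this]

end Euler

/-! ### Composition laws and contractions. -/

section Calculus

/-- Since `L 0 = 0`, the right-hand side involves only earlier values, and `n > 0` can be cancelled
in a domain of characteristic zero. -/
theorem eq_of_euler {A : Type*} [CommRing A] [IsDomain A] [CharZero A] {f g L : ℕ → A}
    (hL : L 0 = 0) (h0 : f 0 = g 0)
    (hf : ∀ n : ℕ, (n : A) * f n = ∑ i ∈ Finset.range (n + 1), L i * f (n - i))
    (hg : ∀ n : ℕ, (n : A) * g n = ∑ i ∈ Finset.range (n + 1), L i * g (n - i)) (n : ℕ) :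
    f n = g n := by
  induction n using Nat.strong_induction_on with
  | _ n ih =>
    rcases Nat.eq_zero_or_pos n with rfl | hn
    · exact h0
    · have : (n : A) * f n = (n : A) * g n := by
        rw [hf, hg]
        refine Finset.sum_congr rfl fun i _ => ?_
        rcases Nat.eq_zero_or_pos i with rfl | hi
        · simp [hL]
        · rw [ih (n - i) (by omega)]
      exact mul_left_cancel₀ (Nat.cast_ne_zero.2 hn.ne') this

/-- The hypotheses say `x f' = L f` and `x g' = L' g` for the generating series; logarithmic
derivatives add under products. -/
theorem euler_mul {A : Type*} [CommRing A] {f g L L' : ℕ → A}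
    (hf : ∀ n : ℕ, (n : A) * f n = ∑ i ∈ Finset.range (n + 1), L i * f (n - i))
    (hg : ∀ n : ℕ, (n : A) * g n = ∑ i ∈ Finset.range (n + 1), L' i * g (n - i)) (n : ℕ) :
    (n : A) * ∑ x ∈ antidiagonal n, f x.1 * g x.2 =
      ∑ i ∈ Finset.range (n + 1), (L i + L' i) *
        ∑ x ∈ antidiagonal (n - i), f x.1 * g x.2 := by
  have key : ∀ (u l : ℕ → A), (∀ n : ℕ, (n : A) * u n = ∑ i ∈ Finset.range (n + 1), l i * u (n - i)) →
      PowerSeries.X * PowerSeries.derivative A (PowerSeries.mk u) =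
        PowerSeries.mk l * PowerSeries.mk u := by
    intro u l h
    ext n
    rw [PowerSeries.coeff_mul (φ := PowerSeries.mk l)]
    simp only [PowerSeries.coeff_mk]
    rw [Finset.Nat.sum_antidiagonal_eq_sum_range_succ (fun i j => l i * u j), ← h]
    cases n with
    | zero => simp
    | succ n =>
      rw [PowerSeries.coeff_succ_X_mul, PowerSeries.coeff_derivative]
      simp [mul_comm]
  have h : PowerSeries.X * PowerSeries.derivative A (PowerSeries.mk f * PowerSeries.mk g) =
      (PowerSeries.mk L + PowerSeries.mk L') * (PowerSeries.mk f * PowerSeries.mk g) := by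
    rw [Derivation.leibniz, smul_eq_mul, smul_eq_mul]
    linear_combination PowerSeries.mk g * key f L hf + PowerSeries.mk f * key g L' hg
  have h2 := congrArg (PowerSeries.coeff n) h
  rw [PowerSeries.coeff_mul (φ := _ + _)] at h2
  simp only [map_add, PowerSeries.coeff_mk, PowerSeries.coeff_mul (φ := PowerSeries.mk f)] at h2
  rw [Finset.Nat.sum_antidiagonal_eq_sum_range_succ (fun i j => (L i + L' i) *
    ∑ x ∈ antidiagonal j, f x.1 * g x.2)] at h2
  rw [← h2]
  cases n with
  | zero => simp
  | succ n =>
    rw [PowerSeries.coeff_succ_X_mul, PowerSeries.coeff_derivative]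
    simp [PowerSeries.coeff_mul, mul_comm]

variable {σ : Type*} (w : σ → ℕ) [IsGrading w] (p p' q q' : σ → ℂ)

theorem linPoly_zero : linPoly w p 0 = 0 := by
  rw [linPoly, Finset.sum_eq_zero]
  intro s hs
  rw [mem_fiber] at hs
  simp [hs]

theorem expPoly_euler_nat (n : ℕ) :
    (n : MvPolynomial σ ℂ) * expPoly w p n =
      ∑ i ∈ Finset.range (n + 1), linPoly w p i * expPoly w p ((n - i : ℕ) : ℤ) := by
  rw [expPoly_euler]
  refine Finset.sum_congr rfl fun i hi => ?_
  rw [Nat.cast_sub (by simpa [Nat.lt_succ_iff] using hi)]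

theorem expPoly_add (n : ℕ) : expPoly w (p + p') n =
    ∑ x ∈ antidiagonal n, expPoly w p x.1 * expPoly w p' x.2 := by
  refine eq_of_euler (A := MvPolynomial σ ℂ) (L := linPoly w (p + p'))
    (f := fun n : ℕ => expPoly w (p + p') n)
    (g := fun n : ℕ => ∑ x ∈ antidiagonal n, expPoly w p x.1 * expPoly w p' x.2)
    (linPoly_zero w _) (by simp [expPoly_zero]) (expPoly_euler_nat w _) (fun n => ?_) n
  rw [euler_mul (expPoly_euler_nat w p) (expPoly_euler_nat w p')]
  refine Finset.sum_congr rfl fun i _ => ?_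
  congr 1
  simp [linPoly, mul_add, add_mul, Finset.sum_add_distrib]

theorem prod_pow_weight (ω : ℂ) (a : σ →₀ ℕ) (φ : σ → ℕ → ℂ) :
    (a.prod fun s n => (ω ^ w s) ^ n * φ s n) = ω ^ Finsupp.weight w a * a.prod φ := by
  rw [Finsupp.prod_mul, Finsupp.weight_apply, Finsupp.prod, Finsupp.sum]
  congr 1
  rw [← Finset.prod_pow_eq_pow_sum]
  refine Finset.prod_congr rfl fun s _ => ?_
  rw [← pow_mul, smul_eq_mul, mul_comm]

theorem expPoly_scale (ω : ℂ) (n : ℕ) :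
    expPoly w (fun s => ω ^ w s * p s) n = C (ω ^ n) * expPoly w p n := by
  ext a
  rw [coeff_C_mul, coeff_expPoly, coeff_expPoly]
  split_ifs with h
  · have h' : Finsupp.weight w a = n := by omega
    rw [← h', expCoeff, expCoeff, ← prod_pow_weight]
    refine Finsupp.prod_congr fun s _ => by rw [mul_pow, mul_div_assoc]
  · simp

theorem shiftHom_scale (ω : ℂ) (n : ℕ) (F : MvPolynomial σ ℂ) :
    (shiftHom w (fun s => ω ^ w s * q s) F).coeff n = C (ω ^ n) * (shiftHom w q F).coeff n := by
  ext a
  rw [coeff_C_mul, coeff_shiftHom, coeff_shiftHom, Finset.mul_sum]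
  refine Finset.sum_congr rfl fun e he => ?_
  rw [mem_wtSet] at he
  have h' : Finsupp.weight w e = n := by omega
  rw [← h', ← mul_assoc, shiftCoeff, shiftCoeff, ← prod_pow_weight]
  congr 1
  refine Finsupp.prod_congr fun s _ => by rw [mul_pow, mul_assoc]

theorem shiftHom_add_eq_eval₂ (F : MvPolynomial σ ℂ) : shiftHom w (q + q') F =
    Polynomial.eval₂ (shiftHom w q).toRingHom Polynomial.X (shiftHom w q' F) := by
  have h : (shiftHom w (q + q')).toRingHom =
      (Polynomial.eval₂RingHom (shiftHom w q).toRingHom Polynomial.X).comp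
        (shiftHom w q').toRingHom := by
    refine MvPolynomial.ringHom_ext (fun c => ?_) fun s => ?_
    · simp
    · simp [shiftHom_X, add_mul, add_assoc]
  exact DFunLike.congr_fun h F

theorem shiftHom_add (F : MvPolynomial σ ℂ) (n : ℕ) : (shiftHom w (q + q') F).coeff n =
    ∑ x ∈ antidiagonal n, (shiftHom w q ((shiftHom w q' F).coeff x.2)).coeff x.1 := by
  rw [shiftHom_add_eq_eval₂]
  rw [Polynomial.eval₂_eq_sum, Polynomial.sum_over_range' _ (by simp)
    (max (n + 1) ((shiftHom w q' F).natDegree + 1)) (by omega), Polynomial.finsetSum_coeff]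
  rw [Finset.Nat.sum_antidiagonal_eq_sum_range_succ
    (fun i j => (shiftHom w q ((shiftHom w q' F).coeff j)).coeff i),
    ← Finset.sum_range_reflect _ (n + 1)]
  symm
  refine Finset.sum_subset_zero_on_sdiff (Finset.range_mono (le_max_left _ _)) ?_ ?_
  · intro i hi
    simp only [Finset.mem_sdiff, Finset.mem_range] at hi
    rw [Polynomial.coeff_mul_X_pow', if_neg (by omega)]
  · intro i hi
    simp only [Finset.mem_range] at hi
    rw [Polynomial.coeff_mul_X_pow', if_pos (by omega)]
    have h1 : n - (n + 1 - 1 - i) = i := by omega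
    have h2 : n + 1 - 1 - i = n - i := by omega
    rw [h1, h2]
    rfl

theorem coeff_coeff_swap {R : Type*} [CommRing R] (P : Polynomial (Polynomial R)) (i j : ℕ) :
    ((Polynomial.Bivariate.swap P).coeff i).coeff j = (P.coeff j).coeff i := by
  induction P using Polynomial.induction_on' generalizing i j with
  | add P Q hP hQ => simp [hP, hQ]
  | monomial n f =>
    induction f using Polynomial.induction_on' generalizing i j with
    | add f g hf hg => simp [hf, hg]
    | monomial m r =>
      rw [Polynomial.Bivariate.swap_monomial_monomial]
      simp only [Polynomial.coeff_monomial]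
      split_ifs <;> simp_all [Polynomial.coeff_monomial]

/-- With separate parameters, both composites are ring homomorphisms into polynomials in two
indeterminates. They are compared on generators after the two indeterminates are exchanged. -/
theorem shiftHom_comm (F : MvPolynomial σ ℂ) (i j : ℕ) :
    (shiftHom w q ((shiftHom w q' F).coeff j)).coeff i =
      (shiftHom w q' ((shiftHom w q F).coeff i)).coeff j := by
  have h : (Polynomial.mapRingHom (shiftHom w q).toRingHom).comp (shiftHom w q').toRingHom =
      ((Polynomial.Bivariate.swap (R := MvPolynomial σ ℂ)).toRingEquiv.toRingHom).comp
        ((Polynomial.mapRingHom (shiftHom w q').toRingHom).comp (shiftHom w q).toRingHom) := by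
    refine MvPolynomial.ringHom_ext (fun c => ?_) fun s => ?_
    · simp [Polynomial.Bivariate.swap_C_C]
    · simp [shiftHom_X, Polynomial.Bivariate.swap_C_C, Polynomial.Bivariate.swap_X,
        Polynomial.Bivariate.swap_Y]
      ring
  have h1 := congrArg (fun P => (P.coeff j).coeff i) (DFunLike.congr_fun h F)
  simpa [coeff_coeff_swap] using h1

theorem prod_eq_of_support_subset (A : Finset σ) (a : σ →₀ ℕ) (h : a.support ⊆ A) (φ : σ → ℕ → ℂ)
    (h0 : ∀ s, φ s 0 = 1) : a.prod φ = ∏ s ∈ A, φ s (a s) :=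
  Finsupp.prod_of_support_subset _ h _ fun s _ => h0 s

theorem shiftCoeff_mul_expCoeff (d e : σ →₀ ℕ) :
    shiftCoeff q d e * expCoeff p (d + e) = expCoeff (fun s => p s * q s) e * expCoeff p d := by
  classical
  have hd : d.support ⊆ d.support ∪ e.support := Finset.subset_union_left
  have he : e.support ⊆ d.support ∪ e.support := Finset.subset_union_right
  unfold shiftCoeff expCoeff
  rw [prod_eq_of_support_subset _ e he _ (by simp), prod_eq_of_support_subset _ e he _ (by simp),
    prod_eq_of_support_subset _ d hd _ (by simp),
    prod_eq_of_support_subset _ (d + e) Finsupp.support_add _ (by simp),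
    ← Finset.prod_mul_distrib, ← Finset.prod_mul_distrib]
  refine Finset.prod_congr rfl fun s _ => ?_
  have h := Nat.add_choose_mul_factorial_mul_factorial (d s) (e s)
  have h1 : ((d s).factorial : ℂ) ≠ 0 := Nat.cast_ne_zero.2 (Nat.factorial_ne_zero _)
  have h2 : ((e s).factorial : ℂ) ≠ 0 := Nat.cast_ne_zero.2 (Nat.factorial_ne_zero _)
  have h3 : ((d s + e s).factorial : ℂ) ≠ 0 := Nat.cast_ne_zero.2 (Nat.factorial_ne_zero _)
  have h' : ((d s + e s).choose (e s) : ℂ) * (d s).factorial * (e s).factorial =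
    (d s + e s).factorial := by exact_mod_cast h
  rw [Finsupp.add_apply]
  field_simp
  rw [pow_add]
  linear_combination (p s ^ e s * p s ^ d s * q s ^ e s) * h'

/-- The coefficient of `T ^ i` in `exp (∑ₛ pₛ qₛ T ^ wₛ)`. -/
def contr (i : ℕ) : ℂ := ∑ e ∈ wtSet w i, expCoeff (fun s => p s * q s) e

/-- The exponential `exp (∑ pₛ tₛ)` is an eigenvector of translations with eigenvalue `exp (∑ pₛ qₛ
T ^ wₛ)`. This scalar is the contraction that arises when derivatives move past multiplications. -/
theorem shiftHom_expPoly (n : ℤ) (i : ℕ) :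
    (shiftHom w q (expPoly w p n)).coeff i = C (contr w p q i) * expPoly w p (n - i) := by
  ext d
  rw [coeff_shiftHom, coeff_C_mul, coeff_expPoly, contr, Finset.sum_mul]
  refine Finset.sum_congr rfl fun e he => ?_
  rw [mem_wtSet] at he
  rw [coeff_expPoly, map_add]
  by_cases h : (Finsupp.weight w d : ℤ) = n - i
  · rw [if_pos (by push_cast; omega), if_pos h, shiftCoeff_mul_expCoeff]
  · rw [if_neg (by push_cast; omega), if_neg h, mul_zero, mul_zero]

theorem contr_eq_eval (i : ℕ) :
    contr w p q i = eval (fun _ => 1) (expPoly w (fun s => p s * q s) i) := by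
  simp [contr, expPoly, eval_monomial]

theorem contr_zero : contr w p q 0 = 1 := by
  rw [contr_eq_eval]; simp [expPoly_zero]

theorem contr_euler (n : ℕ) :
    (n : ℂ) * contr w p q n = ∑ i ∈ Finset.range (n + 1),
      (∑ s ∈ fiber w i, (w s : ℂ) * (p s * q s)) * contr w p q (n - i) := by
  have h := congrArg (eval (fun _ => (1 : ℂ))) (expPoly_euler_nat w (fun s => p s * q s) n)
  simp only [map_mul, map_natCast, map_sum, ← contr_eq_eval] at h
  rw [h]
  refine Finset.sum_congr rfl fun i _ => ?_
  simp [linPoly]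

/-- All monomials of `F` have weight at most `M`. -/
def WtLE (M : ℕ) (F : MvPolynomial σ ℂ) : Prop :=
  ∀ f, M < Finsupp.weight w f → coeff f F = 0

variable {w} in
theorem WtLE.shiftHom {M : ℕ} {F : MvPolynomial σ ℂ} (h : WtLE w M F) (n : ℕ) :
    WtLE w M ((shiftHom w q F).coeff n) := by
  intro d hd
  rw [coeff_shiftHom]
  refine Finset.sum_eq_zero fun e _ => ?_
  rw [h _ (by rw [map_add]; omega), mul_zero]

variable {w} in
theorem WtLE.shiftHom_eq_zero {M : ℕ} {F : MvPolynomial σ ℂ} (h : WtLE w M F) {n : ℕ}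
    (hn : M < n) : (KacWakimotoD.shiftHom w q F).coeff n = 0 := by
  ext d
  rw [coeff_shiftHom, coeff_zero]
  refine Finset.sum_eq_zero fun e he => ?_
  rw [mem_wtSet] at he
  rw [h _ (by rw [map_add]; omega), mul_zero]

theorem exists_wtLE (F : MvPolynomial σ ℂ) : ∃ M, WtLE w M F := by
  refine ⟨F.support.sup (Finsupp.weight w), fun f hf => ?_⟩
  by_contra h
  exact absurd (Finset.le_sup (f := Finsupp.weight w) (mem_support_iff.2 h)) (by omega)

end Calculus

/-! ### Change of weights by a constant factor. -/

section Rescale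

variable {σ : Type*} (w w' : σ → ℕ) [IsGrading w] [IsGrading w'] (p q : σ → ℂ) {c : ℕ}

/-- Variables with charge zero do not enter the exponential, so the two weights need to be
proportional only on the support of the charges. -/
theorem expPoly_rescale (hc : 0 < c) (h : ∀ s, p s ≠ 0 → w' s = c * w s) (n : ℤ) :
    expPoly w' p (c * n) = expPoly w p n := by
  ext a
  rw [coeff_expPoly, coeff_expPoly]
  by_cases h0 : expCoeff p a = 0
  · simp [h0]
  · have : Finsupp.weight w' a = c * Finsupp.weight w a := by
      rw [Finsupp.weight_apply, Finsupp.weight_apply, Finsupp.sum, Finsupp.sum, Finset.mul_sum]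
      refine Finset.sum_congr rfl fun s hs => ?_
      rw [h s, smul_eq_mul, smul_eq_mul]
      · ring
      · intro hp
        apply h0
        refine Finset.prod_eq_zero hs ?_
        rw [Finsupp.mem_support_iff] at hs
        simp [hp, hs]
    rw [this]
    push_cast
    congr 1
    simp [hc.ne']

theorem shiftHom_rescale (h : ∀ s, q s ≠ 0 → w' s = c * w s) (F : MvPolynomial σ ℂ) :
    shiftHom w' q F = Polynomial.expand (MvPolynomial σ ℂ) c (shiftHom w q F) := by
  have h : (shiftHom w' q).toRingHom =
      (Polynomial.expand (MvPolynomial σ ℂ) c).toRingHom.comp (shiftHom w q).toRingHom := by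
    refine MvPolynomial.ringHom_ext (fun c => ?_) fun s => ?_
    · simp
    · by_cases hq : q s = 0
      · simp [shiftHom_X, hq]
      · simp [shiftHom_X, h s hq, pow_mul]
  exact DFunLike.congr_fun h F

end Rescale

/-! ### Modes of vertex operators and normal ordering. -/

section VertexOperators

variable {σ : Type*} (w : σ → ℕ) [IsGrading w] (p p' q q' : σ → ℂ)

/-- The component of degree `-k` of the vertex operator
`exp (∑ₛ pₛ tₛ z ^ wₛ) exp (∑ₛ qₛ z ^ (-wₛ) ∂ₛ)`, acting on polynomials. -/
def vertexMode (k : ℤ) : MvPolynomial σ ℂ →ₗ[ℂ] MvPolynomial σ ℂ :=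
  (Polynomial.lsum fun i : ℕ => LinearMap.mulLeft ℂ (expPoly w p (i - k))) ∘ₗ
    (shiftHom w q).toLinearMap

variable {w} in
theorem WtLE.natDegree_shiftHom {M : ℕ} {F : MvPolynomial σ ℂ} (h : WtLE w M F) :
    (KacWakimotoD.shiftHom w q F).natDegree ≤ M :=
  Polynomial.natDegree_le_iff_coeff_eq_zero.2 fun _ hn => h.shiftHom_eq_zero q hn

theorem vertexMode_eq_sum {M : ℕ} {F : MvPolynomial σ ℂ} (h : (shiftHom w q F).natDegree ≤ M)
    (k : ℤ) : vertexMode w p q k F =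
      ∑ i ∈ Finset.range (M + 1), expPoly w p (i - k) * (shiftHom w q F).coeff i := by
  change Polynomial.sum (shiftHom w q F) _ = _
  rw [Polynomial.sum_over_range' _ (by simp) (M + 1) (by omega)]
  rfl

/-- Translation is multiplicative, so the factors can be translated separately. In the composition
of two modes `U` is a component of the inner exponential. -/
theorem vertexMode_mul {K M : ℕ} {U H : MvPolynomial σ ℂ} (hU : (shiftHom w q U).natDegree ≤ K)
    (hH : (shiftHom w q H).natDegree ≤ M) (k : ℤ) :
    vertexMode w p q k (U * H) = ∑ a ∈ Finset.range (K + 1), ∑ b ∈ Finset.range (M + 1),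
      expPoly w p ((a : ℤ) + b - k) * ((shiftHom w q U).coeff a * (shiftHom w q H).coeff b) := by
  change Polynomial.lsum _ (shiftHom w q (U * H)) = _
  rw [map_mul]
  conv_lhs => rw [Polynomial.as_sum_range' (shiftHom w q U) (K + 1) (by omega),
    Polynomial.as_sum_range' (shiftHom w q H) (M + 1) (by omega)]
  rw [Finset.sum_mul_sum, map_sum]
  refine Finset.sum_congr rfl fun a _ => ?_
  rw [map_sum]
  refine Finset.sum_congr rfl fun b _ => ?_
  rw [Polynomial.monomial_mul_monomial, Polynomial.lsum_apply, Polynomial.sum_monomial_index]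
  · simp
  · simp

/-- The component of bidegree `(κ, -κ)` of the normally ordered product of two vertex operators,
applied to a polynomial of weight at most `M`. -/
def normalPair (M : ℕ) (F : MvPolynomial σ ℂ) (κ : ℤ) : MvPolynomial σ ℂ :=
  ∑ b ∈ Finset.range (M + 1), ∑ b' ∈ Finset.range (M + 1),
    expPoly w p (b + κ) * expPoly w p' (b' - κ) *
      (shiftHom w q ((shiftHom w q' F).coeff b')).coeff b

-- For `b, b' ≤ M` and `|κ| > M` one of the two exponentials is taken in negative degree. Hence all
-- sums over `κ` are finite.
variable {w p p' q q'} in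
theorem normalPair_eq_zero {M : ℕ} {F : MvPolynomial σ ℂ} {κ : ℤ} (hκ : (M : ℤ) < |κ|) :
    normalPair w p p' q q' M F κ = 0 := by
  refine Finset.sum_eq_zero fun b hb => Finset.sum_eq_zero fun b' hb' => ?_
  rw [Finset.mem_range] at hb hb'
  rcases lt_abs.1 hκ with h | h
  · rw [expPoly_of_neg w p' (by omega)]; simp
  · rw [expPoly_of_neg w p (by omega)]; simp

theorem normalPair_symm {M : ℕ} {F : MvPolynomial σ ℂ} (κ : ℤ) :
    normalPair w p p' q q' M F κ = normalPair w p' p q' q M F (-κ) := by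
  unfold normalPair
  rw [Finset.sum_comm]
  refine Finset.sum_congr rfl fun b _ => Finset.sum_congr rfl fun b' _ => ?_
  rw [shiftHom_comm w q q', sub_neg_eq_add, ← sub_eq_add_neg]
  ring

/-- The product of two vertex operators in terms of normally ordered products. -/
theorem vertexMode_comp {M K : ℕ} {F : MvPolynomial σ ℂ} (h : WtLE w M F) (j : ℤ)
    (hK : (M : ℤ) ≤ j + K) :
    vertexMode w p q (-j) (vertexMode w p' q' j F) = ∑ a ∈ Finset.range (K + 1),
      C (contr w p' q a) * normalPair w p p' q q' M F (j + a) := by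
  rw [vertexMode_eq_sum w p' q' (h.natDegree_shiftHom q'), map_sum]
  -- The inner exponential has degree `b' - j ≤ M - j ≤ K`, so contractions of degree above `K` do
  -- not occur.
  have hdeg : ∀ b' ∈ Finset.range (M + 1),
      (shiftHom w q (expPoly w p' (b' - j))).natDegree ≤ K := by
    intro b' hb'
    rw [Finset.mem_range] at hb'
    refine Polynomial.natDegree_le_iff_coeff_eq_zero.2 fun n hn => ?_
    rw [shiftHom_expPoly, expPoly_of_neg w p' (by omega), mul_zero]
  have key : ∀ b' ∈ Finset.range (M + 1),
      vertexMode w p q (-j) (expPoly w p' (b' - j) * (shiftHom w q' F).coeff b') =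
      ∑ a ∈ Finset.range (K + 1), ∑ b ∈ Finset.range (M + 1),
        C (contr w p' q a) * (expPoly w p (b + (j + a)) * expPoly w p' (b' - (j + a)) *
          (shiftHom w q ((shiftHom w q' F).coeff b')).coeff b) := by
    intro b' hb'
    rw [vertexMode_mul w p q (hdeg b' hb') ((h.shiftHom q' b').natDegree_shiftHom q)]
    refine Finset.sum_congr rfl fun a _ => Finset.sum_congr rfl fun b _ => ?_
    rw [shiftHom_expPoly, show (a : ℤ) + b - -j = b + (j + a) by ring,
      show (b' : ℤ) - j - a = b' - (j + a) by ring]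
    ring
  rw [Finset.sum_congr rfl key, Finset.sum_comm]
  refine Finset.sum_congr rfl fun a _ => ?_
  rw [normalPair, Finset.mul_sum, Finset.sum_comm]
  refine Finset.sum_congr rfl fun b _ => ?_
  rw [Finset.mul_sum]

theorem sum_square_eq_sum_antidiagonal {A : Type*} [AddCommMonoid A] (M : ℕ) (φ : ℕ → ℕ → A)
    (h : ∀ a b, M < a ∨ M < b → φ a b = 0) :
    ∑ a ∈ Finset.range (M + 1), ∑ b ∈ Finset.range (M + 1), φ a b =
      ∑ l ∈ Finset.range (2 * M + 1), ∑ x ∈ antidiagonal l, φ x.1 x.2 := by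
  rw [← Finset.sum_product', ← Finset.sum_fiberwise_of_maps_to (t := Finset.range (2 * M + 1))
    (g := fun x => x.1 + x.2) (by
      intro x hx
      simp only [Finset.mem_product, Finset.mem_range] at hx ⊢
      omega)]
  refine Finset.sum_congr rfl fun l _ => ?_
  refine Finset.sum_subset (fun x hx => ?_) fun x hx hx' => h _ _ ?_
  · simp only [Finset.mem_filter] at hx
    simpa using hx.2
  · rw [Finset.HasAntidiagonal.mem_antidiagonal] at hx
    simp only [Finset.mem_filter, Finset.mem_product, Finset.mem_range] at hx'
    omega

theorem sum_Icc_eq_sum_antidiagonal {A : Type*} [AddCommMonoid A] {M b b' : ℕ} (hb : b ≤ M)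
    (hb' : b' ≤ M) (φ : ℤ → ℤ → A) (h : ∀ m n, m < 0 ∨ n < 0 → φ m n = 0) :
    ∑ κ ∈ Finset.Icc (-(M : ℤ)) M, φ (b + κ) (b' - κ) =
      ∑ x ∈ antidiagonal (b + b'), φ x.1 x.2 := by
  symm
  refine Finset.sum_bij_ne_zero (fun x _ _ => (x.1 : ℤ) - b) ?_ ?_ ?_ ?_
  · intro x hx _
    rw [Finset.HasAntidiagonal.mem_antidiagonal] at hx
    rw [Finset.mem_Icc]
    omega
  · intro x hx _ y hy _ hxy
    rw [Finset.HasAntidiagonal.mem_antidiagonal] at hx hy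
    ext <;> omega
  · intro κ _ hne
    have h1 : 0 ≤ (b : ℤ) + κ := by
      by_contra hc
      exact hne (h _ _ (Or.inl (by omega)))
    have h2 : 0 ≤ (b' : ℤ) - κ := by
      by_contra hc
      exact hne (h _ _ (Or.inr (by omega)))
    refine ⟨(((b : ℤ) + κ).toNat, ((b' : ℤ) - κ).toNat), ?_, ?_, ?_⟩
    · rw [Finset.HasAntidiagonal.mem_antidiagonal]
      simp only
      omega
    · simp only [Int.toNat_of_nonneg h1, Int.toNat_of_nonneg h2]
      exact hne
    · simp only
      omega
  · intro x hx _
    rw [Finset.HasAntidiagonal.mem_antidiagonal] at hx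
    rw [show (b : ℤ) + (x.1 - b) = x.1 by ring, show (b' : ℤ) - (x.1 - b) = x.2 by omega]

/-- Weighting the bidegree `(κ, -κ)` by `ω ^ κ` evaluates the normally ordered product at the points
`(ω z, z)`. There it is a single vertex operator whose charges are the sums of the charges at the
two points, and its mode of degree zero is taken. -/
theorem sum_zpow_normalPair {M : ℕ} {F : MvPolynomial σ ℂ} (h : WtLE w M F) {ω : ℂ} (hω : ω ≠ 0) :
    ∑ κ ∈ Finset.Icc (-(M : ℤ)) M, C (ω ^ κ) * normalPair w p p' q q' M F κ =
      vertexMode w (fun s => ω ^ w s * p s + p' s) (fun s => ω⁻¹ ^ w s * q s + q' s) 0 F := by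
  have h2M : (shiftHom w (fun s => ω⁻¹ ^ w s * q s + q' s) F).natDegree ≤ 2 * M :=
    (h.natDegree_shiftHom _).trans (by omega)
  rw [vertexMode_eq_sum w _ _ h2M]
  have e1 : ∀ l : ℕ, expPoly w (fun s => ω ^ w s * p s + p' s) ((l : ℤ) - 0) =
      ∑ x ∈ antidiagonal l, C (ω ^ x.1) * expPoly w p x.1 * expPoly w p' x.2 := by
    intro l
    rw [sub_zero]
    have := expPoly_add w (fun s => ω ^ w s * p s) p' l
    simp_rw [expPoly_scale] at this
    exact this
  have e2 : ∀ l : ℕ, (shiftHom w (fun s => ω⁻¹ ^ w s * q s + q' s) F).coeff l =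
      ∑ x ∈ antidiagonal l, C (ω⁻¹ ^ x.1) *
        (shiftHom w q ((shiftHom w q' F).coeff x.2)).coeff x.1 := by
    intro l
    have := shiftHom_add w (fun s => ω⁻¹ ^ w s * q s) q' F l
    simp_rw [shiftHom_scale] at this
    exact this
  have e3 : ∀ l : ℕ, expPoly w (fun s => ω ^ w s * p s + p' s) ((l : ℤ) - 0) *
      (shiftHom w (fun s => ω⁻¹ ^ w s * q s + q' s) F).coeff l =
      ∑ x ∈ antidiagonal l, expPoly w (fun s => ω ^ w s * p s + p' s) (((x.1 + x.2 : ℕ) : ℤ) - 0) *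
        (C (ω⁻¹ ^ x.1) * (shiftHom w q ((shiftHom w q' F).coeff x.2)).coeff x.1) := by
    intro l
    rw [e2, Finset.mul_sum]
    refine Finset.sum_congr rfl fun x hx => ?_
    rw [Finset.HasAntidiagonal.mem_antidiagonal.1 hx]
  rw [Finset.sum_congr rfl fun l _ => e3 l,
    ← sum_square_eq_sum_antidiagonal M (fun b b' =>
      expPoly w (fun s => ω ^ w s * p s + p' s) (((b + b' : ℕ) : ℤ) - 0) *
        (C (ω⁻¹ ^ b) * (shiftHom w q ((shiftHom w q' F).coeff b')).coeff b))]
  · simp only [normalPair, Finset.mul_sum]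
    rw [Finset.sum_comm]
    refine Finset.sum_congr rfl fun b hb => ?_
    rw [Finset.sum_comm]
    refine Finset.sum_congr rfl fun b' hb' => ?_
    rw [Finset.mem_range] at hb hb'
    rw [e1, Finset.sum_mul]
    have := sum_Icc_eq_sum_antidiagonal (M := M) (b := b) (b' := b') (by omega) (by omega)
      (fun m n => C (ω ^ m) * expPoly w p m * expPoly w p' n *
        (C (ω⁻¹ ^ b) * (shiftHom w q ((shiftHom w q' F).coeff b')).coeff b)) (by
        rintro m n (h | h)
        · rw [expPoly_of_neg w p h]; simp
        · rw [expPoly_of_neg w p' h]; simp)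
    simp only [zpow_natCast] at this
    rw [← this]
    refine Finset.sum_congr rfl fun κ _ => ?_
    rw [zpow_add₀ hω, zpow_natCast, map_mul]
    have hb : (C (ω ^ b) * C (ω⁻¹ ^ b) : MvPolynomial σ ℂ) = 1 := by
      rw [← map_mul, ← mul_pow, mul_inv_cancel₀ hω, one_pow, map_one]
    linear_combination (-(C (ω ^ κ) * (expPoly w p (b + κ) * (expPoly w p' (b' - κ) *
      (shiftHom w q ((shiftHom w q' F).coeff b')).coeff b)))) * hb
  · rintro a b (h' | h')
    · rw [(h.shiftHom q' b).shiftHom_eq_zero q h']; simp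
    · rw [h.shiftHom_eq_zero q' h']; simp

end VertexOperators

/-! ### The second moment of a normally ordered product at `ω = -1`. -/

section SecondMoment

/-- From `x f' = L f` and `f g = 1` one gets `(x f') g = L`. -/
theorem conv_euler {A : Type*} [CommRing A] {f g L : ℕ → A}
    (hf : ∀ n : ℕ, (n : A) * f n = ∑ i ∈ Finset.range (n + 1), L i * f (n - i))
    (hfg : ∀ l, ∑ x ∈ antidiagonal l, f x.1 * g x.2 = if l = 0 then 1 else 0) (l : ℕ) :
    ∑ x ∈ antidiagonal l, (x.1 : A) * f x.1 * g x.2 = L l := by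
  have h1 : PowerSeries.mk (fun n => (n : A) * f n) = PowerSeries.mk L * PowerSeries.mk f := by
    ext n
    rw [PowerSeries.coeff_mul]
    simp only [PowerSeries.coeff_mk]
    rw [hf, Finset.Nat.sum_antidiagonal_eq_sum_range_succ (fun i j => L i * f j)]
  have h2 : PowerSeries.mk f * PowerSeries.mk g = 1 := by
    ext n
    rw [PowerSeries.coeff_mul, PowerSeries.coeff_one]
    simpa using hfg n
  have h3 : PowerSeries.mk (fun n => (n : A) * f n) * PowerSeries.mk g = PowerSeries.mk L := by
    rw [h1, mul_assoc, h2, mul_one]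
  have := congrArg (PowerSeries.coeff l) h3
  rw [PowerSeries.coeff_mul] at this
  simpa using this

variable {σ : Type*} (w : σ → ℕ) [IsGrading w] {p q : σ → ℂ}

/-- On odd weights the substitution `z ↦ -z` negates the charge. This is why normally ordered
products collapse at `ω = -1`. -/
theorem scale_neg_one (hp : ∀ s, p s ≠ 0 → Odd (w s)) :
    (fun s => (-1 : ℂ) ^ w s * p s) = -p := by
  funext s
  by_cases h : p s = 0
  · simp [h]
  · simp [(hp s h).neg_one_pow]

theorem expPoly_neg (hp : ∀ s, p s ≠ 0 → Odd (w s)) (n : ℕ) :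
    expPoly w (-p) n = C ((-1) ^ n) * expPoly w p n := by
  rw [← scale_neg_one w hp, expPoly_scale]

theorem shiftHom_neg (hq : ∀ s, q s ≠ 0 → Odd (w s)) (n : ℕ) (F : MvPolynomial σ ℂ) :
    (shiftHom w (-q) F).coeff n = C ((-1) ^ n) * (shiftHom w q F).coeff n := by
  rw [← scale_neg_one w hq, shiftHom_scale]

theorem expPoly_zero_charge (l : ℕ) :
    expPoly w (0 : σ → ℂ) l = if l = 0 then 1 else 0 := by
  have := eq_of_euler (A := MvPolynomial σ ℂ) (L := linPoly w 0)
    (f := fun n : ℕ => expPoly w (0 : σ → ℂ) n) (g := fun n => if n = 0 then 1 else 0)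
    (linPoly_zero w _) (by simp [expPoly_zero]) (expPoly_euler_nat w _)
    (fun n => by simp [linPoly]) l
  simpa using this

theorem shiftHom_zero_charge (F : MvPolynomial σ ℂ) : shiftHom w (0 : σ → ℂ) F = Polynomial.C F := by
  have h : (shiftHom w (0 : σ → ℂ)).toRingHom = Polynomial.C := by
    refine MvPolynomial.ringHom_ext (fun c => ?_) fun s => ?_
    · simp
    · simp [shiftHom_X]
  exact DFunLike.congr_fun h F

theorem conv_expPoly (hp : ∀ s, p s ≠ 0 → Odd (w s)) (l : ℕ) :
    ∑ x ∈ antidiagonal l, C ((-1) ^ x.1) * expPoly w p x.1 * expPoly w p x.2 =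
      if l = 0 then 1 else 0 := by
  rw [← expPoly_zero_charge w l, ← neg_add_cancel p, expPoly_add]
  simp_rw [expPoly_neg w hp]

theorem conv_expPoly_fst (hp : ∀ s, p s ≠ 0 → Odd (w s)) (l : ℕ) :
    ∑ x ∈ antidiagonal l, (x.1 : MvPolynomial σ ℂ) * (C ((-1) ^ x.1) * expPoly w p x.1) *
      expPoly w p x.2 = -linPoly w p l := by
  have h := conv_euler (A := MvPolynomial σ ℂ) (f := fun n => C ((-1) ^ n) * expPoly w p n)
    (g := fun n => expPoly w p n) (L := linPoly w (-p)) (fun n => by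
      simp_rw [← expPoly_neg w hp]; exact expPoly_euler_nat w (-p) n) (conv_expPoly w hp) l
  rw [h]
  simp [linPoly]

theorem conv_expPoly_snd (hp : ∀ s, p s ≠ 0 → Odd (w s)) (l : ℕ) :
    ∑ x ∈ antidiagonal l, (C ((-1) ^ x.1) * expPoly w p x.1) *
      ((x.2 : MvPolynomial σ ℂ) * expPoly w p x.2) = linPoly w p l := by
  have h := conv_euler (A := MvPolynomial σ ℂ) (g := fun n => C ((-1) ^ n) * expPoly w p n)
    (f := fun n => expPoly w p n) (L := linPoly w p) (expPoly_euler_nat w p) (fun l => by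
      rw [← Finset.Nat.sum_antidiagonal_swap]
      simpa [mul_comm] using conv_expPoly w hp l) l
  rw [← h, ← Finset.Nat.sum_antidiagonal_swap]
  refine Finset.sum_congr rfl fun x _ => ?_
  simp only [Prod.fst_swap, Prod.snd_swap]
  ring

theorem conv_shiftHom (hq : ∀ s, q s ≠ 0 → Odd (w s)) (F : MvPolynomial σ ℂ) (l : ℕ) :
    ∑ x ∈ antidiagonal l, C ((-1) ^ x.1) * (shiftHom w q ((shiftHom w q F).coeff x.2)).coeff x.1 =
      if l = 0 then F else 0 := by
  have h := shiftHom_add w (-q) q F l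
  rw [neg_add_cancel, shiftHom_zero_charge, Polynomial.coeff_C] at h
  rw [h]
  simp_rw [shiftHom_neg w hq]

theorem linDer_of_even (hq : ∀ s, q s ≠ 0 → Odd (w s)) {l : ℕ} (hl : Even l)
    (F : MvPolynomial σ ℂ) : linDer w q l F = 0 := by
  rw [linDer_apply, Finset.sum_eq_zero]
  intro s hs
  rw [mem_fiber] at hs
  by_cases h : q s = 0
  · simp [h]
  · exact absurd hl (Nat.not_even_iff_odd.2 (hs ▸ hq s h))

/-- By `shiftHom_euler` the factor `x.2` turns into a linear derivative applied to `F`. What remains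
is a translation composed with its inverse, and only total degree zero survives. -/
theorem conv_shiftHom_snd (hq : ∀ s, q s ≠ 0 → Odd (w s)) (F : MvPolynomial σ ℂ) (l : ℕ) :
    ∑ x ∈ antidiagonal l, C ((-1) ^ x.1) * ((x.2 : MvPolynomial σ ℂ) *
      (shiftHom w q ((shiftHom w q F).coeff x.2)).coeff x.1) = linDer w q l F := by
  have e : ∀ x : ℕ × ℕ, C ((-1) ^ x.1) * ((x.2 : MvPolynomial σ ℂ) *
      (shiftHom w q ((shiftHom w q F).coeff x.2)).coeff x.1) =
      ∑ i ∈ Finset.range (x.2 + 1), C ((-1) ^ x.1) *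
        (shiftHom w q ((shiftHom w q (linDer w q i F)).coeff (x.2 - i))).coeff x.1 := by
    intro x
    have h1 := shiftHom_euler w q F x.2
    have h2 := congrArg (fun G => (shiftHom w q G).coeff x.1) h1
    simp only [map_mul, map_natCast, map_sum, Polynomial.finsetSum_coeff] at h2
    rw [← Polynomial.C_eq_natCast, Polynomial.coeff_C_mul] at h2
    rw [h2, Finset.mul_sum]
  rw [Finset.sum_congr rfl fun x _ => e x, Finset.sum_sigma']
  have e2 : ∑ i ∈ Finset.range (l + 1), ∑ y ∈ antidiagonal (l - i), C ((-1) ^ y.1) *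
        (shiftHom w q ((shiftHom w q (linDer w q i F)).coeff y.2)).coeff y.1 =
      linDer w q l F := by
    simp_rw [conv_shiftHom w hq]
    rw [Finset.sum_range_succ, Finset.sum_eq_zero, zero_add]
    · simp
    · intro i hi
      rw [Finset.mem_range] at hi
      rw [if_neg (by omega)]
  rw [← e2, Finset.sum_sigma']
  refine Finset.sum_nbij' (fun z => ⟨z.2, (z.1.1, z.1.2 - z.2)⟩)
    (fun z => ⟨(z.2.1, z.2.2 + z.1), z.1⟩) ?_ ?_ ?_ ?_ ?_
  · rintro ⟨⟨a, b⟩, i⟩ h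
    simp at h ⊢
    omega
  · rintro ⟨i, a, b⟩ h
    simp at h ⊢
    omega
  · rintro ⟨⟨a, b⟩, i⟩ h
    simp at h ⊢
    omega
  · rintro ⟨i, a, b⟩ h
    simp
  · rintro ⟨⟨a, b⟩, i⟩ h
    rfl

theorem conv_shiftHom_fst (hq : ∀ s, q s ≠ 0 → Odd (w s)) (F : MvPolynomial σ ℂ) (l : ℕ) :
    ∑ x ∈ antidiagonal l, C ((-1) ^ x.1) * ((x.1 : MvPolynomial σ ℂ) *
      (shiftHom w q ((shiftHom w q F).coeff x.2)).coeff x.1) = -linDer w q l F := by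
  have h := conv_shiftHom_snd w hq F l
  have h2 : ∑ x ∈ antidiagonal l, C ((-1) ^ x.1) * ((x.1 : MvPolynomial σ ℂ) *
      (shiftHom w q ((shiftHom w q F).coeff x.2)).coeff x.1) =
      C ((-1) ^ l) * linDer w q l F := by
    rw [← h, ← Finset.Nat.sum_antidiagonal_swap, Finset.mul_sum]
    refine Finset.sum_congr rfl fun x hx => ?_
    rw [Finset.HasAntidiagonal.mem_antidiagonal] at hx
    simp only [Prod.fst_swap, Prod.snd_swap]
    rw [shiftHom_comm, ← hx, ← mul_assoc (C _) (C _), ← map_mul]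
    congr 2
    rw [pow_add, mul_right_comm, ← mul_pow]
    simp
  rw [h2]
  -- Exchanging the two translations costs the sign `(-1) ^ l`. It is `-1` for odd `l`, and for even
  -- `l` the derivative vanishes because only odd weights carry a charge.
  rcases Nat.even_or_odd l with hl | hl
  · simp [linDer_of_even w hq hl]
  · simp [hl.neg_one_pow]

/-- At `ω = -1` the multiplication exponentials cancel each other, and so do the translations. Of
the second derivative in `log ω` only products of a first moment of one pair with a first moment of
the other survive; these moments are `± linPoly` and `± linDer`. -/
theorem sum_sq_normalPair (hp : ∀ s, p s ≠ 0 → Odd (w s)) (hq : ∀ s, q s ≠ 0 → Odd (w s))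
    {M : ℕ} {F : MvPolynomial σ ℂ} (h : WtLE w M F) :
    ∑ κ ∈ Finset.Icc (-(M : ℤ)) M, C ((-1) ^ κ * (κ : ℂ) ^ 2) * normalPair w p p q q M F κ =
      -2 * ∑ l ∈ Finset.range (2 * M + 1), linPoly w p l * linDer w q l F := by
  set T : ℕ → ℕ → MvPolynomial σ ℂ := fun b b' =>
    (shiftHom w q ((shiftHom w q F).coeff b')).coeff b with hT
  set A11 : ℕ → MvPolynomial σ ℂ := fun l => ∑ x ∈ antidiagonal l,
    (x.1 : MvPolynomial σ ℂ) * (x.2 : MvPolynomial σ ℂ) *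
      (C ((-1) ^ x.1) * expPoly w p x.1) * expPoly w p x.2 with hA11
  have inner : ∀ b ∈ Finset.range (M + 1), ∀ b' ∈ Finset.range (M + 1),
      ∑ κ ∈ Finset.Icc (-(M : ℤ)) M, C ((-1) ^ κ * (κ : ℂ) ^ 2) *
        (expPoly w p (b + κ) * expPoly w p (b' - κ) * T b b') =
      -(linPoly w p (b + b') * (C ((-1) ^ b) * ((b' : MvPolynomial σ ℂ) * T b b'))) -
        A11 (b + b') * (C ((-1) ^ b) * T b b') +
        linPoly w p (b + b') * (C ((-1) ^ b) * ((b : MvPolynomial σ ℂ) * T b b')) := by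
    intro b hb b' hb'
    rw [Finset.mem_range] at hb hb'
    -- Since `m = b + κ` and `n = b' - κ`, the square `κ²` can be written as `(m - b)(b' - n)`,
    -- which expands into products of moments of the exponentials and of the translations.
    have h1 := sum_Icc_eq_sum_antidiagonal (M := M) (b := b) (b' := b') (by omega) (by omega)
      (fun m n => C ((-1) ^ (m - b) * (((m : ℂ) - b) * (b' - n))) *
        (expPoly w p m * expPoly w p n * T b b')) (by
        rintro m n (h | h)
        · rw [expPoly_of_neg w p h]; simp
        · rw [expPoly_of_neg w p h]; simp)
    have h2 : ∀ κ ∈ Finset.Icc (-(M : ℤ)) M, C ((-1) ^ κ * (κ : ℂ) ^ 2) *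
        (expPoly w p (b + κ) * expPoly w p (b' - κ) * T b b') =
        (fun m n : ℤ => C ((-1) ^ (m - b) * (((m : ℂ) - b) * (b' - n))) *
        (expPoly w p m * expPoly w p n * T b b')) (b + κ) (b' - κ) := by
      intro κ _
      simp only
      rw [add_sub_cancel_left]
      push_cast
      congr 2
      ring_nf
    rw [Finset.sum_congr rfl h2, h1]
    have h3 : ∀ x ∈ antidiagonal (b + b'),
        C ((-1 : ℂ) ^ ((x.1 : ℤ) - b) * ((((x.1 : ℤ) : ℂ) - b) * (b' - ((x.2 : ℤ) : ℂ)))) *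
        (expPoly w p x.1 * expPoly w p x.2 * T b b') =
        (C ((-1) ^ b) * T b b') * ((b' : MvPolynomial σ ℂ) *
          ((x.1 : MvPolynomial σ ℂ) * (C ((-1) ^ x.1) * expPoly w p x.1) * expPoly w p x.2)
          - (x.1 : MvPolynomial σ ℂ) * (x.2 : MvPolynomial σ ℂ) *
            (C ((-1) ^ x.1) * expPoly w p x.1) * expPoly w p x.2
          - (b : MvPolynomial σ ℂ) * (b' : MvPolynomial σ ℂ) *
            (C ((-1) ^ x.1) * expPoly w p x.1 * expPoly w p x.2)
          + (b : MvPolynomial σ ℂ) * ((C ((-1) ^ x.1) * expPoly w p x.1) *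
            ((x.2 : MvPolynomial σ ℂ) * expPoly w p x.2))) := by
      intro x _
      have h4 : (-1 : ℂ) ^ ((x.1 : ℤ) - b) = (-1) ^ b * (-1) ^ x.1 := by
        rw [zpow_sub₀ (by norm_num), zpow_natCast, zpow_natCast, div_eq_mul_inv, ← inv_pow,
          mul_comm]
        norm_num
      rw [h4]
      simp only [map_mul, map_sub, Int.cast_natCast, map_natCast]
      ring
    rw [Finset.sum_congr rfl h3, ← Finset.mul_sum, Finset.sum_add_distrib, Finset.sum_sub_distrib,
      Finset.sum_sub_distrib, ← Finset.mul_sum, ← Finset.mul_sum, ← Finset.mul_sum,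
      conv_expPoly w hp, conv_expPoly_fst w hp, conv_expPoly_snd w hp]
    have h5 : (b : MvPolynomial σ ℂ) * b' * (if b + b' = 0 then 1 else 0) = 0 := by
      split_ifs with h0
      · have : b = 0 := by omega
        simp [this]
      · simp
    rw [h5]
    simp only [hA11]
    ring
  have e1 : ∑ κ ∈ Finset.Icc (-(M : ℤ)) M,
      C ((-1) ^ κ * (κ : ℂ) ^ 2) * normalPair w p p q q M F κ =
      ∑ b ∈ Finset.range (M + 1), ∑ b' ∈ Finset.range (M + 1),
      (-(linPoly w p (b + b') * (C ((-1) ^ b) * ((b' : MvPolynomial σ ℂ) * T b b'))) -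
        A11 (b + b') * (C ((-1) ^ b) * T b b') +
        linPoly w p (b + b') * (C ((-1) ^ b) * ((b : MvPolynomial σ ℂ) * T b b'))) := by
    simp only [normalPair, Finset.mul_sum]
    rw [Finset.sum_comm]
    refine Finset.sum_congr rfl fun b hb => ?_
    rw [Finset.sum_comm]
    exact Finset.sum_congr rfl fun b' hb' => inner b hb b' hb'
  rw [e1, sum_square_eq_sum_antidiagonal M (fun b b' =>
      -(linPoly w p (b + b') * (C ((-1) ^ b) * ((b' : MvPolynomial σ ℂ) * T b b'))) -
        A11 (b + b') * (C ((-1) ^ b) * T b b') +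
        linPoly w p (b + b') * (C ((-1) ^ b) * ((b : MvPolynomial σ ℂ) * T b b'))), Finset.mul_sum]
  · refine Finset.sum_congr rfl fun l _ => ?_
    have e2 : ∀ x ∈ antidiagonal l,
      (-(linPoly w p (x.1 + x.2) * (C ((-1) ^ x.1) * ((x.2 : MvPolynomial σ ℂ) * T x.1 x.2))) -
        A11 (x.1 + x.2) * (C ((-1) ^ x.1) * T x.1 x.2) +
        linPoly w p (x.1 + x.2) * (C ((-1) ^ x.1) * ((x.1 : MvPolynomial σ ℂ) * T x.1 x.2))) =
      (-(linPoly w p l * (C ((-1) ^ x.1) * ((x.2 : MvPolynomial σ ℂ) * T x.1 x.2))) -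
        A11 l * (C ((-1) ^ x.1) * T x.1 x.2) +
        linPoly w p l * (C ((-1) ^ x.1) * ((x.1 : MvPolynomial σ ℂ) * T x.1 x.2))) := by
      intro x hx
      rw [Finset.HasAntidiagonal.mem_antidiagonal.1 hx]
    rw [Finset.sum_congr rfl e2, Finset.sum_add_distrib, Finset.sum_sub_distrib,
      Finset.sum_neg_distrib, ← Finset.mul_sum, ← Finset.mul_sum, ← Finset.mul_sum,
      conv_shiftHom w hq, conv_shiftHom_fst w hq, conv_shiftHom_snd w hq]
    -- The mixed second moment `A11` of the exponentials needs no evaluation: it meets the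
    -- translation pair only at `l = 0`, where `x.1 * x.2 = 0`.
    have e3 : A11 l * (if l = 0 then F else 0) = 0 := by
      split_ifs with h0
      · subst h0
        simp [hA11]
      · simp
    rw [e3]
    ring
  · rintro a b (h' | h')
    · simp [hT, (h.shiftHom q b).shiftHom_eq_zero q h']
    · simp [hT, h.shiftHom_eq_zero q h']

end SecondMoment

/-! ### Coefficients of the summed contraction and their discrete Fourier expansion. -/

section Fourier

/-- The expansion coefficients of `((1 - x) / (1 + x)) ^ 2`. -/
def sqCoeff (n : ℕ) : ℂ := if n = 0 then 1 else 4 * n * (-1) ^ n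

/-- The expansion coefficients of `(1/2) (1 + x ^ h) / (1 - x ^ h)`, in powers of `x ^ h`. -/
def halfOne (m : ℕ) : ℂ := if m = 0 then 1 / 2 else 1

/-- An `h`-periodic function, as a function of the residue modulo `h`. -/
def perPart (h ρ : ℕ) : ℂ := if ρ = 0 then 1 else (-1) ^ ρ * (2 * ρ * (h - ρ) / h)

/-- This is the Cauchy product of `(1/2)(1 + x^h)/(1 - x^h)` and `((1 - x)/(1 + x))²` with `h = 2n`.
Passing from `k` to `k + h` adds `(c_k + c_{k+h})/2`, where `c` is the second series, and this
equals the increment of the quadratic term up to the corrections at `k = 0`. -/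
theorem sum_halfOne_sqCoeff {n : ℕ} (hn : 0 < n) (κ : ℕ) :
    ∑ m ∈ Finset.range (κ / (2 * n) + 1), halfOne m * sqCoeff (κ - m * (2 * n)) =
      (if κ = 0 then -1 / 2 else 0) + (2 / (2 * n : ℕ) * (-1) ^ κ * (κ : ℂ) ^ 2 +
        perPart (2 * n) (κ % (2 * n))) := by
  have hn' : (n : ℂ) ≠ 0 := Nat.cast_ne_zero.2 hn.ne'
  induction κ using Nat.strong_induction_on with
  | _ κ ih =>
    by_cases hκ : κ < 2 * n
    · rw [Nat.div_eq_of_lt hκ, Nat.mod_eq_of_lt hκ]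
      by_cases h0 : κ = 0
      · subst h0
        simp [halfOne, sqCoeff, perPart]
        norm_num
      · simp [halfOne, sqCoeff, perPart, h0]
        field_simp
        ring
    · obtain ⟨k, rfl⟩ : ∃ k, κ = k + 2 * n := ⟨κ - 2 * n, by omega⟩
      have h1 : (k + 2 * n) / (2 * n) = k / (2 * n) + 1 := Nat.add_div_right k (by omega)
      have h2 := ih k (by omega)
      rw [h1, Nat.add_mod_right, Finset.sum_range_succ']
      have h3 : ∀ m, k + 2 * n - (m + 1) * (2 * n) = k - m * (2 * n) := by
        intro m
        rw [add_mul, one_mul, Nat.add_sub_add_right]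
      simp only [h3]
      have h4 : ∑ m ∈ Finset.range (k / (2 * n) + 1), halfOne (m + 1) * sqCoeff (k - m * (2 * n)) =
          ∑ m ∈ Finset.range (k / (2 * n) + 1), halfOne m * sqCoeff (k - m * (2 * n)) +
            sqCoeff k / 2 := by
        rw [Finset.sum_range_succ', Finset.sum_range_succ' (fun m => halfOne m * _)]
        simp [halfOne]
        ring
      rw [h4, h2]
      have h5 : (-1 : ℂ) ^ (k + 2 * n) = (-1) ^ k := by rw [pow_add, pow_mul]; simp
      rw [if_neg (by omega : k + 2 * n ≠ 0), h5]
      simp only [zero_mul, Nat.sub_zero, halfOne, if_true]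
      have h6 : sqCoeff (k + 2 * n) = 4 * (k + 2 * n) * (-1) ^ k := by
        rw [sqCoeff, if_neg (by omega), h5]
        push_cast; ring
      rw [h6]
      by_cases hk : k = 0
      · subst hk
        simp [sqCoeff]
        field_simp
        ring
      · rw [if_neg hk, sqCoeff, if_neg hk]
        push_cast
        field_simp
        ring

theorem perPart_symm {n ρ : ℕ} (hρ : 0 < ρ) (hρ' : ρ < 2 * n) :
    perPart (2 * n) (2 * n - ρ) = perPart (2 * n) ρ := by
  rw [perPart, perPart, if_neg (by omega), if_neg (by omega)]
  have h : (-1 : ℂ) ^ (2 * n - ρ) = (-1) ^ ρ := by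
    have : (-1 : ℂ) ^ (2 * n - ρ) * (-1) ^ ρ = 1 := by
      rw [← pow_add, Nat.sub_add_cancel hρ'.le, pow_mul]; simp
    rcases neg_one_pow_eq_or ℂ ρ with h | h <;> rw [h] at this ⊢
    · simpa using this
    · linear_combination -this
  rw [h, Nat.cast_sub hρ'.le]
  push_cast
  ring

theorem geom_sum_root {h : ℕ} {ζ : ℂ} (hζ : ζ ^ h = 1) :
    ∑ j ∈ Finset.range h, ζ ^ j = if ζ = 1 then (h : ℂ) else 0 := by
  split_ifs with h1
  · simp [h1]
  · have := mul_geom_sum ζ h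
    rw [hζ, sub_self] at this
    exact (mul_eq_zero.1 this).resolve_left (sub_ne_zero.2 h1)

/-- The factor `(1 - u)³` clears the denominator of the closed form of a quadratic polynomial summed
against a geometric progression. -/
theorem sum_mul_sub_mul_pow (h : ℕ) (u : ℂ) (n : ℕ) :
    (1 - u) ^ 3 * ∑ ρ ∈ Finset.range n, (ρ : ℂ) * (h - ρ) * u ^ ρ =
      u * (h * (1 - u) - (1 + u)) - u ^ n * ((n : ℂ) * (h - n) * (1 - u) ^ 2 +
        u * ((h - 2 * n) * (1 - u) - (1 + u))) := by
  induction n with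
  | zero => simp
  | succ n ih =>
    rw [Finset.sum_range_succ, mul_add, ih]
    push_cast
    ring

theorem sum_mul_sub (h n : ℕ) :
    6 * ∑ ρ ∈ Finset.range n, (ρ : ℂ) * (h - ρ) = 3 * h * n * (n - 1) - (n - 1) * n * (2 * n - 1) := by
  induction n with
  | zero => simp
  | succ n ih =>
    rw [Finset.sum_range_succ, mul_add, ih]
    push_cast
    ring

/-- The square of `(1 - u) / (1 + u)`. -/
def cayleySq (u : ℂ) : ℂ := ((1 - u) / (1 + u)) ^ 2

/-- For `v ≠ -1` the closed form of the sum is rational in `v` and equals `cayleySq v`. For `v = -1`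
it degenerates to the sum of `ρ (h - ρ)`, computed directly; `cayleySq (-1)` is `0` by the
convention for division by zero, so the whole value sits in the extra term. -/
theorem sum_perPart_mul {n : ℕ} (hn : 0 < n) {v : ℂ} (hv : v ^ (2 * n) = 1) :
    ∑ ρ ∈ Finset.range (2 * n), perPart (2 * n) ρ * v⁻¹ ^ ρ =
      cayleySq v + if v = -1 then (((2 * n : ℕ) : ℂ) ^ 2 + 2) / 3 else 0 := by
  have hn' : (n : ℂ) ≠ 0 := Nat.cast_ne_zero.2 hn.ne'
  have hv0 : v ≠ 0 := by rintro rfl; simp [hn.ne'] at hv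
  have h1 : ∀ ρ ∈ Finset.range (2 * n), perPart (2 * n) ρ * v⁻¹ ^ ρ =
      (if ρ = 0 then 1 else 0) +
        (2 / (2 * n : ℕ)) * ((ρ : ℂ) * ((2 * n : ℕ) - ρ) * (-v⁻¹) ^ ρ) := by
    intro ρ _
    by_cases h : ρ = 0
    · simp [h, perPart]
    · rw [perPart, if_neg h, if_neg h, neg_pow]
      ring
  rw [Finset.sum_congr rfl h1, Finset.sum_add_distrib, ← Finset.mul_sum]
  rw [Finset.sum_ite_eq' (Finset.range (2 * n)) 0 (fun _ => (1 : ℂ)),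
    if_pos (Finset.mem_range.2 (by omega))]
  by_cases hv1 : v = -1
  · have h2 := sum_mul_sub (2 * n) (2 * n)
    rw [if_pos hv1, hv1, cayleySq]
    simp only [inv_neg, inv_one, neg_neg, one_pow, mul_one, add_neg_cancel, div_zero]
    have h3 : ∑ ρ ∈ Finset.range (2 * n), (ρ : ℂ) * ((2 * n : ℕ) - ρ) =
      (3 * (2 * n : ℕ) * (2 * n : ℕ) * ((2 * n : ℕ) - 1) -
        ((2 * n : ℕ) - 1) * (2 * n : ℕ) * (2 * (2 * n : ℕ) - 1)) / 6 := by
      rw [← h2]; ring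
    rw [h3]
    push_cast
    field_simp
    ring
  · rw [if_neg hv1, add_zero]
    have h2 := sum_mul_sub_mul_pow (2 * n) (-v⁻¹) (2 * n)
    have h4 : (-v⁻¹) ^ (2 * n) = 1 := by
      rw [neg_pow, inv_pow, hv, pow_mul]; simp
    rw [h4] at h2
    have h5 : 1 + v ≠ 0 := fun h => hv1 (by linear_combination h)
    set S := ∑ ρ ∈ Finset.range (2 * n), (ρ : ℂ) * ((2 * n : ℕ) - ρ) * (-v⁻¹) ^ ρ with hS
    have h6 : S = -2 * (2 * n) * v / (1 + v) ^ 2 := by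
      field_simp at h2 ⊢
      push_cast at h2
      have h7 : (1 + v) * (S * (1 + v) ^ 2 + 2 ^ 2 * n * v) = 0 := by
        linear_combination h2
      have := (mul_eq_zero.1 h7).resolve_left h5
      linear_combination this
    rw [h6, cayleySq]
    push_cast
    field_simp
    ring

/-- Discrete Fourier expansion of the periodic part. -/
theorem sum_fourier {n : ℕ} (hn : 0 < n) {η : ℂ} (hη : IsPrimitiveRoot η (2 * n)) (κ : ℤ) :
    ∑ j ∈ Finset.range (2 * n), (1 / (2 * n : ℕ) : ℂ) * (cayleySq (η ^ j) +
      if η ^ j = -1 then (((2 * n : ℕ) : ℂ) ^ 2 + 2) / 3 else 0) * (η ^ j) ^ κ =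
      perPart (2 * n) (κ % (2 * n : ℕ)).toNat := by
  have hη0 : η ≠ 0 := hη.ne_zero (by omega)
  have h2n : ((2 * n : ℕ) : ℂ) ≠ 0 := Nat.cast_ne_zero.2 (by omega)
  have h1 : ∀ j ∈ Finset.range (2 * n), (1 / (2 * n : ℕ) : ℂ) * (cayleySq (η ^ j) +
      if η ^ j = -1 then (((2 * n : ℕ) : ℂ) ^ 2 + 2) / 3 else 0) * (η ^ j) ^ κ =
      ∑ ρ ∈ Finset.range (2 * n), (1 / (2 * n : ℕ) : ℂ) * perPart (2 * n) ρ *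
        (η ^ (κ - ρ)) ^ j := by
    intro j _
    rw [← sum_perPart_mul hn (by rw [← pow_mul, mul_comm, pow_mul, hη.pow_eq_one, one_pow]),
      Finset.mul_sum, Finset.sum_mul]
    refine Finset.sum_congr rfl fun ρ _ => ?_
    have : (η ^ (κ - ρ)) ^ j = (η ^ j)⁻¹ ^ ρ * (η ^ j) ^ κ := by
      rw [zpow_sub₀ hη0, div_pow, ← zpow_natCast (η ^ κ), ← zpow_mul, mul_comm κ, zpow_mul,
        zpow_natCast, zpow_natCast, ← pow_mul, mul_comm ρ, pow_mul, inv_pow, div_eq_mul_inv,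
        mul_comm]
    rw [this]
    ring
  rw [Finset.sum_congr rfl h1, Finset.sum_comm]
  simp_rw [← Finset.mul_sum]
  have h2 : ∀ ρ ∈ Finset.range (2 * n), (1 / (2 * n : ℕ) : ℂ) * perPart (2 * n) ρ *
      ∑ j ∈ Finset.range (2 * n), (η ^ (κ - ρ)) ^ j =
      if ρ = (κ % (2 * n : ℕ)).toNat then perPart (2 * n) ρ else 0 := by
    intro ρ hρ
    rw [Finset.mem_range] at hρ
    have hz : (η ^ (κ - ρ)) ^ (2 * n) = 1 := by
      rw [← zpow_natCast, ← zpow_mul, mul_comm, zpow_mul, zpow_natCast, hη.pow_eq_one, one_zpow]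
    rw [geom_sum_root hz]
    have hiff : η ^ (κ - ρ) = 1 ↔ ρ = (κ % (2 * n : ℕ)).toNat := by
      rw [hη.zpow_eq_one_iff_dvd, Int.dvd_iff_emod_eq_zero,
        ← Int.emod_eq_emod_iff_emod_sub_eq_zero]
      have e : (ρ : ℤ) % (2 * n : ℕ) = ρ := Int.emod_eq_of_lt (by omega) (by omega)
      rw [e]
      have := Int.emod_nonneg κ (b := ((2 * n : ℕ) : ℤ)) (by omega)
      omega
    by_cases hc : ρ = (κ % (2 * n : ℕ)).toNat
    · rw [if_pos hc, if_pos (hiff.2 hc)]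
      field_simp
    · rw [if_neg hc, if_neg (fun h => hc (hiff.1 h)), mul_zero]
  rw [Finset.sum_congr rfl h2, Finset.sum_ite_eq', if_pos]
  rw [Finset.mem_range]
  have := Int.emod_lt_of_pos κ (b := ((2 * n : ℕ) : ℤ)) (by omega)
  omega

end Fourier

/-! ### Products of modes from the same component. -/

section Diagonal

theorem sum_Icc_symm {A : Type*} [AddCommMonoid A] (M : ℕ) (φ : ℤ → A) :
    ∑ κ ∈ Finset.Icc (-(M : ℤ)) M, φ κ =
      φ 0 + ∑ k ∈ Finset.range M, (φ ((k : ℤ) + 1) + φ (-((k : ℤ) + 1))) := by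
  induction M with
  | zero => simp
  | succ M ih =>
    have h : Finset.Icc (-((M + 1 : ℕ) : ℤ)) ((M + 1 : ℕ) : ℤ) =
        insert ((M : ℤ) + 1) (insert (-((M : ℤ) + 1)) (Finset.Icc (-(M : ℤ)) M)) := by
      ext x
      simp only [Finset.mem_Icc, Finset.mem_insert]
      push_cast
      omega
    rw [h, Finset.sum_insert, Finset.sum_insert, ih, Finset.sum_range_succ]
    · abel
    · simp only [Finset.mem_Icc]; omega
    · simp only [Finset.mem_Icc, Finset.mem_insert]; omega

variable {σ : Type*} (w : σ → ℕ) [IsGrading w] {p q : σ → ℂ}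

theorem vertexMode_zero_charge (F : MvPolynomial σ ℂ) : vertexMode w 0 0 0 F = F := by
  rw [vertexMode_eq_sum w 0 0 (M := 0) (by simp [shiftHom_zero_charge])]
  simp [shiftHom_zero_charge, expPoly_zero]

theorem sum_shift_sqCoeff {M : ℕ} (G : ℤ → MvPolynomial σ ℂ) (hG : ∀ κ : ℤ, (M : ℤ) < |κ| → G κ = 0)
    (j : ℕ) (r : ℕ → ℂ) :
    ∑ a ∈ Finset.range (M + 1), C (r a) * G (j + a) =
      ∑ κ ∈ Finset.range (M + 1), if j ≤ κ then C (r (κ - j)) * G κ else 0 := by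
  refine Finset.sum_bij_ne_zero (fun a _ _ => j + a) ?_ ?_ ?_ ?_
  · intro a _ hne
    rw [Finset.mem_range]
    by_contra hc
    refine hne ?_
    rw [hG _ (by rw [abs_of_nonneg (by omega)]; omega), mul_zero]
  · intro a _ _ b _ _ h
    omega
  · intro κ hκ hne
    have hj : j ≤ κ := by
      by_contra hc
      simp [hc] at hne
    rw [Finset.mem_range] at hκ
    refine ⟨κ - j, Finset.mem_range.2 (by omega), ?_, by omega⟩
    rw [if_pos hj] at hne
    rw [show ((j : ℤ) + ((κ - j : ℕ) : ℤ)) = κ by omega]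
    exact hne
  · intro a _ _
    rw [if_pos (by omega)]
    simp

/-- Each product of modes is expanded by `vertexMode_comp` and reindexed by `κ = 2 n m + a`, with
`a` the degree of the contraction. The total coefficient of the `κ`-th normally ordered product is
then the Cauchy product of `sum_halfOne_sqCoeff`. -/
theorem sum_modes_eq {n M K : ℕ} (hn : 0 < n) (hK : M ≤ K) {F : MvPolynomial σ ℂ}
    (hF : WtLE w M F) (hr : ∀ i, contr w p q i = sqCoeff i) :
    ∑ m ∈ Finset.range (K + 1), C (halfOne m) * vertexMode w p q (-((m * (2 * n) : ℕ) : ℤ))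
      (vertexMode w p q ((m * (2 * n) : ℕ) : ℤ) F) =
    ∑ κ ∈ Finset.range (M + 1), C ((if κ = 0 then -1 / 2 else 0) +
      (2 / (2 * n : ℕ) * (-1) ^ κ * (κ : ℂ) ^ 2 + perPart (2 * n) (κ % (2 * n)))) *
        normalPair w p p q q M F κ := by
  have h1 : ∀ m ∈ Finset.range (K + 1), C (halfOne m) *
      vertexMode w p q (-((m * (2 * n) : ℕ) : ℤ)) (vertexMode w p q ((m * (2 * n) : ℕ) : ℤ) F) =
      ∑ κ ∈ Finset.range (M + 1), (if m * (2 * n) ≤ κ then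
        C (halfOne m * sqCoeff (κ - m * (2 * n))) else 0) * normalPair w p p q q M F κ := by
    intro m _
    rw [vertexMode_comp w p p q q (K := M) hF _ (by omega)]
    simp_rw [hr]
    rw [sum_shift_sqCoeff (fun κ => normalPair w p p q q M F κ)
      (fun κ hκ => normalPair_eq_zero hκ), Finset.mul_sum]
    refine Finset.sum_congr rfl fun κ _ => ?_
    split_ifs
    · rw [map_mul, mul_assoc]
    · simp
  rw [Finset.sum_congr rfl h1, Finset.sum_comm]
  refine Finset.sum_congr rfl fun κ hκ => ?_
  rw [Finset.mem_range] at hκ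
  rw [← Finset.sum_mul, ← sum_halfOne_sqCoeff hn κ, map_sum]
  congr 1
  symm
  refine Finset.sum_subset_zero_on_sdiff ?_ ?_ ?_
  · refine Finset.range_mono ?_
    have : κ / (2 * n) ≤ κ := Nat.div_le_self _ _
    omega
  · intro m hm
    simp only [Finset.mem_sdiff, Finset.mem_range, not_lt] at hm
    rw [if_neg]
    have := Nat.lt_mul_of_div_lt (show κ / (2 * n) < m by omega) (by omega : 0 < 2 * n)
    omega
  · intro m hm
    rw [Finset.mem_range] at hm
    rw [if_pos]
    exact (Nat.le_div_iff_mul_le (by omega)).1 (by omega)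

/-- The part of the Casimir that comes from one component. -/
theorem sum_modes_eq_vertexMode {n M K : ℕ} (hn : 0 < n) (hK : M ≤ K) {F : MvPolynomial σ ℂ}
    (hF : WtLE w M F) (hr : ∀ i, contr w p q i = sqCoeff i)
    (hp : ∀ s, p s ≠ 0 → Odd (w s)) (hq : ∀ s, q s ≠ 0 → Odd (w s))
    {η : ℂ} (hη : IsPrimitiveRoot η (2 * n)) :
    ∑ m ∈ Finset.range (K + 1), C (halfOne m) * vertexMode w p q (-((m * (2 * n) : ℕ) : ℤ))
      (vertexMode w p q ((m * (2 * n) : ℕ) : ℤ) F) =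
    C (1 / 2 : ℂ) * (∑ j ∈ Finset.range (2 * n), C (1 / (2 * n : ℕ) * cayleySq (η ^ j) : ℂ) *
        vertexMode w (fun s => (η ^ j) ^ w s * p s + p s)
          (fun s => (η ^ j)⁻¹ ^ w s * q s + q s) 0 F +
      C ((((2 * n : ℕ) : ℂ) ^ 2 + 2) / (3 * (2 * n : ℕ))) * F -
      C (4 / (2 * n : ℕ) : ℂ) * ∑ l ∈ Finset.range (2 * M + 1), linPoly w p l * linDer w q l F) := by
  have hη0 : η ≠ 0 := hη.ne_zero (by omega)
  have h2n : ((2 * n : ℕ) : ℂ) ≠ 0 := Nat.cast_ne_zero.2 (by omega)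
  set G := normalPair w p p q q M F with hGdef
  have hG : ∀ κ, G (-κ) = G κ := fun κ => by
    rw [hGdef, normalPair_symm w p p q q (-κ), neg_neg]
  set Q : ℤ → ℂ := fun κ => 2 / (2 * n : ℕ) * ((-1) ^ κ * (κ : ℂ) ^ 2) +
    perPart (2 * n) (κ % (2 * n : ℕ)).toNat with hQ
  have hQnat : ∀ k : ℕ, Q k = 2 / (2 * n : ℕ) * (-1) ^ k * (k : ℂ) ^ 2 +
      perPart (2 * n) (k % (2 * n)) := by
    intro k
    simp only [hQ, zpow_natCast, Int.cast_natCast, ← Int.natCast_mod, Int.toNat_natCast]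
    ring
  have hQsymm : ∀ κ, Q (-κ) = Q κ := by
    intro κ
    simp only [hQ]
    have e1 : (-1 : ℂ) ^ (-κ) = (-1) ^ κ := by rw [zpow_neg, ← inv_zpow]; norm_num
    rw [e1]
    have hm := Int.emod_nonneg κ (b := ((2 * n : ℕ) : ℤ)) (by omega)
    have hm' := Int.emod_lt_of_pos κ (b := ((2 * n : ℕ) : ℤ)) (by omega)
    have e2 : perPart (2 * n) ((-κ) % (2 * n : ℕ)).toNat =
        perPart (2 * n) (κ % (2 * n : ℕ)).toNat := by
      by_cases h0 : κ % (2 * n : ℕ) = 0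
      · have : (-κ) % (2 * n : ℕ) = 0 :=
          Int.emod_eq_zero_of_dvd ((Int.dvd_neg).2 (Int.dvd_of_emod_eq_zero h0))
        rw [h0, this]
      · have : (-κ) % (2 * n : ℕ) = (2 * n : ℕ) - κ % (2 * n : ℕ) := by
          rw [← Int.emod_eq_of_lt (a := ((2 * n : ℕ) : ℤ) - κ % (2 * n : ℕ)) (b := (2 * n : ℕ))
            (by omega) (by omega)]
          rw [Int.emod_eq_emod_iff_emod_sub_eq_zero, ← Int.dvd_iff_emod_eq_zero]
          refine ⟨-1 - κ / (2 * n : ℕ), ?_⟩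
          have := Int.emod_add_mul_ediv κ (2 * n : ℕ)
          linear_combination this
        rw [this, ← perPart_symm (ρ := (κ % (2 * n : ℕ)).toNat) (n := n) (by omega) (by omega)]
        congr 1
        omega
    rw [e2]
    push_cast
    ring
  have hsum : ∑ κ ∈ Finset.Icc (-(M : ℤ)) M, C (Q κ) * G κ =
      ∑ j ∈ Finset.range (2 * n), C (1 / (2 * n : ℕ) * cayleySq (η ^ j) : ℂ) *
        vertexMode w (fun s => (η ^ j) ^ w s * p s + p s)
          (fun s => (η ^ j)⁻¹ ^ w s * q s + q s) 0 F +
      C ((((2 * n : ℕ) : ℂ) ^ 2 + 2) / (3 * (2 * n : ℕ))) * F -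
      C (4 / (2 * n : ℕ) : ℂ) * ∑ l ∈ Finset.range (2 * M + 1), linPoly w p l * linDer w q l F := by
    have e1 : ∀ κ ∈ Finset.Icc (-(M : ℤ)) M, C (Q κ) * G κ =
        C (2 / (2 * n : ℕ) : ℂ) * (C ((-1) ^ κ * (κ : ℂ) ^ 2) * G κ) +
        ∑ j ∈ Finset.range (2 * n), C ((1 / (2 * n : ℕ) : ℂ) * (cayleySq (η ^ j) +
          if η ^ j = -1 then (((2 * n : ℕ) : ℂ) ^ 2 + 2) / 3 else 0)) *
            (C ((η ^ j) ^ κ) * G κ) := by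
      intro κ _
      simp only [hQ, ← sum_fourier hn hη κ, map_add, map_mul, map_sum, add_mul, Finset.sum_mul,
        mul_assoc]
    rw [Finset.sum_congr rfl e1, Finset.sum_add_distrib, ← Finset.mul_sum,
      sum_sq_normalPair w hp hq hF, Finset.sum_comm]
    have e0 : ∀ (j : ℕ) (a : ℂ), ∑ κ ∈ Finset.Icc (-(M : ℤ)) M, C a * (C ((η ^ j) ^ κ) * G κ) =
        C a * vertexMode w (fun s => (η ^ j) ^ w s * p s + p s)
          (fun s => (η ^ j)⁻¹ ^ w s * q s + q s) 0 F := fun j a => by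
      rw [← Finset.mul_sum, ← sum_zpow_normalPair w p p q q hF (pow_ne_zero j hη0)]
    simp only [e0]
    have e2 : ∑ j ∈ Finset.range (2 * n), C ((1 / (2 * n : ℕ) : ℂ) * (cayleySq (η ^ j) +
          if η ^ j = -1 then (((2 * n : ℕ) : ℂ) ^ 2 + 2) / 3 else 0)) *
          vertexMode w (fun s => (η ^ j) ^ w s * p s + p s)
          (fun s => (η ^ j)⁻¹ ^ w s * q s + q s) 0 F =
        ∑ j ∈ Finset.range (2 * n), C (1 / (2 * n : ℕ) * cayleySq (η ^ j) : ℂ) *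
        vertexMode w (fun s => (η ^ j) ^ w s * p s + p s)
          (fun s => (η ^ j)⁻¹ ^ w s * q s + q s) 0 F +
        C ((((2 * n : ℕ) : ℂ) ^ 2 + 2) / (3 * (2 * n : ℕ))) * F := by
      simp_rw [mul_add, map_add, add_mul]
      rw [Finset.sum_add_distrib]
      congr 1
      -- Only `j = n` gives `η ^ j = -1`. There the charges at the two points cancel on odd weights,
      -- the vertex operator is the identity, and the extra Fourier coefficient becomes a scalar
      -- multiple of `F`.
      have hη1 : η ^ n = -1 := by
        have h1 : (η ^ n) ^ 2 = 1 := by rw [← pow_mul, mul_comm, hη.pow_eq_one]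
        have h2 : (η ^ n - 1) * (η ^ n + 1) = 0 := by linear_combination h1
        rcases mul_eq_zero.1 h2 with h | h
        · exact absurd (sub_eq_zero.1 h) (hη.pow_ne_one_of_pos_of_lt (by omega) (by omega))
        · linear_combination h
      rw [Finset.sum_eq_single_of_mem n (Finset.mem_range.2 (by omega))]
      · rw [if_pos hη1, hη1]
        have a1 : (fun s => (-1 : ℂ) ^ w s * p s + p s) = 0 := by
          funext s
          have := congrFun (scale_neg_one w hp) s
          rw [this]; simp
        have a2 : (fun s => (-1 : ℂ)⁻¹ ^ w s * q s + q s) = 0 := by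
          funext s
          have := congrFun (scale_neg_one w hq) s
          rw [show (-1 : ℂ)⁻¹ = -1 by norm_num, this]; simp
        rw [a1, a2, vertexMode_zero_charge]
        congr 2
        field_simp
      · intro j hj hjn
        rw [Finset.mem_range] at hj
        rw [if_neg, mul_zero, map_zero, zero_mul]
        rw [← hη1]
        exact fun h => hjn (hη.pow_inj hj (by omega) h)
    rw [e2]
    have e3 : (C (4 / (2 * n : ℕ) : ℂ) : MvPolynomial σ ℂ) = C (2 / (2 * n : ℕ) : ℂ) * 2 := by
      rw [← map_ofNat (C : ℂ →+* MvPolynomial σ ℂ) 2, ← map_mul]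
      congr 1
      ring
    rw [e3]
    ring
  -- Both `Q` and `G` are even in `κ`, so the one-sided sum is half of the two-sided one. This fits
  -- at `κ = 0` because `Q 0 = 1` and the one-sided coefficient there is `1 - 1/2`.
  rw [sum_modes_eq w hn hK hF hr, ← hsum, sum_Icc_symm, Finset.sum_range_succ']
  simp_rw [hG, hQsymm]
  have hQ0 : Q 0 = 1 := by simp [hQ, perPart]
  have hC : (C (1 / 2) + C (1 / 2) : MvPolynomial σ ℂ) = 1 := by
    rw [← map_add]; norm_num
  rw [mul_add, Finset.mul_sum, add_comm, ← hGdef]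
  congr 1
  · rw [hQ0, map_one, one_mul]
    congr 2
    simp [perPart]
    norm_num
  · refine Finset.sum_congr rfl fun k _ => ?_
    rw [if_neg (by omega), zero_add, ← hQnat]
    push_cast
    linear_combination (-C (Q ((k : ℤ) + 1)) * G ((k : ℤ) + 1)) * hC

end Diagonal

/-! ### The hermitian form on polynomials and adjoints of vertex operators. -/

section Hermitian

variable {σ : Type*} (c : σ → ℝ)

/-- The squared norm of the monomial `tᵈ`. -/
def normCoeff (d : σ →₀ ℕ) : ℝ := d.prod fun s n => c s ^ n * (n.factorial : ℝ)

/-- The hermitian form on polynomials for which the monomials are orthogonal and `tₛ` is adjoint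
to `cₛ ∂ₛ`; it is linear in the second argument. -/
def hermForm (F : MvPolynomial σ ℂ) : MvPolynomial σ ℂ →ₗ[ℂ] ℂ :=
  (basisMonomials σ ℂ).constr ℂ fun d => (normCoeff c d : ℂ) * conj (coeff d F)

theorem hermForm_monomial (F : MvPolynomial σ ℂ) (d : σ →₀ ℕ) (a : ℂ) :
    hermForm c F (monomial d a) = a * ((normCoeff c d : ℂ) * conj (coeff d F)) := by
  have h : monomial d a = a • (basisMonomials σ ℂ d) := by simp [smul_monomial]
  rw [h, map_smul, hermForm, Module.Basis.constr_basis, smul_eq_mul]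

theorem hermForm_eq_sum (F H : MvPolynomial σ ℂ) {A : Finset (σ →₀ ℕ)} (hA : H.support ⊆ A) :
    hermForm c F H = ∑ d ∈ A, coeff d H * ((normCoeff c d : ℂ) * conj (coeff d F)) := by
  conv_lhs => rw [H.as_sum]
  rw [map_sum]
  simp_rw [hermForm_monomial]
  refine Finset.sum_subset hA fun d _ hd => ?_
  rw [notMem_support_iff.1 hd, zero_mul]

theorem hermForm_conj (F H : MvPolynomial σ ℂ) : conj (hermForm c F H) = hermForm c H F := by
  classical
  rw [hermForm_eq_sum c F H (A := F.support ∪ H.support) Finset.subset_union_right,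
    hermForm_eq_sum c H F (A := F.support ∪ H.support) Finset.subset_union_left, map_sum]
  refine Finset.sum_congr rfl fun d _ => ?_
  simp only [map_mul, Complex.conj_conj, Complex.conj_ofReal]
  ring

theorem hermForm_self (F : MvPolynomial σ ℂ) :
    hermForm c F F = ((∑ d ∈ F.support, normCoeff c d * Complex.normSq (coeff d F) : ℝ) : ℂ) := by
  rw [hermForm_eq_sum c F F subset_rfl]
  push_cast
  refine Finset.sum_congr rfl fun d _ => ?_
  rw [← Complex.mul_conj]
  ring

variable {c} in
theorem normCoeff_pos (hc : ∀ s, 0 < c s) (d : σ →₀ ℕ) : 0 < normCoeff c d :=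
  Finset.prod_pos fun s _ => mul_pos (pow_pos (hc s) _) (Nat.cast_pos.2 (Nat.factorial_pos _))

variable {c} in
theorem hermForm_self_nonneg (hc : ∀ s, 0 < c s) (F : MvPolynomial σ ℂ) :
    ∃ r : ℝ, 0 ≤ r ∧ hermForm c F F = r ∧ (r = 0 → F = 0) := by
  refine ⟨_, ?_, hermForm_self c F, ?_⟩
  · exact Finset.sum_nonneg fun d _ => mul_nonneg (normCoeff_pos hc d).le (Complex.normSq_nonneg _)
  · intro h
    rw [Finset.sum_eq_zero_iff_of_nonneg fun d _ =>
      mul_nonneg (normCoeff_pos hc d).le (Complex.normSq_nonneg _)] at h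
    ext d
    by_contra hd
    have := h d (mem_support_iff.2 hd)
    rcases mul_eq_zero.1 this with h0 | h0
    · exact (normCoeff_pos hc d).ne' h0
    · exact hd (by simpa using h0)

theorem normCoeff_mul_expCoeff (p : σ → ℝ) (d e : σ →₀ ℕ) :
    (normCoeff c (e + d) : ℂ) * expCoeff (fun s => (p s : ℂ)) e =
      (normCoeff c d : ℂ) * shiftCoeff (fun s => (c s * p s : ℂ)) d e := by
  classical
  have hd : d.support ⊆ e.support ∪ d.support := Finset.subset_union_right
  have he : e.support ⊆ e.support ∪ d.support := Finset.subset_union_left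
  unfold normCoeff shiftCoeff expCoeff
  simp only [Finsupp.prod, Complex.ofReal_prod]
  change ((e + d).prod fun s n => ((c s ^ n * (n.factorial : ℝ) : ℝ) : ℂ)) * (e.prod fun s n =>
    (p s : ℂ) ^ n / (n.factorial : ℂ)) = (d.prod fun s n => ((c s ^ n * (n.factorial : ℝ) : ℝ) : ℂ)) *
    e.prod fun s j => ((c s : ℂ) * p s) ^ j * ((d s + j).choose j : ℂ)
  rw [prod_eq_of_support_subset _ e he _ (by simp), prod_eq_of_support_subset _ e he _ (by simp),
    prod_eq_of_support_subset _ d hd _ (by simp),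
    prod_eq_of_support_subset _ (e + d) Finsupp.support_add _ (by simp),
    ← Finset.prod_mul_distrib, ← Finset.prod_mul_distrib]
  refine Finset.prod_congr rfl fun s _ => ?_
  have h := Nat.add_choose_mul_factorial_mul_factorial (d s) (e s)
  have h2 : ((e s).factorial : ℂ) ≠ 0 := Nat.cast_ne_zero.2 (Nat.factorial_ne_zero _)
  have h' : ((d s + e s).choose (e s) : ℂ) * (d s).factorial * (e s).factorial =
    (d s + e s).factorial := by exact_mod_cast h
  rw [Finsupp.add_apply, add_comm (e s), ← Complex.ofReal_natCast, ← Complex.ofReal_natCast]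
  push_cast
  field_simp
  rw [pow_add]
  linear_combination (-(c s : ℂ) ^ d s * c s ^ e s * p s ^ e s) * h'

theorem shiftCoeff_conj (q : σ → ℝ) (d e : σ →₀ ℕ) :
    conj (shiftCoeff (fun s => (q s : ℂ)) d e) = shiftCoeff (fun s => (q s : ℂ)) d e := by
  simp [shiftCoeff, Finsupp.prod, map_prod]

variable (w : σ → ℕ) [IsGrading w]

/-- As `tₛ` is adjoint to `cₛ ∂ₛ`, the multiplication by `exp (∑ pₛ tₛ)` is adjoint to `exp (∑ cₛ pₛ
∂ₛ)`, degree by degree. The charges are real, so conjugation does not change them. -/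
theorem hermForm_expPoly_mul (p : σ → ℝ) (n : ℕ) (F H : MvPolynomial σ ℂ) :
    hermForm c F (expPoly w (fun s => (p s : ℂ)) n * H) =
      hermForm c ((shiftHom w (fun s => ((c s * p s : ℝ) : ℂ)) F).coeff n) H := by
  induction H using MvPolynomial.induction_on' with
  | add H H' h h' => rw [mul_add, map_add, map_add, h, h']
  | monomial d a =>
    rw [hermForm_monomial, coeff_shiftHom, expPoly, Finset.sum_mul, map_sum, map_sum,
      Finset.mul_sum, Finset.mul_sum]
    refine Finset.sum_congr rfl fun e _ => ?_
    rw [monomial_mul, hermForm_monomial, map_mul, shiftCoeff_conj, add_comm d e]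
    have := normCoeff_mul_expCoeff c p d e
    push_cast
    linear_combination a * conj (coeff (e + d) F) * this

theorem hermForm_shiftHom (p : σ → ℝ) (n : ℕ) (F H : MvPolynomial σ ℂ) :
    hermForm c F ((shiftHom w (fun s => ((c s * p s : ℝ) : ℂ)) H).coeff n) =
      hermForm c (expPoly w (fun s => (p s : ℂ)) n * F) H := by
  rw [← hermForm_conj, ← hermForm_expPoly_mul, hermForm_conj]

theorem hermForm_sum_left {ι : Type*} (A : Finset ι) (G : ι → MvPolynomial σ ℂ)
    (H : MvPolynomial σ ℂ) : hermForm c (∑ i ∈ A, G i) H = ∑ i ∈ A, hermForm c (G i) H := by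
  rw [← hermForm_conj, map_sum, map_sum]
  exact Finset.sum_congr rfl fun i _ => hermForm_conj c _ _

/-- The adjoint of a vertex operator. -/
theorem hermForm_vertexMode (p : σ → ℝ) (hp : ∀ s, p s ≠ 0 → Odd (w s)) {j : ℕ} (hj : Even j)
    (F H : MvPolynomial σ ℂ) :
    hermForm c F (vertexMode w (fun s => (p s : ℂ)) (fun s => ((-(c s * p s) : ℝ) : ℂ)) (-(j : ℤ)) H) =
      hermForm c (vertexMode w (fun s => (p s : ℂ)) (fun s => ((-(c s * p s) : ℝ) : ℂ)) j F) H := by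
  set q : σ → ℂ := fun s => ((-(c s * p s) : ℝ) : ℂ) with hq
  have hq' : (fun s => ((c s * p s : ℝ) : ℂ)) = -q := by funext s; simp [hq]
  have hq'' : (fun s => ((c s * (-p s) : ℝ) : ℂ)) = q := by funext s; simp [hq]
  have hp' : (fun s => ((-p s : ℝ) : ℂ)) = -(fun s => (p s : ℂ)) := by funext s; simp
  have oddp : ∀ s, (fun s => (p s : ℂ)) s ≠ 0 → Odd (w s) := fun s h => hp s (by simpa using h)
  have oddq : ∀ s, q s ≠ 0 → Odd (w s) := fun s h => hp s (by
    rintro h0; simp [hq, h0] at h)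
  obtain ⟨M, hM⟩ : ∃ M, (shiftHom w q H).natDegree ≤ M ∧ (shiftHom w q F).natDegree ≤ M :=
    ⟨_, le_max_left _ _, le_max_right _ _⟩
  rw [vertexMode_eq_sum w _ q hM.1, map_sum,
    vertexMode_eq_sum w _ q (M := j + M) (hM.2.trans (by omega)), add_assoc,
    Finset.sum_range_add _ j (M + 1)]
  have h0 : ∑ i ∈ Finset.range j, expPoly w (fun s => (p s : ℂ)) ((i : ℤ) - j) *
      (shiftHom w q F).coeff i = 0 := by
    refine Finset.sum_eq_zero fun i hi => ?_
    rw [Finset.mem_range] at hi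
    rw [expPoly_of_neg _ _ (by omega), zero_mul]
  rw [h0, zero_add, hermForm_sum_left]
  refine Finset.sum_congr rfl fun i _ => ?_
  have e1 : (i : ℤ) - -(j : ℤ) = ((i + j : ℕ) : ℤ) := by push_cast; ring
  have e2 : ((j + i : ℕ) : ℤ) - j = (i : ℤ) := by push_cast; ring
  rw [e1, e2, hermForm_expPoly_mul, hq']
  have e3 := hermForm_shiftHom c w (fun s => -p s) i ((shiftHom w (-q) F).coeff (i + j)) H
  rw [hq''] at e3
  -- Taking adjoints negates both charges, which on odd weights costs `(-1) ^ i` and `(-1) ^ (i +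
  -- j)`. The signs cancel because `j` is even.
  have e4 : (C ((-1 : ℂ) ^ i) * C ((-1) ^ (i + j)) : MvPolynomial σ ℂ) = 1 := by
    rw [← map_mul, pow_add, hj.neg_one_pow, mul_one, ← mul_pow]; simp
  have e5 : expPoly w (fun s => ((-p s : ℝ) : ℂ)) i * (shiftHom w (-q) F).coeff (i + j) =
      expPoly w (fun s => (p s : ℂ)) i * (shiftHom w q F).coeff (j + i) := by
    rw [hp', expPoly_neg w oddp, shiftHom_neg w oddq, add_comm j i]
    linear_combination (expPoly w (fun s => (p s : ℂ)) i * (shiftHom w q F).coeff (i + j)) * e4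
  rw [e3, e5]

end Hermitian

/-! ### Behaviour of modes under rescaling of weights and of the spectral variable. -/

section Rescaling

variable {σ : Type*}

/-- Used to pass between the weight of `z₁` or `z₂` in each component and the common weight of `ζ =
λ^{1/h}`. -/
theorem vertexMode_rescale (w w' : σ → ℕ) [IsGrading w] [IsGrading w'] {p q : σ → ℂ} {c : ℕ}
    (hc : 0 < c) (hp : ∀ s, p s ≠ 0 → w' s = c * w s) (hq : ∀ s, q s ≠ 0 → w' s = c * w s)
    (k : ℤ) (F : MvPolynomial σ ℂ) : vertexMode w' p q (c * k) F = vertexMode w p q k F := by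
  change Polynomial.lsum _ (shiftHom w' q F) = Polynomial.lsum _ (shiftHom w q F)
  rw [shiftHom_rescale w w' q hq]
  generalize shiftHom w q F = P
  induction P using Polynomial.induction_on' with
  | add P Q hP hQ => simp only [map_add, hP, hQ]
  | monomial i a =>
    rw [Polynomial.expand_monomial]
    rw [Polynomial.lsum_apply, Polynomial.sum_monomial_index _ _ (by simp), Polynomial.lsum_apply,
      Polynomial.sum_monomial_index _ _ (by simp)]
    simp only [LinearMap.mulLeft_apply]
    rw [← expPoly_rescale w w' p hc hp (i - k)]
    congr 2
    push_cast
    ring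

/-- The substitution `z ↦ ω z` does not change the mode of degree zero. It serves to normalise one
of the two points of a root vertex operator. -/
theorem vertexMode_scale (w : σ → ℕ) [IsGrading w] (p q : σ → ℂ) {ω : ℂ} (hω : ω ≠ 0)
    (F : MvPolynomial σ ℂ) :
    vertexMode w (fun s => ω ^ w s * p s) (fun s => ω⁻¹ ^ w s * q s) 0 F =
      vertexMode w p q 0 F := by
  obtain ⟨M, hM⟩ := exists_wtLE w F
  rw [vertexMode_eq_sum w _ _ (hM.natDegree_shiftHom _),
    vertexMode_eq_sum w _ _ (hM.natDegree_shiftHom _)]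
  refine Finset.sum_congr rfl fun i _ => ?_
  rw [sub_zero, expPoly_scale, shiftHom_scale]
  have h : (C (ω ^ i) * C (ω⁻¹ ^ i) : MvPolynomial σ ℂ) = 1 := by
    rw [← map_mul, ← mul_pow, mul_inv_cancel₀ hω, one_pow, map_one]
  linear_combination (expPoly w p i * (shiftHom w q F).coeff i) * h

theorem contr_of_mul_eq_zero (w : σ → ℕ) [IsGrading w] {p q : σ → ℂ} (h : ∀ s, p s * q s = 0)
    (i : ℕ) : contr w p q i = if i = 0 then 1 else 0 := by
  rw [contr_eq_eval, show (fun s => p s * q s) = 0 from funext h, expPoly_zero_charge]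
  split_ifs <;> simp

end Rescaling

/-- The logarithmic derivative `x d/dx` of `((1 - x)/(1 + x))²` is `-4 (x + x³ + x⁵ + ⋯)`. -/
theorem sqCoeff_euler (n : ℕ) : (n : ℂ) * sqCoeff n =
    ∑ i ∈ Finset.range (n + 1), (if Odd i then (-4 : ℂ) else 0) * sqCoeff (n - i) := by
  induction n using Nat.twoStepInduction with
  | zero => simp
  | one => simp [sqCoeff, Finset.sum_range_succ]
  | more n ih _ =>
    rw [Finset.sum_range_succ', Finset.sum_range_succ']
    have h : ∀ i, (if Odd (i + 1 + 1) then (-4 : ℂ) else 0) * sqCoeff (n + 2 - (i + 1 + 1)) =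
        (if Odd i then (-4 : ℂ) else 0) * sqCoeff (n - i) := by
      intro i
      have : Odd (i + 1 + 1) ↔ Odd i := by
        rw [show i + 1 + 1 = i + 2 by ring, Nat.odd_add]; simp
      rw [show n + 2 - (i + 1 + 1) = n - i by omega]
      simp only [this]
    rw [Finset.sum_congr rfl fun i _ => h i, ← ih]
    simp [sqCoeff]
    by_cases h0 : n = 0
    · simp [h0]; norm_num
    · simp [h0, pow_succ]
      ring

/-! ### The operators `Ω_m` on polynomials in two copies of the variables. -/

section DoubledVariables

/-- The variables of the two copies of `ℂ[[𝐭¹, 𝐭²]]`. -/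
abbrev Var2 : Type := Var ⊕ Var

/-- The variable of `ℂ[[𝐭¹, 𝐭²]]` of which `s` is a copy. -/
def Var2.base (s : Var2) : Var := Sum.elim id id s

/-- `1` on the first copy of the variables and `-1` on the second. -/
def Var2.sign (s : Var2) : ℝ := Sum.elim (fun _ => 1) (fun _ => -1) s

theorem Var2.sign_mul_self (s : Var2) : s.sign * s.sign = 1 := by
  rcases s with s | s <;> simp [Var2.sign]

/-- The weight `m` of the two copies of `t^a_m`. -/
def idx2 (s : Var2) : ℕ := s.base.idx

/-- The weights of the variables with respect to `ζ = λ^{1/h}`. -/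
def kw2 (N : ℕ) (s : Var2) : ℕ := kwWeight N s.base

theorem finite_idx_le (n : ℕ) : {s : Var2 | idx2 s ≤ n}.Finite := by
  have h : ({s : Var | Var.idx s ≤ n}).Finite := by
    refine ((Set.finite_univ (α := Fin 2)).prod (Set.finite_Iic n)).subset fun s hs => ?_
    have : Var.idx s ≤ n := hs
    simp only [Var.idx] at this
    simp only [Set.mem_prod, Set.mem_univ, Set.mem_Iic, true_and]
    omega
  refine ((h.image Sum.inl).union (h.image Sum.inr)).subset ?_
  rintro (s | s) hs
  · exact Or.inl ⟨s, hs, rfl⟩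
  · exact Or.inr ⟨s, hs, rfl⟩

instance isGrading_idx2 : IsGrading idx2 where
  pos s := by simp [idx2, Var.idx]
  fin n := (finite_idx_le n).subset fun s hs => le_of_eq hs

theorem idx2_le_kw2 {N : ℕ} (hN : 3 ≤ N) (s : Var2) : idx2 s ≤ kw2 N s := by
  unfold idx2 kw2 kwWeight
  split_ifs
  · exact le_rfl
  · exact Nat.le_mul_of_pos_right _ (by omega)

theorem isGrading_kw2 {N : ℕ} (hN : 3 ≤ N) : IsGrading (kw2 N) where
  pos s := lt_of_lt_of_le (IsGrading.pos (w := idx2) s) (idx2_le_kw2 hN s)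
  fin n := (finite_idx_le n).subset fun s hs => (idx2_le_kw2 hN s).trans (le_of_eq hs)

theorem odd_idx2 (s : Var2) : Odd (idx2 s) := ⟨s.base.2, rfl⟩

/-- The multiplication charges of `Γ(𝐭ᵃ, z) ⊗ Γ(𝐭ᵃ, -z)`. -/
def chargeR (a : Fin 2) (s : Var2) : ℝ := if s.base.1 = a then s.sign else 0

/-- The constants of the hermitian form for which `J_m` and `J_{-m}` are adjoint. -/
def formConst (s : Var2) : ℝ := 2 / idx2 s

/-- The multiplication charges of `Γ(𝐭ᵃ, z) ⊗ Γ(𝐭ᵃ, -z)`. -/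
def chargeP (a : Fin 2) (s : Var2) : ℂ := (chargeR a s : ℂ)

/-- The differentiation charges of `Γ(𝐭ᵃ, z) ⊗ Γ(𝐭ᵃ, -z)`. -/
def chargeQ (a : Fin 2) (s : Var2) : ℂ := ((-(formConst s * chargeR a s) : ℝ) : ℂ)

theorem chargeP_of_ne {a : Fin 2} {s : Var2} (h : s.base.1 ≠ a) : chargeP a s = 0 := by
  simp [chargeP, chargeR, h]

theorem chargeQ_of_ne {a : Fin 2} {s : Var2} (h : s.base.1 ≠ a) : chargeQ a s = 0 := by
  simp [chargeQ, chargeR, h]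

theorem idx2_mul_charges (a : Fin 2) (s : Var2) :
    (idx2 s : ℂ) * (chargeP a s * chargeQ a s) = if s.base.1 = a then -2 else 0 := by
  have h0 : (idx2 s : ℝ) ≠ 0 := Nat.cast_ne_zero.2 (IsGrading.pos (w := idx2) s).ne'
  have h1 : (idx2 s : ℝ) * (chargeR a s * -(formConst s * chargeR a s)) =
      if s.base.1 = a then -2 else 0 := by
    unfold chargeR formConst
    split_ifs
    · have := s.sign_mul_self
      field_simp
      linear_combination -this
    · simp
  have h2 := congrArg (fun x : ℝ => (x : ℂ)) h1
  simp only [chargeP, chargeQ]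
  push_cast at h2 ⊢
  rw [h2]
  split_ifs <;> simp

theorem fiber_filter (a : Fin 2) (i : ℕ) :
    (fiber idx2 i).filter (fun s => s.base.1 = a) =
      if Odd i then {Sum.inl (a, i / 2), Sum.inr (a, i / 2)} else ∅ := by
  split_ifs with h
  · obtain ⟨k, rfl⟩ := h
    ext s
    simp only [Finset.mem_filter, mem_fiber, Finset.mem_insert, Finset.mem_singleton]
    have hk : (2 * k + 1) / 2 = k := by omega
    rw [hk]
    rcases s with ⟨b, l⟩ | ⟨b, l⟩ <;> simp [idx2, Var2.base, Var.idx, Prod.ext_iff] <;> tauto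
  · refine Finset.filter_eq_empty_iff.2 fun s hs => ?_
    rw [mem_fiber] at hs
    exact absurd (hs ▸ odd_idx2 s) h

/-- In each odd degree the two copies contribute `-2` each to the logarithmic derivative of the
contraction, so the contraction satisfies the same Euler recurrence as `sqCoeff`. -/
theorem contr_charges (a : Fin 2) (i : ℕ) :
    contr idx2 (chargeP a) (chargeQ a) i = sqCoeff i := by
  refine eq_of_euler (A := ℂ) (L := fun i => if Odd i then (-4 : ℂ) else 0)
    (f := contr idx2 (chargeP a) (chargeQ a)) (g := sqCoeff) (by simp)
    (by rw [contr_zero]; simp [sqCoeff]) (fun n => ?_) sqCoeff_euler i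
  rw [contr_euler]
  refine Finset.sum_congr rfl fun i _ => ?_
  congr 1
  simp_rw [idx2_mul_charges]
  rw [← Finset.sum_filter, fiber_filter]
  split_ifs with h
  · rw [Finset.sum_pair (by simp)]; norm_num
  · simp

/-- `Ω_m`, acting on polynomials. -/
def omegaPoly (N : ℕ) (m : ℤ) : MvPolynomial Var2 ℂ →ₗ[ℂ] MvPolynomial Var2 ℂ :=
  vertexMode idx2 (chargeP 0) (chargeQ 0) (m * cox N) -
    vertexMode idx2 (chargeP 1) (chargeQ 1) (2 * m)

theorem formConst_pos (s : Var2) : 0 < formConst s :=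
  div_pos two_pos (Nat.cast_pos.2 (IsGrading.pos (w := idx2) s))

/-- The constants `2 / m` are chosen so that the differentiation charges are minus the adjoints of
the multiplication charges. The degrees `m h` and `2 m` are even, so no sign arises. -/
theorem hermForm_omegaPoly {N : ℕ} (m : ℕ) (F H : MvPolynomial Var2 ℂ) :
    hermForm formConst F (omegaPoly N (-m) H) = hermForm formConst (omegaPoly N m F) H := by
  have h := fun a : Fin 2 => fun j : ℕ => fun hj : Even j =>
    hermForm_vertexMode formConst idx2 (chargeR a) (fun s _ => odd_idx2 s) hj F H
  have h0 := h 0 (m * cox N) (by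
    refine Even.mul_left ?_ m
    exact ⟨N - 1, by unfold cox; omega⟩)
  have h1 := h 1 (2 * m) (even_two_mul m)
  change hermForm formConst F (vertexMode idx2 (chargeP 0) (chargeQ 0) _ H) =
    hermForm formConst (vertexMode idx2 (chargeP 0) (chargeQ 0) _ F) H at h0
  change hermForm formConst F (vertexMode idx2 (chargeP 1) (chargeQ 1) _ H) =
    hermForm formConst (vertexMode idx2 (chargeP 1) (chargeQ 1) _ F) H at h1
  rw [omegaPoly, omegaPoly, LinearMap.sub_apply, LinearMap.sub_apply, map_sub,
    ← hermForm_conj formConst H, map_sub, map_sub, hermForm_conj, hermForm_conj]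
  push_cast at h0 h1
  rw [← h0, ← h1, neg_mul, mul_neg]

/-- Positivity: a sum of the operators `Ω_{-m} Ω_m` with positive weights vanishes on `F` only if
all `Ω_m` do. -/
theorem omegaPoly_eq_zero_of_sum {N K : ℕ} {F : MvPolynomial Var2 ℂ}
    (h : ∑ m ∈ Finset.range (K + 1), C (halfOne m) * omegaPoly N (-m) (omegaPoly N m F) = 0)
    {m : ℕ} (hm : m ≤ K) : omegaPoly N m F = 0 := by
  choose r hr0 hr hrz using fun m : ℕ => hermForm_self_nonneg formConst_pos (omegaPoly N m F)
  have h1 := congrArg (hermForm formConst F) h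
  rw [map_sum, map_zero] at h1
  have h2 : ∀ m ∈ Finset.range (K + 1), hermForm formConst F
      (C (halfOne m) * omegaPoly N (-m) (omegaPoly N m F)) =
      (((if m = 0 then 1 / 2 else 1) * r m : ℝ) : ℂ) := by
    intro m _
    rw [← smul_eq_C_mul, map_smul, hermForm_omegaPoly, hr, halfOne, smul_eq_mul]
    split_ifs <;> push_cast <;> rfl
  rw [Finset.sum_congr rfl h2, ← Complex.ofReal_sum, Complex.ofReal_eq_zero,
    Finset.sum_eq_zero_iff_of_nonneg (fun m _ => mul_nonneg (by split_ifs <;> norm_num) (hr0 m))]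
    at h1
  refine hrz m ((mul_eq_zero.1 (h1 m (Finset.mem_range.2 (by omega)))).resolve_left ?_)
  split_ifs <;> norm_num

end DoubledVariables

/-! ### The sum of `Ω_{-m} Ω_m` in terms of vertex operators. -/

theorem eta_isPrimitiveRoot {N : ℕ} (hN : 3 ≤ N) : IsPrimitiveRoot (eta N) (cox N) :=
  Complex.isPrimitiveRoot_exp _ (by unfold cox; omega)

theorem cox_eq {N : ℕ} : cox N = 2 * (N - 1) := by unfold cox; omega

theorem kw2_of_zero {N : ℕ} {s : Var2} (h : s.base.1 = 0) : kw2 N s = idx2 s := by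
  simp [kw2, kwWeight, h, idx2]

theorem kw2_of_ne_zero {N : ℕ} {s : Var2} (h : s.base.1 ≠ 0) : kw2 N s = (N - 1) * idx2 s := by
  simp [kw2, kwWeight, h, idx2, mul_comm]

theorem wtLE_idx2_of_kw2 {N : ℕ} (hN : 3 ≤ N) {M : ℕ} {F : MvPolynomial Var2 ℂ}
    (h : WtLE (kw2 N) M F) : WtLE idx2 M F := by
  intro f hf
  refine h f (lt_of_lt_of_le hf ?_)
  rw [Finsupp.weight_apply, Finsupp.weight_apply]
  exact Finset.sum_le_sum fun s _ => Nat.mul_le_mul_left _ (idx2_le_kw2 hN s)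

section Multiples

variable {A : Type*} [AddCommMonoid A]

theorem sum_multiples {h M K : ℕ} (hh : 0 < h) (hK : M ≤ K) (ψ : ℕ → A)
    (hψ : ∀ k, M < k → ψ k = 0) :
    ∑ m ∈ Finset.range K, ψ ((m + 1) * h) =
      ∑ k ∈ Finset.range M, if h ∣ k + 1 then ψ (k + 1) else 0 := by
  refine Finset.sum_bij_ne_zero (fun m _ _ => (m + 1) * h - 1) ?_ ?_ ?_ ?_
  · intro m _ hne
    rw [Finset.mem_range]
    by_contra hc
    exact hne (hψ _ (by
      have : 0 < (m + 1) * h := Nat.mul_pos (by omega) hh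
      omega))
  · intro m _ _ m' _ _ h'
    have h1 : 0 < (m + 1) * h := Nat.mul_pos (by omega) hh
    have h2 : 0 < (m' + 1) * h := Nat.mul_pos (by omega) hh
    have h3 : (m + 1) * h = (m' + 1) * h := by omega
    have := Nat.eq_of_mul_eq_mul_right hh h3
    omega
  · intro k hk hne
    rw [Finset.mem_range] at hk
    have hd : h ∣ k + 1 := by
      by_contra hc
      simp [hc] at hne
    rw [if_pos hd] at hne
    obtain ⟨m, hm⟩ := hd
    have hm0 : m ≠ 0 := by rintro rfl; simp at hm
    have hmk : m ≤ k + 1 := hm ▸ Nat.le_mul_of_pos_left m hh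
    have e : (m - 1 + 1) * h = k + 1 := by rw [hm, Nat.sub_add_cancel (by omega), mul_comm]
    refine ⟨m - 1, Finset.mem_range.2 (by omega), by rw [e]; exact hne, by rw [e]; omega⟩
  · intro m _ _
    have h1 : 0 < (m + 1) * h := Nat.mul_pos (by omega) hh
    rw [Nat.sub_add_cancel h1, if_pos (Dvd.intro_left _ rfl)]

end Multiples

/-- Averaging `ω ^ κ` over the `h`-th roots of unity selects the multiples of `h`. The weight `1/2`
at `m = 0` compensates for `G 0` being counted twice. -/
theorem sum_halfOne_multiples {σ : Type*} {h M K : ℕ} (hh : 0 < h) (hK : M ≤ K)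
    (G : ℤ → MvPolynomial σ ℂ) (hG : ∀ κ : ℤ, (M : ℤ) < |κ| → G κ = 0)
    {η : ℂ} (hη : IsPrimitiveRoot η h) :
    ∑ m ∈ Finset.range (K + 1), C (halfOne m) * (G ((m * h : ℕ) : ℤ) + G (-((m * h : ℕ) : ℤ))) =
      C (1 / h : ℂ) * ∑ j ∈ Finset.range h, ∑ κ ∈ Finset.Icc (-(M : ℤ)) M, C ((η ^ j) ^ κ) * G κ := by
  have hh0 : (h : ℂ) ≠ 0 := Nat.cast_ne_zero.2 hh.ne'
  have h1 : ∀ κ : ℤ, C (1 / h : ℂ) * ∑ j ∈ Finset.range h, C ((η ^ j) ^ κ) * G κ =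
      if (h : ℤ) ∣ κ then G κ else 0 := by
    intro κ
    have e : ∀ j ∈ Finset.range h, (η ^ j) ^ κ = (η ^ κ) ^ j := fun j _ => by
      rw [← zpow_natCast, ← zpow_natCast, ← zpow_mul, ← zpow_mul, mul_comm]
    have hz : (η ^ κ) ^ h = 1 := by
      rw [← zpow_natCast, ← zpow_mul, mul_comm, zpow_mul, zpow_natCast, hη.pow_eq_one, one_zpow]
    rw [← Finset.sum_mul, ← map_sum, Finset.sum_congr rfl e, geom_sum_root hz, ← mul_assoc,
      ← map_mul]
    simp only [hη.zpow_eq_one_iff_dvd]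
    split_ifs
    · rw [one_div, inv_mul_cancel₀ hh0, map_one, one_mul]
    · simp
  rw [Finset.sum_comm, Finset.mul_sum, Finset.sum_congr rfl fun κ _ => h1 κ, sum_Icc_symm,
    Finset.sum_range_succ', add_comm]
  have hC : (C (1 / 2) + C (1 / 2) : MvPolynomial σ ℂ) = 1 := by
    rw [← map_add]; norm_num
  congr 1
  · simp only [halfOne, if_true, zero_mul, dvd_zero]
    simp only [Nat.cast_zero, neg_zero]
    linear_combination (G 0) * hC
  · have e : ∀ m ∈ Finset.range K, C (halfOne (m + 1)) *
        (G (((m + 1) * h : ℕ) : ℤ) + G (-(((m + 1) * h : ℕ) : ℤ))) =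
        (fun k : ℕ => G (k : ℤ) + G (-(k : ℤ))) ((m + 1) * h) := by
      intro m _
      simp [halfOne]
    rw [Finset.sum_congr rfl e, sum_multiples hh hK (fun k : ℕ => G (k : ℤ) + G (-(k : ℤ)))]
    · refine Finset.sum_congr rfl fun k _ => ?_
      have e1 : (h : ℤ) ∣ (k : ℤ) + 1 ↔ h ∣ k + 1 := by
        rw [← Int.natCast_dvd_natCast]; push_cast; rfl
      have e2 : (h : ℤ) ∣ -((k : ℤ) + 1) ↔ h ∣ k + 1 := by rw [Int.dvd_neg, e1]
      simp only [e1, e2]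
      split_ifs <;> simp
    · intro k hk
      rw [hG _ (by rw [abs_of_nonneg (by omega)]; omega), hG _ (by
        rw [abs_neg, abs_of_nonneg (by omega)]; omega), add_zero]

theorem vertexMode_kw_zero {N : ℕ} [IsGrading (kw2 N)] (k : ℤ) (F : MvPolynomial Var2 ℂ) :
    vertexMode (kw2 N) (chargeP 0) (chargeQ 0) k F =
      vertexMode idx2 (chargeP 0) (chargeQ 0) k F := by
  have h : ∀ s : Var2, s.base.1 = 0 → kw2 N s = 1 * idx2 s := fun s h => by
    rw [one_mul, kw2_of_zero h]
  have := vertexMode_rescale idx2 (kw2 N) (p := chargeP 0) (q := chargeQ 0) one_pos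
    (fun s hs => h s (by_contra fun hc => hs (chargeP_of_ne hc)))
    (fun s hs => h s (by_contra fun hc => hs (chargeQ_of_ne hc))) k F
  rwa [Nat.cast_one, one_mul] at this

/-- On the second component `z₂ = ζ ^ (N - 1)` and `h = 2 (N - 1)`, so degree `m h` in `ζ` is degree
`2 m` in `z₂`. -/
theorem vertexMode_kw_one {N : ℕ} (hN : 3 ≤ N) [IsGrading (kw2 N)] (m : ℤ)
    (F : MvPolynomial Var2 ℂ) :
    vertexMode (kw2 N) (chargeP 1) (chargeQ 1) (m * cox N) F =
      vertexMode idx2 (chargeP 1) (chargeQ 1) (2 * m) F := by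
  have h : ∀ s : Var2, s.base.1 = 1 → kw2 N s = (N - 1) * idx2 s := fun s h => by
    rw [kw2_of_ne_zero (by simp [h])]
  rw [← vertexMode_rescale idx2 (kw2 N) (p := chargeP 1) (q := chargeQ 1) (c := N - 1) (by omega)
    (fun s hs => h s (by_contra fun hc => hs (chargeP_of_ne hc)))
    (fun s hs => h s (by_contra fun hc => hs (chargeQ_of_ne hc))) (2 * m) F]
  rw [cox_eq]
  congr 2
  push_cast
  ring

theorem chargeP_mul_chargeQ_of_ne {a b : Fin 2} (h : a ≠ b) (s : Var2) :
    chargeP a s * chargeQ b s = 0 := by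
  by_cases hs : s.base.1 = a
  · rw [chargeQ_of_ne (hs ▸ h), mul_zero]
  · rw [chargeP_of_ne hs, zero_mul]

/-- Without contraction only the term `a = 0` of `vertexMode_comp` survives, so the product is
already normally ordered. This is the case of modes from different components. -/
theorem vertexMode_comp_of_contr {σ : Type*} (w : σ → ℕ) [IsGrading w] {p p' q q' : σ → ℂ}
    (h0 : ∀ s, p' s * q s = 0) {M : ℕ} {F : MvPolynomial σ ℂ} (h : WtLE w M F) (j : ℕ) :
    vertexMode w p q (-(j : ℤ)) (vertexMode w p' q' j F) = normalPair w p p' q q' M F j := by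
  rw [vertexMode_comp w p p' q q' (K := M) h j (by omega),
    Finset.sum_eq_single_of_mem 0 (Finset.mem_range.2 (by omega))]
  · simp [contr_zero]
  · intro a _ ha
    rw [contr_of_mul_eq_zero w h0, if_neg ha, map_zero, zero_mul]

/-- The operators `Ω_{-m} Ω_m`, summed over `m`, in terms of vertex operators. -/
theorem sum_omegaPoly {N : ℕ} (hN : 3 ≤ N) [IsGrading (kw2 N)] {M K : ℕ} (hK : M ≤ K)
    {F : MvPolynomial Var2 ℂ} (hF : WtLE (kw2 N) M F) :
    ∑ m ∈ Finset.range (K + 1), C (halfOne m) * omegaPoly N (-m) (omegaPoly N m F) =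
      C (1 / 2 : ℂ) * ∑ j ∈ Finset.range (cox N), C (1 / (cox N : ℂ) * cayleySq (eta N ^ j)) *
        vertexMode idx2 (fun s => (eta N ^ j) ^ idx2 s * chargeP 0 s + chargeP 0 s)
          (fun s => (eta N ^ j)⁻¹ ^ idx2 s * chargeQ 0 s + chargeQ 0 s) 0 F -
      C (1 / (cox N : ℂ)) * ∑ j ∈ Finset.range (cox N),
        vertexMode (kw2 N) (fun s => (eta N ^ j) ^ kw2 N s * chargeP 0 s + chargeP 1 s)
          (fun s => (eta N ^ j)⁻¹ ^ kw2 N s * chargeQ 0 s + chargeQ 1 s) 0 F +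
      C (N * (cox N + 1) / (3 * cox N) : ℂ) * F -
      C (2 / (cox N : ℂ)) * ∑ l ∈ Finset.range (2 * M + 1),
        linPoly idx2 (chargeP 0) l * linDer idx2 (chargeQ 0) l F -
      ∑ l ∈ Finset.range (2 * M + 1), linPoly idx2 (chargeP 1) l * linDer idx2 (chargeQ 1) l F := by
  have hF' := wtLE_idx2_of_kw2 hN hF
  have hη := eta_isPrimitiveRoot hN
  have hcox0 : (cox N : ℂ) ≠ 0 := Nat.cast_ne_zero.2 (by unfold cox; omega)
  have h0 := sum_modes_eq_vertexMode idx2 (p := chargeP 0) (q := chargeQ 0) (n := N - 1) (by omega)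
    hK hF' (contr_charges 0) (fun s _ => odd_idx2 s) (fun s _ => odd_idx2 s)
    (η := eta N) (by rw [← cox_eq]; exact hη)
  rw [← cox_eq] at h0
  have h1 := sum_modes_eq_vertexMode idx2 (p := chargeP 1) (q := chargeQ 1) (n := 1) one_pos
    hK hF' (contr_charges 1) (fun s _ => odd_idx2 s) (fun s _ => odd_idx2 s)
    (η := -1) (by simpa using IsPrimitiveRoot.neg_one 0 (by norm_num))
  -- The second component has `h₂ = 2`, and `cayleySq` vanishes at both square roots of unity. So
  -- this component gives only a scalar and Heisenberg terms.
  have hc : cayleySq 1 = 0 ∧ cayleySq (-1) = 0 := by simp [cayleySq]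
  rw [show Finset.range (2 * 1) = {0, 1} from rfl, Finset.sum_pair (by norm_num)] at h1
  simp only [pow_zero, pow_one, hc.1, hc.2, mul_zero, map_zero, zero_mul, add_zero,
    zero_add] at h1
  have h2 := sum_halfOne_multiples (h := cox N) (M := M) (K := K) (by unfold cox; omega) hK
    (normalPair (kw2 N) (chargeP 0) (chargeP 1) (chargeQ 0) (chargeQ 1) M F)
    (fun κ hκ => normalPair_eq_zero hκ) hη
  simp_rw [fun j : ℕ => sum_zpow_normalPair (kw2 N) (chargeP 0) (chargeP 1) (chargeQ 0) (chargeQ 1)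
    hF (pow_ne_zero j (hη.ne_zero (by unfold cox; omega)))] at h2
  have h3 : ∀ m : ℕ, normalPair (kw2 N) (chargeP 0) (chargeP 1) (chargeQ 0) (chargeQ 1) M F
        ((m * cox N : ℕ) : ℤ) +
      normalPair (kw2 N) (chargeP 0) (chargeP 1) (chargeQ 0) (chargeQ 1) M F
        (-((m * cox N : ℕ) : ℤ)) =
      vertexMode idx2 (chargeP 0) (chargeQ 0) (-((m * cox N : ℕ) : ℤ))
        (vertexMode idx2 (chargeP 1) (chargeQ 1) ((m * (2 * 1) : ℕ) : ℤ) F) +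
      vertexMode idx2 (chargeP 1) (chargeQ 1) (-((m * (2 * 1) : ℕ) : ℤ))
        (vertexMode idx2 (chargeP 0) (chargeQ 0) ((m * cox N : ℕ) : ℤ) F) := by
    intro m
    have e1 : ((m * cox N : ℕ) : ℤ) = (m : ℤ) * cox N := by push_cast; ring
    have e2 : -((m * cox N : ℕ) : ℤ) = (-m : ℤ) * cox N := by push_cast; ring
    have e3 : ((m * (2 * 1) : ℕ) : ℤ) = 2 * (m : ℤ) := by push_cast; ring
    have e4 : -((m * (2 * 1) : ℕ) : ℤ) = 2 * (-m : ℤ) := by push_cast; ring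
    rw [normalPair_symm (kw2 N) (chargeP 0) (chargeP 1) (chargeQ 0) (chargeQ 1)
        (-((m * cox N : ℕ) : ℤ)), neg_neg,
      ← vertexMode_comp_of_contr (kw2 N) (fun s => chargeP_mul_chargeQ_of_ne (by decide) s) hF,
      ← vertexMode_comp_of_contr (kw2 N) (fun s => chargeP_mul_chargeQ_of_ne (by decide) s) hF,
      vertexMode_kw_zero, vertexMode_kw_zero, e4, e3, ← vertexMode_kw_one hN, ← vertexMode_kw_one hN,
      e2, e1]
  simp_rw [h3] at h2
  have h4 : ∀ m ∈ Finset.range (K + 1), C (halfOne m) * omegaPoly N (-m) (omegaPoly N m F) =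
      C (halfOne m) * vertexMode idx2 (chargeP 0) (chargeQ 0) (-((m * cox N : ℕ) : ℤ))
        (vertexMode idx2 (chargeP 0) (chargeQ 0) ((m * cox N : ℕ) : ℤ) F) +
      C (halfOne m) * vertexMode idx2 (chargeP 1) (chargeQ 1) (-((m * (2 * 1) : ℕ) : ℤ))
        (vertexMode idx2 (chargeP 1) (chargeQ 1) ((m * (2 * 1) : ℕ) : ℤ) F) -
      C (halfOne m) * (vertexMode idx2 (chargeP 0) (chargeQ 0) (-((m * cox N : ℕ) : ℤ))
        (vertexMode idx2 (chargeP 1) (chargeQ 1) ((m * (2 * 1) : ℕ) : ℤ) F) +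
      vertexMode idx2 (chargeP 1) (chargeQ 1) (-((m * (2 * 1) : ℕ) : ℤ))
        (vertexMode idx2 (chargeP 0) (chargeQ 0) ((m * cox N : ℕ) : ℤ) F)) := by
    intro m _
    have e1 : ((m * cox N : ℕ) : ℤ) = (m : ℤ) * cox N := by push_cast; ring
    have e2 : -((m * cox N : ℕ) : ℤ) = (-m : ℤ) * cox N := by push_cast; ring
    have e3 : ((m * (2 * 1) : ℕ) : ℤ) = 2 * (m : ℤ) := by push_cast; ring
    have e4 : -((m * (2 * 1) : ℕ) : ℤ) = 2 * (-m : ℤ) := by push_cast; ring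
    rw [e2, e4, e1, e3]
    simp only [omegaPoly, LinearMap.sub_apply, map_sub]
    ring
  rw [Finset.sum_congr rfl h4, Finset.sum_sub_distrib, Finset.sum_add_distrib, h0, h1, h2]
  have hN' : (N : ℂ) = (cox N + 2) / 2 := by
    have : cox N + 2 = 2 * N := by unfold cox; omega
    have h' : (cox N : ℂ) + 2 = 2 * N := by exact_mod_cast this
    rw [h']; ring
  -- The scalars of the two components are `(h² + 2)/(6h)` and `1/2`. Their sum `(h + 1)(h +
  -- 2)/(6h)` is `N (h + 1)/(3h)`, because `N = (h + 2)/2`.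
  have c1 : (C (N * (cox N + 1) / (3 * cox N) : ℂ) : MvPolynomial Var2 ℂ) =
      C (1 / 2) * C (((cox N : ℂ) ^ 2 + 2) / (3 * cox N)) +
        C (1 / 2) * C ((((2 * 1 : ℕ) : ℂ) ^ 2 + 2) / (3 * (2 * 1 : ℕ))) := by
    rw [← map_mul, ← map_mul, ← map_add, hN']
    congr 1
    push_cast
    field_simp
    ring
  have c2 : (C (2 / (cox N : ℂ)) : MvPolynomial Var2 ℂ) = C (1 / 2) * C (4 / (cox N : ℂ)) := by
    rw [← map_mul]; congr 1; field_simp; norm_num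
  have c3 : (C (1 / 2) * C (4 / (2 * 1 : ℕ) : ℂ) : MvPolynomial Var2 ℂ) = 1 := by
    rw [← map_mul]; norm_num
  rw [c1, c2]
  linear_combination (-∑ l ∈ Finset.range (2 * M + 1),
    linPoly idx2 (chargeP 1) l * linDer idx2 (chargeQ 1) l F) * c3

/-! ### The Coxeter transformation, the cocycle and the products over roots of unity. -/

section Lattice

variable {N : ℕ}

theorem ip_add_left (α β γ : Fin N → ℤ) : ip (α + β) γ = ip α γ + ip β γ := by
  simp [ip, add_mul, Finset.sum_add_distrib]

theorem ip_add_right (α β γ : Fin N → ℤ) : ip α (β + γ) = ip α β + ip α γ := by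
  simp [ip, mul_add, Finset.sum_add_distrib]

theorem ip_neg_right (α β : Fin N → ℤ) : ip α (-β) = -ip α β := by
  simp [ip]

theorem ip_single_right (α : Fin N → ℤ) (j : Fin N) (y : ℤ) :
    ip α (Pi.single j y) = α j * y := by
  simp [ip, Pi.single_apply]

theorem coxeter_add (α β : Fin N → ℤ) : coxeter (α + β) = coxeter α + coxeter β := by
  funext j
  simp only [coxeter, Pi.add_apply]
  split_ifs <;> ring

theorem coxeter_smul (x : ℤ) (α : Fin N → ℤ) : coxeter (x • α) = x • coxeter α := by
  funext j
  simp only [coxeter, Pi.smul_apply, smul_eq_mul]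
  split_ifs <;> ring

theorem coxeter_iterate_add (k : ℕ) (α β : Fin N → ℤ) :
    coxeter^[k] (α + β) = coxeter^[k] α + coxeter^[k] β := by
  induction k with
  | zero => rfl
  | succ k ih => simp only [Function.iterate_succ_apply', ih, coxeter_add]

theorem coxeter_iterate_smul (k : ℕ) (x : ℤ) (α : Fin N → ℤ) :
    coxeter^[k] (x • α) = x • coxeter^[k] α := by
  induction k with
  | zero => rfl
  | succ k ih => simp only [Function.iterate_succ_apply', ih, coxeter_smul]

/-- The orbit of `v₁` under the Coxeter transformation. -/
def orbitVec (N m : ℕ) : Fin N → ℤ := fun j =>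
  if j.1 + 1 = N then 0
  else if m % (2 * (N - 1)) = j.1 then 1
  else if m % (2 * (N - 1)) = j.1 + (N - 1) then -1 else 0

theorem coxeter_orbitVec (hN : 3 ≤ N) (m : ℕ) : coxeter (orbitVec N m) = orbitVec N (m + 1) := by
  funext j
  obtain ⟨j, hj⟩ := j
  have h2 := Nat.mod_lt m (show 0 < 2 * (N - 1) by omega)
  have h1 : (m + 1) % (2 * (N - 1)) =
      if m % (2 * (N - 1)) + 1 = 2 * (N - 1) then 0 else m % (2 * (N - 1)) + 1 := by
    rw [Nat.add_mod, Nat.mod_eq_of_lt (show 1 < 2 * (N - 1) by omega)]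
    split_ifs with h
    · rw [h, Nat.mod_self]
    · exact Nat.mod_eq_of_lt (by omega)
  simp only [coxeter, orbitVec, h1]
  generalize m % (2 * (N - 1)) = r at *
  split_ifs <;> omega

theorem coxeter_iterate_orbitVec (hN : 3 ≤ N) (k m : ℕ) :
    coxeter^[k] (orbitVec N m) = orbitVec N (m + k) := by
  induction k with
  | zero => rfl
  | succ k ih => rw [Function.iterate_succ_apply', ih, coxeter_orbitVec hN, add_assoc]

theorem single_eq_orbitVec {i : Fin N} (hi : i.1 + 1 < N) (x : ℤ) :
    Pi.single i x = x • orbitVec N i.1 := by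
  funext j
  have h1 : i.1 % (2 * (N - 1)) = i.1 := Nat.mod_eq_of_lt (by omega)
  simp only [Pi.smul_apply, orbitVec, smul_eq_mul, h1, Pi.single_apply, Fin.ext_iff]
  have := j.2
  split_ifs <;> omega

theorem coxeter_single_last {i : Fin N} (hi : i.1 + 1 = N) (x : ℤ) :
    coxeter (Pi.single i x) = Pi.single i (-x) := by
  funext j
  simp only [coxeter, Pi.single_apply, Fin.ext_iff]
  have := j.2
  split_ifs <;> omega

theorem coxeter_iterate_single_last {i : Fin N} (hi : i.1 + 1 = N) (k : ℕ) (x : ℤ) :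
    coxeter^[k] (Pi.single i x) = Pi.single i ((-1) ^ k * x) := by
  induction k with
  | zero => simp
  | succ k ih =>
    rw [Function.iterate_succ_apply', ih, coxeter_single_last hi]
    congr 1
    ring

/-- The pairings of the basis vectors with the images of basis vectors under `σ^k`. -/
theorem ip_iterate_single (hN : 3 ≤ N) {i j : Fin N} (hi : i.1 + 1 < N) (hj : j.1 + 1 < N) (k : ℕ)
    (x y : ℤ) : ip (coxeter^[k] (Pi.single i x)) (Pi.single j y) = x * y *
      ((if (i.1 + k) % (2 * (N - 1)) = j.1 then 1 else 0) -
        (if (i.1 + k) % (2 * (N - 1)) = j.1 + (N - 1) then 1 else 0)) := by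
  rw [ip_single_right, single_eq_orbitVec hi, coxeter_iterate_smul, coxeter_iterate_orbitVec hN]
  simp only [Pi.smul_apply, orbitVec, smul_eq_mul]
  rw [if_neg (by omega)]
  split_ifs <;> first | omega | ring

theorem ip_iterate_last {i : Fin N} (hi : i.1 + 1 = N) (k : ℕ) (x y : ℤ) :
    ip (coxeter^[k] (Pi.single i x)) (Pi.single i y) = (-1) ^ k * (x * y) := by
  rw [ip_single_right, coxeter_iterate_single_last hi]
  simp [mul_assoc]

theorem ip_iterate_mixed (hN : 3 ≤ N) {i j : Fin N} (hi : i.1 + 1 < N) (hj : j.1 + 1 = N) (k : ℕ)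
    (x y : ℤ) : ip (coxeter^[k] (Pi.single i x)) (Pi.single j y) = 0 := by
  rw [ip_single_right, single_eq_orbitVec hi, coxeter_iterate_smul, coxeter_iterate_orbitVec hN]
  simp [orbitVec, hj]

theorem ip_iterate_mixed' {i j : Fin N} (hi : i.1 + 1 < N) (hj : j.1 + 1 = N) (k : ℕ)
    (x y : ℤ) : ip (coxeter^[k] (Pi.single j y)) (Pi.single i x) = 0 := by
  rw [ip_single_right, coxeter_iterate_single_last hj, Pi.single_eq_of_ne, zero_mul]
  rw [ne_eq, Fin.ext_iff]
  omega

theorem eps_add_left (α β γ : Fin N → ℤ) : eps (α + β) γ = eps α γ * eps β γ := by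
  simp only [eps, ← Finset.prod_mul_distrib]
  refine Finset.prod_congr rfl fun i _ => Finset.prod_congr rfl fun j _ => ?_
  rw [Pi.add_apply, add_mul, zpow_add₀]
  split_ifs <;> norm_num

theorem eps_add_right (α β γ : Fin N → ℤ) : eps α (β + γ) = eps α β * eps α γ := by
  simp only [eps, ← Finset.prod_mul_distrib]
  refine Finset.prod_congr rfl fun i _ => Finset.prod_congr rfl fun j _ => ?_
  rw [Pi.add_apply, mul_add, zpow_add₀]
  split_ifs <;> norm_num

theorem eps_single (i j : Fin N) (x y : ℤ) :
    eps (Pi.single i x) (Pi.single j y) = (if i ≤ j then (-1 : ℂ) else 1) ^ (x * y) := by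
  rw [eps, Finset.prod_eq_single i, Finset.prod_eq_single j]
  · simp
  · intro b _ hb
    rw [Pi.single_eq_of_ne hb]; simp
  · simp
  · intro b _ hb
    rw [Pi.single_eq_of_ne hb]; simp
  · simp

theorem eps_root {i j : Fin N} (hij : i ≠ j) (x y : ℤˣ) :
    eps (Pi.single i (x : ℤ) + Pi.single j (y : ℤ)) (-(Pi.single i (x : ℤ) + Pi.single j (y : ℤ))) =
      -1 := by
  rw [neg_add, ← Pi.single_neg, ← Pi.single_neg, eps_add_left, eps_add_right, eps_add_right,
    eps_single, eps_single, eps_single, eps_single]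
  rcases lt_or_gt_of_ne hij with h | h
  · rw [if_pos le_rfl, if_pos le_rfl, if_pos h.le, if_neg (not_le.2 h)]
    rcases Int.units_eq_one_or x with rfl | rfl <;> rcases Int.units_eq_one_or y with rfl | rfl <;>
      simp
  · rw [if_pos le_rfl, if_pos le_rfl, if_pos h.le, if_neg (not_le.2 h)]
    rcases Int.units_eq_one_or x with rfl | rfl <;> rcases Int.units_eq_one_or y with rfl | rfl <;>
      simp

theorem eta_pow_half (hN : 3 ≤ N) : eta N ^ (N - 1) = -1 := by
  have hη := eta_isPrimitiveRoot hN
  have h1 : (eta N ^ (N - 1)) ^ 2 = 1 := by rw [← pow_mul, mul_comm, ← cox_eq, hη.pow_eq_one]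
  have h2 : (eta N ^ (N - 1) - 1) * (eta N ^ (N - 1) + 1) = 0 := by linear_combination h1
  rcases mul_eq_zero.1 h2 with h | h
  · exact absurd (sub_eq_zero.1 h) (hη.pow_ne_one_of_pos_of_lt (by omega) (by unfold cox; omega))
  · linear_combination h

theorem eta_ne_zero (hN : 3 ≤ N) : eta N ≠ 0 :=
  (eta_isPrimitiveRoot hN).ne_zero (by unfold cox; omega)

/-- Exactly one residue `k` modulo `h` satisfies `i + k ≡ l`. It lies in the range `1, …, h - 1`
unless `i = l`, when it is the excluded `k = 0`. -/
theorem prod_indicator (hN : 3 ≤ N) {i l : ℕ} (hi : i < cox N) (hl : l < cox N) :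
    ∏ k ∈ Finset.Icc 1 (cox N - 1), (1 - eta N ^ k) ^ (if (i + k) % cox N = l then (1 : ℤ) else 0) =
      if i = l then 1 else 1 - eta N ^ ((l : ℤ) - i) := by
  have hη := eta_isPrimitiveRoot hN
  have key : ∀ k ∈ Finset.Icc 1 (cox N - 1), (i + k) % cox N = l →
      (i + k = l ∨ i + k = l + cox N) := by
    intro k hk h
    rw [Finset.mem_Icc] at hk
    by_cases hc : i + k < cox N
    · rw [Nat.mod_eq_of_lt hc] at h
      exact Or.inl h
    · rw [Nat.mod_eq_sub_mod (by omega), Nat.mod_eq_of_lt (by omega)] at h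
      right; omega
  split_ifs with h
  · refine Finset.prod_eq_one fun k hk => ?_
    rw [if_neg, zpow_zero]
    intro hc
    have := key k hk hc
    rw [Finset.mem_Icc] at hk
    omega
  · set k0 := if i < l then l - i else l + cox N - i with hk0
    have hk0' : k0 ∈ Finset.Icc 1 (cox N - 1) := by
      rw [Finset.mem_Icc, hk0]; split_ifs <;> omega
    rw [Finset.prod_eq_single_of_mem k0 hk0']
    · have e : (i + k0) % cox N = l := by
        rw [hk0]
        split_ifs with h1
        · rw [Nat.mod_eq_of_lt (by omega)]; omega
        · rw [show i + (l + cox N - i) = l + cox N by omega, Nat.add_mod_right,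
            Nat.mod_eq_of_lt hl]
      rw [if_pos e, zpow_one]
      congr 1
      rw [hk0]
      split_ifs with h1
      · rw [← zpow_natCast]; congr 1; omega
      · rw [← zpow_natCast, show ((l + cox N - i : ℕ) : ℤ) = ((l : ℤ) - i) + cox N by omega,
          zpow_add₀ (eta_ne_zero hN), zpow_natCast _ (cox N), hη.pow_eq_one, mul_one]
    · intro k hk hne
      rw [if_neg, zpow_zero]
      intro hc
      have := key k hk hc
      rw [Finset.mem_Icc] at hk
      apply hne
      rw [hk0]
      split_ifs <;> omega

theorem one_sub_eta_pow_ne_zero (hN : 3 ≤ N) {k : ℕ} (hk : k ∈ Finset.Icc 1 (cox N - 1)) :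
    1 - eta N ^ k ≠ 0 := by
  rw [Finset.mem_Icc] at hk
  exact sub_ne_zero.2 ((eta_isPrimitiveRoot hN).pow_ne_one_of_pos_of_lt (by omega) (by omega)).symm

/-- The product `∏ₖ (1 - η ^ k) ^ (σ^k v_i | v_j)`. -/
theorem prod_pairing (hN : 3 ≤ N) {i j : ℕ} (hi : i + 1 < N) (hj : j + 1 < N) :
    ∏ k ∈ Finset.Icc 1 (cox N - 1), (1 - eta N ^ k) ^
      ((if (i + k) % (2 * (N - 1)) = j then (1 : ℤ) else 0) -
        (if (i + k) % (2 * (N - 1)) = j + (N - 1) then (1 : ℤ) else 0)) =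
      (if i = j then 1 else 1 - eta N ^ ((j : ℤ) - i)) / (1 + eta N ^ ((j : ℤ) - i)) := by
  rw [← cox_eq]
  rw [Finset.prod_congr rfl fun k hk => zpow_sub₀ (one_sub_eta_pow_ne_zero hN hk) _ _,
    Finset.prod_div_distrib, prod_indicator hN (by unfold cox; omega) (by unfold cox; omega),
    prod_indicator hN (by unfold cox; omega) (by unfold cox; omega), if_neg (by omega : i ≠ j + (N - 1))]
  congr 1
  rw [show ((j + (N - 1) : ℕ) : ℤ) - i = ((j : ℤ) - i) + (N - 1 : ℕ) by push_cast; ring,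
    zpow_add₀ (eta_ne_zero hN), zpow_natCast _ (N - 1), eta_pow_half hN]
  ring

end Lattice

/-! ### The scalars `U_α U_{-α}`. -/

section Lattice

variable {N : ℕ}

theorem prod_Icc_one (n : ℕ) (φ : ℕ → ℂ) :
    ∏ k ∈ Finset.Icc 1 n, φ k = ∏ k ∈ Finset.range n, φ (k + 1) := by
  induction n with
  | zero => simp
  | succ n ih => rw [Finset.prod_Icc_succ_top (by omega), Finset.prod_range_succ, ih]

theorem prod_Icc_even_odd (n : ℕ) (φ : ℕ → ℂ) : ∏ k ∈ Finset.Icc 1 (2 * n + 1), φ k =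
    (∏ k ∈ Finset.range n, φ (2 * (k + 1))) * ∏ k ∈ Finset.range (n + 1), φ (2 * k + 1) := by
  induction n with
  | zero => simp
  | succ n ih =>
    rw [show 2 * (n + 1) + 1 = 2 * n + 1 + 1 + 1 by ring, Finset.prod_Icc_succ_top (by omega),
      Finset.prod_Icc_succ_top (by omega), ih, Finset.prod_range_succ (fun k => φ (2 * (k + 1))) n,
      Finset.prod_range_succ _ (n + 1)]
    rw [show 2 * n + 1 + 1 = 2 * (n + 1) by ring]
    generalize ∏ k ∈ Finset.range n, φ (2 * (k + 1)) = A
    generalize ∏ k ∈ Finset.range (n + 1), φ (2 * k + 1) = B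
    ring

/-- The product over all `k` is `h`. The even `k` belong to `η²`, of order `N - 1`, and give `h/2`;
the odd `k` therefore give `2`, and the quotient is `h/4`. -/
theorem prod_alternating (hN : 3 ≤ N) :
    ∏ k ∈ Finset.Icc 1 (cox N - 1), (1 - eta N ^ k) ^ ((-1 : ℤ) ^ k) = (cox N : ℂ) / 4 := by
  obtain ⟨n, rfl⟩ : ∃ n, N = n + 2 := ⟨N - 2, by omega⟩
  have hη := eta_isPrimitiveRoot hN
  set η := eta (n + 2)
  have hc : cox (n + 2) = 2 * n + 1 + 1 := by unfold cox; omega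
  rw [hc] at hη ⊢
  have h2 : IsPrimitiveRoot (η ^ 2) (n + 1) := hη.pow (by omega) (by ring)
  have e1 := hη.prod_one_sub_pow_eq_order
  have e2 := h2.prod_one_sub_pow_eq_order
  rw [← prod_Icc_one _ fun k => 1 - η ^ k, prod_Icc_even_odd] at e1
  simp_rw [← pow_mul] at e2
  have hn : (n : ℂ) + 1 ≠ 0 := by exact_mod_cast Nat.succ_ne_zero n
  rw [e2] at e1
  have e3 : ∏ k ∈ Finset.range (n + 1), (1 - η ^ (2 * k + 1)) = 2 := by
    apply mul_left_cancel₀ hn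
    rw [e1]; push_cast; ring
  have e4 : ∀ k ∈ Finset.range n, (1 - η ^ (2 * (k + 1))) ^ ((-1 : ℤ) ^ (2 * (k + 1))) =
      1 - η ^ (2 * (k + 1)) := by
    intro k _
    rw [(even_two_mul (k + 1)).neg_one_pow, zpow_one]
  have e5 : ∀ k ∈ Finset.range (n + 1), (1 - η ^ (2 * k + 1)) ^ ((-1 : ℤ) ^ (2 * k + 1)) =
      (1 - η ^ (2 * k + 1))⁻¹ := by
    intro k _
    rw [(odd_two_mul_add_one k).neg_one_pow, zpow_neg_one]
  rw [Nat.add_sub_cancel, prod_Icc_even_odd, Finset.prod_congr rfl e4, Finset.prod_congr rfl e5, e2,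
    Finset.prod_inv_distrib, e3]
  push_cast
  ring

/-- The number `x η ^ i` for the vector `x v_i`. -/
def rootPoint (N : ℕ) (i : Fin N) (x : ℤˣ) : ℂ := ((x : ℤ) : ℂ) * eta N ^ (i.1 + 1)

theorem rootPoint_ne_zero (hN : 3 ≤ N) (i : Fin N) (x : ℤˣ) : rootPoint N i x ≠ 0 :=
  mul_ne_zero (by simp) (pow_ne_zero _ (eta_ne_zero hN))

theorem units_mul_self (x : ℤˣ) : (x : ℤ) * x = 1 := by
  rcases Int.units_eq_one_or x with rfl | rfl <;> simp

theorem ip_root {i j : Fin N} (hij : i ≠ j) (x y : ℤˣ) :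
    ip (Pi.single i (x : ℤ) + Pi.single j (y : ℤ)) (-(Pi.single i (x : ℤ) + Pi.single j (y : ℤ))) =
      -2 := by
  rw [ip_neg_right, ip_add_right, ip_single_right, ip_single_right]
  simp only [Pi.add_apply, Pi.single_eq_same, Pi.single_eq_of_ne hij, Pi.single_eq_of_ne hij.symm]
  linear_combination -units_mul_self x - units_mul_self y

/-- The part of `v_i` contributes `1/2` to the product over `k`, and the part of `v_N`, on which
`σ^k` acts by `(-1)^k`, contributes `h/4`. There are no cross terms, so `B(α, -α) = 8h`, and the
cocycle gives the sign. -/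
theorem uProd_mixed (hN : 3 ≤ N) {i j : Fin N} (hi : i.1 + 1 < N) (hj : j.1 + 1 = N) (x y : ℤˣ) :
    uProd (Pi.single i (x : ℤ) + Pi.single j (y : ℤ)) = -(1 / (8 * cox N)) := by
  have hij : i ≠ j := by rw [ne_eq, Fin.ext_iff]; omega
  have hc : (cox N : ℂ) ≠ 0 := Nat.cast_ne_zero.2 (by unfold cox; omega)
  have h1 : ∀ k ∈ Finset.Icc 1 (cox N - 1),
      (1 - eta N ^ k) ^ ip (coxeter^[k] (Pi.single i (x : ℤ) + Pi.single j (y : ℤ)))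
        (-(Pi.single i (x : ℤ) + Pi.single j (y : ℤ))) =
      ((1 - eta N ^ k) ^ ((if (i.1 + k) % (2 * (N - 1)) = i.1 then (1 : ℤ) else 0) -
        (if (i.1 + k) % (2 * (N - 1)) = i.1 + (N - 1) then (1 : ℤ) else 0)) *
        (1 - eta N ^ k) ^ ((-1 : ℤ) ^ k))⁻¹ := by
    intro k hk
    rw [← zpow_add₀ (one_sub_eta_pow_ne_zero hN hk), ← zpow_neg, ip_neg_right, coxeter_iterate_add,
      ip_add_left, ip_add_right, ip_add_right, ip_iterate_single hN hi hi, ip_iterate_mixed hN hi hj,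
      ip_iterate_mixed' hi hj, ip_iterate_last hj, units_mul_self, units_mul_self]
    congr 1
    ring
  rw [uProd, eps_root hij, bFun, ip_root hij, Finset.prod_congr rfl h1, Finset.prod_inv_distrib,
    Finset.prod_mul_distrib, prod_pairing hN hi hi, prod_alternating hN]
  rw [if_pos rfl, sub_self, zpow_zero, neg_neg, zpow_ofNat]
  field_simp
  norm_num

/-- Each of `v_i` and `v_j` contributes `1/2` to the product over `k`. The two cross products
multiply to `-cayleySq (η ^ (j - i))`, raised to a power of sign determined by the product of the
signs `x` and `y`. -/
theorem uProd_inner (hN : 3 ≤ N) {i j : Fin N} (hij : i ≠ j) (hi : i.1 + 1 < N) (hj : j.1 + 1 < N)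
    (x y : ℤˣ) : uProd (Pi.single i (x : ℤ) + Pi.single j (y : ℤ)) =
      1 / (4 * (cox N : ℂ) ^ 2) * cayleySq (rootPoint N i x * (rootPoint N j y)⁻¹) := by
  have hc : (cox N : ℂ) ≠ 0 := Nat.cast_ne_zero.2 (by unfold cox; omega)
  set f : ℕ → ℕ → ℕ → ℤ := fun i j k => (if (i + k) % (2 * (N - 1)) = j then (1 : ℤ) else 0) -
        (if (i + k) % (2 * (N - 1)) = j + (N - 1) then (1 : ℤ) else 0) with hf
  have h1 : ∀ k ∈ Finset.Icc 1 (cox N - 1),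
      (1 - eta N ^ k) ^ ip (coxeter^[k] (Pi.single i (x : ℤ) + Pi.single j (y : ℤ)))
        (-(Pi.single i (x : ℤ) + Pi.single j (y : ℤ))) =
      ((1 - eta N ^ k) ^ f i i k * (1 - eta N ^ k) ^ f j j k)⁻¹ *
        ((1 - eta N ^ k) ^ f i j k * (1 - eta N ^ k) ^ f j i k) ^ (-((x : ℤ) * y)) := by
    intro k hk
    rw [← zpow_add₀ (one_sub_eta_pow_ne_zero hN hk), ← zpow_add₀ (one_sub_eta_pow_ne_zero hN hk),
      ← zpow_neg, ← zpow_mul, ← zpow_add₀ (one_sub_eta_pow_ne_zero hN hk),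
      ip_neg_right, coxeter_iterate_add,
      ip_add_left, ip_add_right, ip_add_right, ip_iterate_single hN hi hi, ip_iterate_single hN hi hj,
      ip_iterate_single hN hj hi, ip_iterate_single hN hj hj, units_mul_self, units_mul_self]
    congr 1
    simp only [hf]
    ring
  set X : ℂ := eta N ^ ((j.1 : ℤ) - i.1) with hX
  have hX0 : X ≠ 0 := zpow_ne_zero _ (eta_ne_zero hN)
  have hX' : eta N ^ ((i.1 : ℤ) - j.1) = X⁻¹ := by rw [hX, ← zpow_neg, neg_sub]
  have hR : (1 - X) / (1 + X) * ((1 - X⁻¹) / (1 + X⁻¹)) = -cayleySq X := by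
    have : (1 - X⁻¹) / (1 + X⁻¹) = (X - 1) / (X + 1) := by
      rw [← mul_div_mul_left _ _ hX0, mul_sub, mul_add, mul_inv_cancel₀ hX0, mul_one]
    rw [this, cayleySq, add_comm X 1]
    ring
  have hne : i.1 ≠ j.1 := fun h => hij (Fin.ext h)
  rw [uProd, eps_root hij, bFun, ip_root hij, Finset.prod_congr rfl h1, Finset.prod_mul_distrib,
    Finset.prod_inv_distrib, Finset.prod_mul_distrib, Finset.prod_zpow, Finset.prod_mul_distrib,
    prod_pairing hN hi hi, prod_pairing hN hj hj, prod_pairing hN hi hj, prod_pairing hN hj hi,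
    if_pos rfl, if_pos rfl, if_neg hne, if_neg hne.symm, ← hX, hX', hR, sub_self, sub_self, zpow_zero]
  have hpt : rootPoint N i x * (rootPoint N j y)⁻¹ = ((((x : ℤ) * y : ℤ)) : ℂ) * X⁻¹ := by
    have hy : ((y : ℤ) : ℂ)⁻¹ = ((y : ℤ) : ℂ) := by
      rcases Int.units_eq_one_or y with rfl | rfl <;> norm_num
    rw [rootPoint, rootPoint, mul_inv, hy, hX, ← zpow_neg, neg_sub, zpow_sub₀ (eta_ne_zero hN),
      zpow_natCast, zpow_natCast, pow_succ, pow_succ]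
    have := eta_ne_zero hN
    push_cast
    field_simp
  have hinv : ∀ u : ℂ, u ≠ 0 → cayleySq u⁻¹ = cayleySq u := by
    intro u hu
    rw [cayleySq, cayleySq, ← mul_div_mul_left _ _ hu, mul_sub, mul_add, mul_inv_cancel₀ hu, mul_one,
      add_comm u 1, div_pow, div_pow]
    ring
  rw [hpt]
  have hxy : (x : ℤ) * y = 1 ∨ (x : ℤ) * y = -1 := by
    rcases Int.units_eq_one_or x with rfl | rfl <;> rcases Int.units_eq_one_or y with rfl | rfl <;>
      simp
  rcases hxy with h | h
  · rw [h, Int.cast_one, one_mul, hinv X hX0, neg_neg, zpow_ofNat, zpow_neg_one]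
    rw [show (1 : ℂ) + 1 = 2 by norm_num]
    field_simp
    norm_num
    ring
  · rw [h, Int.cast_neg, Int.cast_one, neg_one_mul, neg_inv, hinv _ (neg_ne_zero.2 hX0), neg_neg,
      neg_neg, zpow_ofNat, zpow_one]
    -- For opposite signs the cross terms enter inverted, and so does `cayleySq` when the ratio of
    -- the two root points changes sign.
    have : cayleySq (-X) = (cayleySq X)⁻¹ := by
      rw [cayleySq, cayleySq, ← inv_pow, inv_div]
      congr 2; ring
    rw [this]
    rw [show (1 : ℂ) + 1 = 2 by norm_num]
    field_simp
    norm_num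

end Lattice

/-! ### The sum over the roots. -/

section RootSum

variable {N : ℕ} {A : Type*} [AddCommMonoid A]

theorem single_add_single_eq {i j i' j' : Fin N} (hij : i ≠ j) (hij' : i' ≠ j') {x y x' y' : ℤˣ}
    (h : (Pi.single i' (x' : ℤ) + Pi.single j' (y' : ℤ) : Fin N → ℤ) =
      Pi.single i (x : ℤ) + Pi.single j (y : ℤ)) :
    (i', j', x', y') = (i, j, x, y) ∨ (i', j', x', y') = (j, i, y, x) := by
  have key : ∀ l, (if l = i' then (x' : ℤ) else 0) + (if l = j' then (y' : ℤ) else 0) =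
      (if l = i then (x : ℤ) else 0) + (if l = j then (y : ℤ) else 0) := by
    intro l
    have := congrFun h l
    simpa only [Pi.add_apply, Pi.single_apply] using this
  have hx := x.isUnit.ne_zero
  have hy := y.isUnit.ne_zero
  have hx' := x'.isUnit.ne_zero
  have hy' := y'.isUnit.ne_zero
  have h1 := key i'
  have h2 := key j'
  rw [if_pos rfl, if_neg hij', add_zero] at h1
  rw [if_pos rfl, if_neg hij'.symm, zero_add] at h2
  by_cases ei : i' = i
  · subst ei
    rw [if_pos rfl, if_neg hij, add_zero] at h1
    rw [if_neg hij'.symm, zero_add] at h2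
    by_cases ej : j' = j
    · subst ej
      rw [if_pos rfl] at h2
      left
      rw [Units.ext h1, Units.ext h2]
    · rw [if_neg ej] at h2
      exact absurd h2 hy'
  · rw [if_neg ei, zero_add] at h1
    by_cases ei' : i' = j
    · subst ei'
      rw [if_pos rfl] at h1
      rw [if_neg hij'.symm, add_zero] at h2
      by_cases ej : j' = i
      · subst ej
        rw [if_pos rfl] at h2
        right
        rw [Units.ext h1, Units.ext h2]
      · rw [if_neg ej] at h2
        exact absurd h2 hy'
    · rw [if_neg ei'] at h1
      exact absurd h1 hx'

/-- A root determines its two signed basis vectors up to order, so each root arises from exactly two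
quadruples. -/
theorem two_nsmul_sum_roots (φ : (Fin N → ℤ) → A) :
    2 • ∑ α ∈ roots N, φ α = ∑ i : Fin N, ∑ j : Fin N, ∑ x : ℤˣ, ∑ y : ℤˣ,
      if i ≠ j then φ (Pi.single i (x : ℤ) + Pi.single j (y : ℤ)) else 0 := by
  have h := Finset.sum_comp (s := (Finset.univ : Finset (Fin N × Fin N × ℤˣ × ℤˣ)).filter
    fun x => x.1 ≠ x.2.1) φ (fun x => Pi.single x.1 (x.2.2.1 : ℤ) + Pi.single x.2.1 (x.2.2.2 : ℤ))
  rw [Finset.sum_filter] at h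
  simp only [Fintype.sum_prod_type] at h
  rw [h, Finset.smul_sum]
  refine Finset.sum_congr rfl fun α hα => ?_
  congr 1
  obtain ⟨⟨i, j, x, y⟩, hm, rfl⟩ := Finset.mem_image.1 hα
  have hij : i ≠ j := (Finset.mem_filter.1 hm).2
  symm
  rw [Finset.card_eq_two]
  refine ⟨(i, j, x, y), (j, i, y, x), by simp [hij], ?_⟩
  ext ⟨i', j', x', y'⟩
  simp only [Finset.mem_filter, Finset.mem_univ, true_and, Finset.mem_insert, Finset.mem_singleton]
  constructor
  · rintro ⟨h1, h2⟩
    exact single_add_single_eq hij h1 h2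
  · rintro (h | h)
    · simp only [Prod.mk.injEq] at h
      obtain ⟨rfl, rfl, rfl, rfl⟩ := h
      exact ⟨hij, rfl⟩
    · simp only [Prod.mk.injEq] at h
      obtain ⟨rfl, rfl, rfl, rfl⟩ := h
      exact ⟨hij.symm, add_comm _ _⟩

theorem sum_units (φ : ℤˣ → A) : ∑ x : ℤˣ, φ x = φ 1 + φ (-1) := by
  rw [show (Finset.univ : Finset ℤˣ) = {1, -1} from rfl, Finset.sum_pair (by decide)]

theorem sum_root_shift {h : ℕ} {η : ℂ} (hη : η ^ h = 1) (ψ : ℂ → A) :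
    ∑ k ∈ Finset.range h, ψ (η ^ (k + 1)) = ∑ k ∈ Finset.range h, ψ (η ^ k) := by
  rcases Nat.eq_zero_or_pos h with rfl | hh
  · simp
  · obtain ⟨n, rfl⟩ : ∃ n, h = n + 1 := ⟨h - 1, by omega⟩
    rw [Finset.sum_range_succ, Finset.sum_range_succ', hη, pow_zero]

/-- As `-1 = η ^ (N - 1)`, the numbers `± η ^ i` with `1 ≤ i ≤ N - 1` are all the `h`-th roots of
unity, each once. -/
theorem sum_rootPoint {n : ℕ} (hn : 3 ≤ n + 1) (ψ : ℂ → A) :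
    ∑ i : Fin n, ∑ x : ℤˣ, ψ (rootPoint (n + 1) i.castSucc x) =
      ∑ k ∈ Finset.range (cox (n + 1)), ψ (eta (n + 1) ^ k) := by
  have hη := eta_isPrimitiveRoot hn
  rw [← sum_root_shift hη.pow_eq_one, cox_eq, Nat.add_sub_cancel, two_mul, Finset.sum_range_add]
  simp_rw [sum_units]
  rw [Finset.sum_add_distrib, Finset.sum_range, Finset.sum_range]
  congr 1
  · refine Finset.sum_congr rfl fun i _ => ?_
    simp [rootPoint]
  · refine Finset.sum_congr rfl fun i _ => ?_
    congr 1
    have h := eta_pow_half hn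
    rw [Nat.add_sub_cancel] at h
    rw [add_assoc, pow_add (eta (n + 1)) n, h]
    simp [rootPoint]

theorem sum_root_div (hN : 3 ≤ N) (ψ : ℂ → A) (l : ℕ) :
    ∑ k ∈ Finset.range (cox N), ψ (eta N ^ k * (eta N ^ l)⁻¹) =
      ∑ k ∈ Finset.range (cox N), ψ (eta N ^ k) := by
  have hη := eta_isPrimitiveRoot hN
  induction l with
  | zero => simp
  | succ l ih =>
    rw [← ih, ← sum_root_shift hη.pow_eq_one (fun u => ψ (u * (eta N ^ (l + 1))⁻¹))]
    refine Finset.sum_congr rfl fun k _ => ?_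
    congr 1
    have := eta_ne_zero hN
    rw [pow_succ, pow_succ]
    field_simp

theorem rootPoint_pow_odd (i : Fin N) (x : ℤˣ) {m : ℕ} (hm : Odd m) :
    ((x : ℤ) : ℂ) * eta N ^ ((1 : ℤ) * ((i.1 + 1 : ℕ) : ℤ) * (m : ℤ)) = rootPoint N i x ^ m ∧
    ((x : ℤ) : ℂ) * eta N ^ ((-1 : ℤ) * ((i.1 + 1 : ℕ) : ℤ) * (m : ℤ)) = (rootPoint N i x)⁻¹ ^ m := by
  have hx : ((x : ℤ) : ℂ) ^ m = ((x : ℤ) : ℂ) := by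
    rcases Int.units_eq_one_or x with rfl | rfl
    · simp
    · simp [hm.neg_one_pow]
  have hx' : ((x : ℤ) : ℂ)⁻¹ = ((x : ℤ) : ℂ) := by
    rcases Int.units_eq_one_or x with rfl | rfl <;> norm_num
  constructor
  · rw [rootPoint, mul_pow, hx, one_mul, ← Nat.cast_mul, zpow_natCast, pow_mul]
  · rw [rootPoint, mul_inv, hx', mul_pow, hx, neg_one_mul, neg_mul, ← Nat.cast_mul, zpow_neg,
      zpow_natCast, pow_mul, inv_pow]

/-- The charges of the vertex operators of a root on the tensor square. -/
def rootP (α : Fin N → ℤ) (s : Var2) : ℂ := (s.sign : ℂ) * rootCoeff α 1 s.base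

/-- The coefficients of the derivatives in the vertex operators of a root on the tensor square. -/
def rootQ (α : Fin N → ℤ) (s : Var2) : ℂ :=
  (s.sign : ℂ) * (-2 / (idx2 s : ℂ) * rootCoeff α (-1) s.base)

theorem rootCoeff_add (α β : Fin N → ℤ) (e : ℤ) (s : Var) :
    rootCoeff (α + β) e s = rootCoeff α e s + rootCoeff β e s := by
  unfold rootCoeff
  split_ifs
  · rw [← Finset.sum_add_distrib]
    refine Finset.sum_congr rfl fun i _ => ?_
    split_ifs
    · push_cast [Pi.add_apply]; ring
    · simp
  · rw [← Finset.sum_add_distrib]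
    refine Finset.sum_congr rfl fun i _ => ?_
    split_ifs
    · push_cast [Pi.add_apply]; ring
    · simp

theorem rootCoeff_neg (α : Fin N → ℤ) (e : ℤ) (s : Var) : rootCoeff (-α) e s = -rootCoeff α e s := by
  have h0 : rootCoeff (0 : Fin N → ℤ) e s = 0 := by simp [rootCoeff]
  have := rootCoeff_add (-α) α e s
  rw [neg_add_cancel, h0] at this
  linear_combination -this

theorem rootCoeff_single_inner {i : Fin N} (hi : i.1 + 1 < N) (x : ℤ) (e : ℤ) (s : Var) :
    rootCoeff (Pi.single i x) e s =
      if s.1 = 0 then (x : ℂ) * eta N ^ (e * ((i.1 + 1 : ℕ) : ℤ) * (s.idx : ℤ)) else 0 := by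
  unfold rootCoeff
  split_ifs with h
  · rw [Finset.sum_eq_single i]
    · rw [if_pos hi, Pi.single_eq_same]
    · intro b _ hb
      rw [Pi.single_eq_of_ne hb]; simp
    · simp
  · refine Finset.sum_eq_zero fun b _ => ?_
    split_ifs with hb
    · rw [Pi.single_eq_of_ne, Int.cast_zero]
      rw [ne_eq, Fin.ext_iff]; omega
    · rfl

theorem rootCoeff_single_last {i : Fin N} (hi : i.1 + 1 = N) (x : ℤ) (e : ℤ) (s : Var) :
    rootCoeff (Pi.single i x) e s = if s.1 = 0 then 0 else (x : ℂ) := by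
  unfold rootCoeff
  split_ifs with h
  · refine Finset.sum_eq_zero fun b _ => ?_
    split_ifs with hb
    · rw [Pi.single_eq_of_ne, Int.cast_zero, zero_mul]
      rw [ne_eq, Fin.ext_iff]; omega
    · rfl
  · rw [Finset.sum_eq_single i]
    · rw [if_pos hi, Pi.single_eq_same]
    · intro b _ hb
      rw [Pi.single_eq_of_ne hb]; simp
    · simp

theorem fin_two_ne_zero {a : Fin 2} : a ≠ 0 ↔ a = 1 := by omega

theorem chargeQ_eq (a : Fin 2) (s : Var2) : chargeQ a s =
    if s.base.1 = a then (s.sign : ℂ) * (-2 / (idx2 s : ℂ)) else 0 := by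
  rw [chargeQ, chargeR, formConst]
  split_ifs
  · push_cast; ring
  · simp

theorem chargeP_eq (a : Fin 2) (s : Var2) : chargeP a s =
    if s.base.1 = a then (s.sign : ℂ) else 0 := by
  rw [chargeP, chargeR]
  split_ifs <;> simp

/-- On `t¹_m` the multiplication charge of `x v_i + y v_j` is `U ^ m + W ^ m` up to the sign of the
copy, where `U` and `W` are the root points; the signs `x`, `y` can be absorbed into them because
`m` is odd. Rescaling `ζ` by `W` leaves only the ratio `U / W`. -/
theorem vertexMode_root_inner (hN : 3 ≤ N) [IsGrading (kw2 N)] {i j : Fin N} (hi : i.1 + 1 < N)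
    (hj : j.1 + 1 < N) (x y : ℤˣ) (F : MvPolynomial Var2 ℂ) :
    vertexMode (kw2 N) (rootP (Pi.single i (x : ℤ) + Pi.single j (y : ℤ)))
      (rootQ (Pi.single i (x : ℤ) + Pi.single j (y : ℤ))) 0 F =
    vertexMode idx2
      (fun s => (rootPoint N i x * (rootPoint N j y)⁻¹) ^ idx2 s * chargeP 0 s + chargeP 0 s)
      (fun s => (rootPoint N i x * (rootPoint N j y)⁻¹)⁻¹ ^ idx2 s * chargeQ 0 s + chargeQ 0 s) 0 F := by
  have hU := rootPoint_ne_zero hN i x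
  have hW := rootPoint_ne_zero hN j y
  have hp : ∀ s, rootP (Pi.single i (x : ℤ) + Pi.single j (y : ℤ)) s = rootPoint N j y ^ idx2 s *
      ((rootPoint N i x * (rootPoint N j y)⁻¹) ^ idx2 s * chargeP 0 s + chargeP 0 s) := by
    intro s
    rw [rootP, rootCoeff_add, rootCoeff_single_inner hi, rootCoeff_single_inner hj, chargeP_eq]
    split_ifs
    · change _ * (_ * eta N ^ (_ * (idx2 s : ℤ)) + _ * eta N ^ (_ * (idx2 s : ℤ))) = _
      rw [(rootPoint_pow_odd i x (odd_idx2 s)).1, (rootPoint_pow_odd j y (odd_idx2 s)).1,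
        mul_pow, inv_pow]
      have := pow_ne_zero (idx2 s) hW
      field_simp
    · simp
  have hq : ∀ s, rootQ (Pi.single i (x : ℤ) + Pi.single j (y : ℤ)) s = (rootPoint N j y)⁻¹ ^ idx2 s *
      ((rootPoint N i x * (rootPoint N j y)⁻¹)⁻¹ ^ idx2 s * chargeQ 0 s + chargeQ 0 s) := by
    intro s
    rw [rootQ, rootCoeff_add, rootCoeff_single_inner hi, rootCoeff_single_inner hj, chargeQ_eq]
    split_ifs
    · change _ * (_ * (_ * eta N ^ (_ * (idx2 s : ℤ)) + _ * eta N ^ (_ * (idx2 s : ℤ)))) = _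
      rw [(rootPoint_pow_odd i x (odd_idx2 s)).2, (rootPoint_pow_odd j y (odd_idx2 s)).2,
        mul_inv, inv_inv, mul_pow, inv_pow, inv_pow]
      have h1 := pow_ne_zero (idx2 s) hW
      have h2 := pow_ne_zero (idx2 s) hU
      field_simp
      ring
    · simp
  have h0 : ∀ s : Var2, s.base.1 ≠ 0 → rootP (Pi.single i (x : ℤ) + Pi.single j (y : ℤ)) s = 0 ∧
      rootQ (Pi.single i (x : ℤ) + Pi.single j (y : ℤ)) s = 0 := by
    intro s hs
    rw [hp, hq, chargeP_eq, chargeQ_eq, if_neg hs, if_neg hs]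
    simp
  have hr := vertexMode_rescale idx2 (kw2 N)
    (p := rootP (Pi.single i (x : ℤ) + Pi.single j (y : ℤ)))
    (q := rootQ (Pi.single i (x : ℤ) + Pi.single j (y : ℤ))) one_pos
    (fun s hs => by rw [one_mul]; exact kw2_of_zero (by_contra fun h => hs (h0 s h).1))
    (fun s hs => by rw [one_mul]; exact kw2_of_zero (by_contra fun h => hs (h0 s h).2)) 0 F
  rw [mul_zero] at hr
  rw [hr, funext hp, funext hq, vertexMode_scale idx2 _ _ hW]

/-- On `t²_m` the weight is `(N - 1) m`, so rescaling `ζ` by `ω` with `ω ^ (N - 1) = y` absorbs the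
sign of `v_N`. The point of `v_i` is divided by `ω`. -/
theorem vertexMode_root_mixed (hN : 3 ≤ N) [IsGrading (kw2 N)] {i j : Fin N} (hi : i.1 + 1 < N)
    (hj : j.1 + 1 = N) (x y : ℤˣ) (F : MvPolynomial Var2 ℂ) {ω : ℂ} (hω : ω ≠ 0)
    (hωy : ω ^ (N - 1) = ((y : ℤ) : ℂ)) :
    vertexMode (kw2 N) (rootP (Pi.single i (x : ℤ) + Pi.single j (y : ℤ)))
      (rootQ (Pi.single i (x : ℤ) + Pi.single j (y : ℤ))) 0 F =
    vertexMode (kw2 N)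
      (fun s => (rootPoint N i x * ω⁻¹) ^ kw2 N s * chargeP 0 s + chargeP 1 s)
      (fun s => (rootPoint N i x * ω⁻¹)⁻¹ ^ kw2 N s * chargeQ 0 s + chargeQ 1 s) 0 F := by
  have hU := rootPoint_ne_zero hN i x
  have hy : ∀ s : Var2, ((y : ℤ) : ℂ) ^ idx2 s = ((y : ℤ) : ℂ) := by
    intro s
    rcases Int.units_eq_one_or y with rfl | rfl
    · simp
    · simp [(odd_idx2 s).neg_one_pow]
  have hy' : ((y : ℤ) : ℂ)⁻¹ = ((y : ℤ) : ℂ) := by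
    rcases Int.units_eq_one_or y with rfl | rfl <;> norm_num
  refine Eq.trans ?_ (vertexMode_scale (kw2 N) _ _ hω F)
  congr 2
  · funext s
    rw [rootP, rootCoeff_add, rootCoeff_single_inner hi, rootCoeff_single_last hj, chargeP_eq,
      chargeP_eq]
    by_cases h : s.base.1 = 0
    · rw [if_pos h, if_pos h, if_pos h, if_neg (by rw [h]; decide), kw2_of_zero h]
      change _ * (_ * eta N ^ (_ * (idx2 s : ℤ)) + _) = _
      rw [(rootPoint_pow_odd i x (odd_idx2 s)).1, mul_pow, inv_pow]
      have := pow_ne_zero (idx2 s) hω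
      field_simp
      ring
    · rw [if_neg h, if_neg h, if_neg h, if_pos (fin_two_ne_zero.1 h), kw2_of_ne_zero h, pow_mul ω,
        hωy, hy]
      ring
  · funext s
    rw [rootQ, rootCoeff_add, rootCoeff_single_inner hi, rootCoeff_single_last hj, chargeQ_eq,
      chargeQ_eq]
    by_cases h : s.base.1 = 0
    · rw [if_pos h, if_pos h, if_pos h, if_neg (by rw [h]; decide), kw2_of_zero h]
      change _ * (_ * (_ * eta N ^ (_ * (idx2 s : ℤ)) + _)) = _
      rw [(rootPoint_pow_odd i x (odd_idx2 s)).2, mul_inv, inv_inv, mul_pow, inv_pow, inv_pow]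
      have h1 := pow_ne_zero (idx2 s) hω
      have h2 := pow_ne_zero (idx2 s) hU
      field_simp
      ring
    · rw [if_neg h, if_neg h, if_neg h, if_pos (fin_two_ne_zero.1 h), kw2_of_ne_zero h,
        pow_mul ω⁻¹, inv_pow, hωy, hy', hy]
      ring

theorem sum_castSucc_last {n : ℕ} (g : Fin (n + 1) → Fin (n + 1) → A) :
    ∑ i, ∑ j, g i j = ∑ i : Fin n, ∑ j : Fin n, g i.castSucc j.castSucc +
      ∑ i : Fin n, g i.castSucc (Fin.last n) + ∑ i : Fin n, g (Fin.last n) i.castSucc +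
        g (Fin.last n) (Fin.last n) := by
  simp only [Fin.sum_univ_castSucc (n := n), Finset.sum_add_distrib, add_assoc]

/-- For `i, j < N` the `h²` pairs of signed vectors give each ratio `η ^ k` exactly `h` times. For
the roots with `v_N` each sign of `v_N` gives every `η ^ k` once. All is counted twice because the
pairs are ordered. -/
theorem sum_roots (hN : 3 ≤ N) [IsGrading (kw2 N)] (F : MvPolynomial Var2 ℂ) :
    ∑ α ∈ roots N, C (uProd α) * vertexMode (kw2 N) (rootP α) (rootQ α) 0 F =
      C (1 / (8 * cox N) : ℂ) * ∑ j ∈ Finset.range (cox N), C (cayleySq (eta N ^ j)) *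
        vertexMode idx2 (fun s => (eta N ^ j) ^ idx2 s * chargeP 0 s + chargeP 0 s)
          (fun s => (eta N ^ j)⁻¹ ^ idx2 s * chargeQ 0 s + chargeQ 0 s) 0 F -
      C (1 / (4 * cox N) : ℂ) * ∑ j ∈ Finset.range (cox N),
        vertexMode (kw2 N) (fun s => (eta N ^ j) ^ kw2 N s * chargeP 0 s + chargeP 1 s)
          (fun s => (eta N ^ j)⁻¹ ^ kw2 N s * chargeQ 0 s + chargeQ 1 s) 0 F := by
  obtain ⟨n, rfl⟩ : ∃ n, N = n + 1 := ⟨N - 1, by omega⟩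
  have hc : (cox (n + 1) : ℂ) ≠ 0 := Nat.cast_ne_zero.2 (by unfold cox; omega)
  set Y0 : ℂ → MvPolynomial Var2 ℂ := fun u => C (cayleySq u) *
    vertexMode idx2 (fun s => u ^ idx2 s * chargeP 0 s + chargeP 0 s)
      (fun s => u⁻¹ ^ idx2 s * chargeQ 0 s + chargeQ 0 s) 0 F with hY0
  set Y1 : ℂ → MvPolynomial Var2 ℂ := fun u =>
    vertexMode (kw2 (n + 1)) (fun s => u ^ kw2 (n + 1) s * chargeP 0 s + chargeP 1 s)
      (fun s => u⁻¹ ^ kw2 (n + 1) s * chargeQ 0 s + chargeQ 1 s) 0 F with hY1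
  set φ : (Fin (n + 1) → ℤ) → MvPolynomial Var2 ℂ := fun α =>
    C (uProd α) * vertexMode (kw2 (n + 1)) (rootP α) (rootQ α) 0 F with hφ
  have hin : ∀ (i j : Fin n) (x y : ℤˣ), (if i.castSucc ≠ j.castSucc then
      φ (Pi.single i.castSucc (x : ℤ) + Pi.single j.castSucc (y : ℤ)) else 0) =
      C (1 / (4 * (cox (n + 1) : ℂ) ^ 2)) *
        Y0 (rootPoint (n + 1) i.castSucc x * (rootPoint (n + 1) j.castSucc y)⁻¹) := by
    intro i j x y
    -- Pairs with `i = j` are no roots, but may be included: the ratio of their points is `±1`,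
    -- where `cayleySq` vanishes.
    by_cases hij : i = j
    · subst hij
      rw [if_neg (by simp)]
      have : rootPoint (n + 1) i.castSucc x * (rootPoint (n + 1) i.castSucc y)⁻¹ =
          ((x : ℤ) : ℂ) * ((y : ℤ) : ℂ)⁻¹ := by
        have := pow_ne_zero (i.1 + 1) (eta_ne_zero hN)
        rw [rootPoint, rootPoint, mul_inv, Fin.val_castSucc]
        field_simp
      have h0 : cayleySq (((x : ℤ) : ℂ) * ((y : ℤ) : ℂ)⁻¹) = 0 := by
        rcases Int.units_eq_one_or x with rfl | rfl <;>
          rcases Int.units_eq_one_or y with rfl | rfl <;> norm_num [cayleySq]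
      simp only [hY0, this, h0, map_zero, zero_mul, mul_zero]
    · have hij' : i.castSucc ≠ j.castSucc := fun h => hij (Fin.castSucc_injective _ h)
      have hi := Nat.succ_lt_succ i.2
      have hj := Nat.succ_lt_succ j.2
      rw [if_pos hij']
      simp only [hφ, hY0]
      rw [uProd_inner hN hij' hi hj, vertexMode_root_inner hN hi hj, map_mul, mul_assoc]
  have hmix : ∀ (i : Fin n) (x y : ℤˣ) (ω : ℂ), ω ≠ 0 → ω ^ n = ((y : ℤ) : ℂ) →
      φ (Pi.single i.castSucc (x : ℤ) + Pi.single (Fin.last n) (y : ℤ)) =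
      C (-(1 / (8 * cox (n + 1)) : ℂ)) * Y1 (rootPoint (n + 1) i.castSucc x * ω⁻¹) := by
    intro i x y ω hω hωy
    have hi := Nat.succ_lt_succ i.2
    simp only [hφ, hY1]
    rw [uProd_mixed hN hi rfl, vertexMode_root_mixed hN hi rfl x y F hω hωy]
  have hcast : ∀ i : Fin n, i.castSucc ≠ Fin.last n := fun i => (Fin.castSucc_lt_last i).ne
  have h := two_nsmul_sum_roots φ
  rw [sum_castSucc_last] at h
  have hS : ∀ y : ℤˣ, ∑ i : Fin n, ∑ x : ℤˣ,
      φ (Pi.single i.castSucc (x : ℤ) + Pi.single (Fin.last n) (y : ℤ)) =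
      C (-(1 / (8 * cox (n + 1)) : ℂ)) *
        ∑ k ∈ Finset.range (cox (n + 1)), Y1 (eta (n + 1) ^ k) := by
    intro y
    -- Both signs are `(N - 1)`-st powers of powers of `η`, so the division by `ω` only permutes the
    -- `h`-th roots of unity.
    obtain ⟨l, hl⟩ : ∃ l : ℕ, (eta (n + 1) ^ l) ^ n = ((y : ℤ) : ℂ) := by
      rcases Int.units_eq_one_or y with rfl | rfl
      · exact ⟨0, by simp⟩
      · refine ⟨1, ?_⟩
        have h := eta_pow_half hN
        rw [Nat.add_sub_cancel] at h
        simp [h]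
    simp only [hmix _ _ y _ (pow_ne_zero l (eta_ne_zero hN)) hl, ← Finset.mul_sum]
    rw [sum_rootPoint hN (fun u => Y1 (u * (eta (n + 1) ^ l)⁻¹)), sum_root_div hN]
  have hS0 : ∑ i : Fin n, ∑ j : Fin n, ∑ x : ℤˣ, ∑ y : ℤˣ, C (1 / (4 * (cox (n + 1) : ℂ) ^ 2)) *
        Y0 (rootPoint (n + 1) i.castSucc x * (rootPoint (n + 1) j.castSucc y)⁻¹) =
      C (1 / (4 * (cox (n + 1) : ℂ))) * ∑ k ∈ Finset.range (cox (n + 1)), Y0 (eta (n + 1) ^ k) := by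
    simp only [← Finset.mul_sum]
    have : ∀ i : Fin n, ∑ j : Fin n, ∑ x : ℤˣ, ∑ y : ℤˣ,
        Y0 (rootPoint (n + 1) i.castSucc x * (rootPoint (n + 1) j.castSucc y)⁻¹) =
        ∑ x : ℤˣ, ∑ j : Fin n, ∑ y : ℤˣ,
        Y0 (rootPoint (n + 1) i.castSucc x * (rootPoint (n + 1) j.castSucc y)⁻¹) :=
      fun i => Finset.sum_comm
    simp only [this]
    rw [sum_rootPoint hN (fun u => ∑ j : Fin n, ∑ y : ℤˣ,
      Y0 (u * (rootPoint (n + 1) j.castSucc y)⁻¹))]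
    simp only [fun k => sum_rootPoint hN (fun u => Y0 (eta (n + 1) ^ k * u⁻¹))]
    rw [Finset.sum_comm]
    simp only [sum_root_div hN]
    rw [Finset.sum_const, Finset.card_range, nsmul_eq_mul, ← mul_assoc, ← map_natCast (C : ℂ →+* _),
      ← map_mul]
    congr 2
    field_simp
  have hS1 : ∑ i : Fin n, ∑ x : ℤˣ, ∑ y : ℤˣ,
      φ (Pi.single i.castSucc (x : ℤ) + Pi.single (Fin.last n) (y : ℤ)) =
      2 * (C (-(1 / (8 * cox (n + 1)) : ℂ)) *
        ∑ k ∈ Finset.range (cox (n + 1)), Y1 (eta (n + 1) ^ k)) := by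
    simp only [sum_units (fun y : ℤˣ => φ (_ + Pi.single (Fin.last n) (y : ℤ))),
      Finset.sum_add_distrib]
    rw [hS, hS, two_mul]
  have hS2 : ∑ i : Fin n, ∑ y : ℤˣ, ∑ x : ℤˣ,
      φ (Pi.single i.castSucc (x : ℤ) + Pi.single (Fin.last n) (y : ℤ)) =
      2 * (C (-(1 / (8 * cox (n + 1)) : ℂ)) *
        ∑ k ∈ Finset.range (cox (n + 1)), Y1 (eta (n + 1) ^ k)) := by
    rw [← hS1]
    exact Finset.sum_congr rfl fun i _ => Finset.sum_comm
  have hd : ∑ i : Fin n, ∑ j : Fin n, ∑ x : ℤˣ, ∑ y : ℤˣ, (if i.castSucc ≠ j.castSucc then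
      φ (Pi.single i.castSucc (x : ℤ) + Pi.single j.castSucc (y : ℤ)) else 0) = _ :=
    Eq.trans (Finset.sum_congr rfl fun i _ => Finset.sum_congr rfl fun j _ =>
      Finset.sum_congr rfl fun x _ => Finset.sum_congr rfl fun y _ => hin i j x y) hS0
  have hd1 : ∑ i : Fin n, ∑ x : ℤˣ, ∑ y : ℤˣ, (if i.castSucc ≠ Fin.last n then
      φ (Pi.single i.castSucc (x : ℤ) + Pi.single (Fin.last n) (y : ℤ)) else 0) = _ :=
    Eq.trans (Finset.sum_congr rfl fun i _ => Finset.sum_congr rfl fun x _ =>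
      Finset.sum_congr rfl fun y _ => if_pos (hcast i)) hS1
  have hd2 : ∑ i : Fin n, ∑ y : ℤˣ, ∑ x : ℤˣ, (if Fin.last n ≠ i.castSucc then
      φ (Pi.single (Fin.last n) (y : ℤ) + Pi.single i.castSucc (x : ℤ)) else 0) = _ :=
    Eq.trans (Finset.sum_congr rfl fun i _ => Finset.sum_congr rfl fun x _ =>
      Finset.sum_congr rfl fun y _ => by rw [if_pos (hcast i).symm, add_comm]) hS2
  rw [hd, hd1, hd2] at h
  simp only [ne_eq, not_true_eq_false, if_false, Finset.sum_const_zero, add_zero] at h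
  have c1 : (C (1 / (4 * cox (n + 1)) : ℂ) : MvPolynomial Var2 ℂ) =
      2 * C (1 / (8 * cox (n + 1)) : ℂ) := by
    rw [← map_ofNat (C : ℂ →+* MvPolynomial Var2 ℂ) 2, ← map_mul]
    congr 1; field_simp; norm_num
  rw [map_neg, c1, two_nsmul] at h
  rw [c1]
  have h2 : (2 : MvPolynomial Var2 ℂ) ≠ 0 := two_ne_zero
  apply mul_left_cancel₀ h2
  linear_combination h

end RootSum

/-! ### Modes on the level of coefficients. -/

section ModeCoeff

variable {σ : Type*} (w : σ → ℕ) [IsGrading w] (p q : σ → ℂ)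

/-- The coefficient of `tᵈ` in the mode of degree `-k` of the vertex operator
`exp (∑ₛ pₛ tₛ z ^ wₛ) exp (∑ₛ qₛ z ^ (-wₛ) ∂ₛ)`, applied to a series with coefficients `T`. -/
def modeCoeff (k : ℤ) (T : (σ →₀ ℕ) → ℂ) (d : σ →₀ ℕ) : ℂ := by
  classical
  exact ∑ x ∈ antidiagonal d, expCoeff p x.1 *
    ∑ e ∈ wtSet w (k + Finsupp.weight w x.1), shiftCoeff q x.2 e * T (x.2 + e)

theorem modeCoeff_def [DecidableEq σ] (k : ℤ) (T : (σ →₀ ℕ) → ℂ) (d : σ →₀ ℕ) :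
    modeCoeff w p q k T d = ∑ x ∈ antidiagonal d, expCoeff p x.1 *
      ∑ e ∈ wtSet w (k + Finsupp.weight w x.1), shiftCoeff q x.2 e * T (x.2 + e) := by
  unfold modeCoeff
  congr!

/-- A mode of degree `-k` is homogeneous, so the coefficient of `tᵈ` sees only coefficients of
weight `|d| + k`, which are finite in number. This extends the modes from polynomials to power
series. -/
theorem modeCoeff_congr {k : ℤ} {T T' : (σ →₀ ℕ) → ℂ} {d : σ →₀ ℕ}
    (h : ∀ c, (Finsupp.weight w c : ℤ) = Finsupp.weight w d + k → T c = T' c) :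
    modeCoeff w p q k T d = modeCoeff w p q k T' d := by
  classical
  rw [modeCoeff_def, modeCoeff_def]
  refine Finset.sum_congr rfl fun x hx => ?_
  congr 1
  refine Finset.sum_congr rfl fun e he => ?_
  rw [h]
  rw [mem_wtSet] at he
  rw [← Finset.HasAntidiagonal.mem_antidiagonal.1 hx, map_add, map_add]
  push_cast
  omega

theorem coeff_vertexMode (k : ℤ) (F : MvPolynomial σ ℂ) (d : σ →₀ ℕ) :
    coeff d (vertexMode w p q k F) = modeCoeff w p q k (fun c => coeff c F) d := by
  classical
  obtain ⟨M, hM⟩ := exists_wtLE w F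
  rw [vertexMode_eq_sum w _ _ (hM.natDegree_shiftHom _), coeff_sum, modeCoeff_def]
  simp_rw [coeff_mul, coeff_expPoly, coeff_shiftHom]
  rw [Finset.sum_comm]
  refine Finset.sum_congr rfl fun x hx => ?_
  by_cases h : 0 ≤ k + Finsupp.weight w x.1 ∧ k + Finsupp.weight w x.1 ≤ M
  · rw [Finset.sum_eq_single_of_mem (k + Finsupp.weight w x.1).toNat]
    · rw [if_pos (by omega), Int.toNat_of_nonneg h.1]
    · rw [Finset.mem_range]; omega
    · intro i _ hi
      rw [if_neg (by omega), zero_mul]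
  · rw [Finset.sum_eq_zero, Finset.sum_eq_zero, mul_zero]
    · intro e he
      rw [mem_wtSet] at he
      have : coeff (x.2 + e) F = 0 := by
        apply hM
        rw [map_add]
        omega
      rw [this, mul_zero]
    · intro i hi
      rw [Finset.mem_range] at hi
      rw [if_neg (by omega), zero_mul]

end ModeCoeff

/-! ### Vertex operators on power series as Laurent series in `z⁻¹`. -/

section SeriesModes

variable (w : Var → ℕ) [IsGrading w] (p q : Var → ℂ)

/-- The coefficient of `tᵈ` in `exp (∑ₛ qₛ T ^ wₛ ∂ₛ) f`, a power series in `T`. -/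
def shiftSeries (f : Fock) (d : Var →₀ ℕ) : PowerSeries ℂ :=
  PowerSeries.mk fun n => ∑ e ∈ wtSet w n, shiftCoeff q d e * MvPowerSeries.coeff (d + e) f

theorem expDer_eq (f : Fock) (d : Var →₀ ℕ) :
    expDer w q f d = HahnSeries.ofPowerSeries ℤ ℂ (shiftSeries w q f d) := by
  rw [expDer, shiftSeries]
  congr 2
  funext n
  rw [finsum_subtype_eq_finsum_cond (p := fun e => Finsupp.weight w e = n)
    (f := fun e : Var →₀ ℕ => (e.prod fun s j => q s ^ j / (j.factorial : ℂ) *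
      ((d s + j).descFactorial j : ℂ)) * MvPowerSeries.coeff (d + e) f)]
  rw [← finsum_mem_coe_finset]
  refine finsum_congr fun e => ?_
  have h1 : (e ∈ (wtSet w n : Set (Var →₀ ℕ))) = (Finsupp.weight w e = n) := by
    rw [Finset.mem_coe, mem_wtSet, Nat.cast_inj]
  simp only [h1]
  refine finsum_congr fun _ => ?_
  congr 1
  refine Finsupp.prod_congr fun s _ => ?_
  have h2 : ((e s).factorial : ℂ) ≠ 0 := Nat.cast_ne_zero.2 (Nat.factorial_ne_zero _)
  rw [Nat.descFactorial_eq_factorial_mul_choose]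
  push_cast
  field_simp

theorem coeff_single_mul_ofPowerSeries (n : ℕ) (c : ℂ) (P : PowerSeries ℂ) (k : ℤ) :
    (HahnSeries.single (-(n : ℤ)) c * HahnSeries.ofPowerSeries ℤ ℂ P).coeff k =
      if 0 ≤ k + n then c * PowerSeries.coeff (k + n).toNat P else 0 := by
  have h : (HahnSeries.single (-(n : ℤ)) c * HahnSeries.ofPowerSeries ℤ ℂ P).coeff k =
      c * (HahnSeries.ofPowerSeries ℤ ℂ P).coeff (k + n) := by
    have := HahnSeries.coeff_single_mul_add (r := c) (x := HahnSeries.ofPowerSeries ℤ ℂ P)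
      (a := k + n) (b := -(n : ℤ))
    rwa [add_neg_cancel_right] at this
  rw [h]
  split_ifs with h0
  · obtain ⟨j, hj⟩ := Int.eq_ofNat_of_zero_le h0
    rw [hj, HahnSeries.ofPowerSeries_apply_coeff, Int.toNat_natCast]
  · rw [HahnSeries.ofPowerSeries_apply, HahnSeries.embDomain_of_notMem_range, mul_zero]
    rintro ⟨j, hj⟩
    simp at hj
    omega

theorem vertexOp_apply (f : Fock) (d : Var →₀ ℕ) : vertexOp w p q f d = ∑ x ∈ antidiagonal d,
    HahnSeries.single (-(Finsupp.weight w x.1 : ℤ)) (expCoeff p x.1) *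
      HahnSeries.ofPowerSeries ℤ ℂ (shiftSeries w q f x.2) := by
  have h : vertexOp w p q f d = MvPowerSeries.coeff d (expMul w p * expDer w q f) := rfl
  rw [h, MvPowerSeries.coeff_mul]
  refine Finset.sum_congr rfl fun x _ => ?_
  rw [← expDer_eq]
  rfl

end SeriesModes

/-! ### Tensor products of vertex operators as vertex operators in the doubled variables. -/

section Tensor

theorem tensor_sumElim {R : Type*} [Mul R] (F G : MvPowerSeries Var R) (a b : Var →₀ ℕ) :
    tensor F G (a.sumElim b) = F a * G b := by
  rw [tensor, Finsupp.comapDomain_inl_sumElim, Finsupp.comapDomain_inr_sumElim]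

theorem coeff_tensor_sumElim {R : Type*} [Semiring R] (F G : MvPowerSeries Var R) (a b : Var →₀ ℕ) :
    MvPowerSeries.coeff (a.sumElim b) (tensor F G) =
      MvPowerSeries.coeff a F * MvPowerSeries.coeff b G :=
  tensor_sumElim F G a b

theorem exists_sumElim (d : Var2 →₀ ℕ) : ∃ a b : Var →₀ ℕ, d = a.sumElim b :=
  ⟨_, _, (Finsupp.comapDomain_sumElim_comapDomain _).symm⟩

theorem sumElim_add (a b c e : Var →₀ ℕ) :
    (a.sumElim b + c.sumElim e : Var2 →₀ ℕ) = (a + c).sumElim (b + e) := by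
  ext (s | s) <;> rfl

theorem sumElim_inj {a b c e : Var →₀ ℕ} :
    (a.sumElim b : Var2 →₀ ℕ) = c.sumElim e ↔ a = c ∧ b = e := by
  constructor
  · intro h
    constructor
    · have := congrArg (fun d : Var2 →₀ ℕ => d.comapDomain Sum.inl Sum.inl_injective.injOn) h
      simpa only [Finsupp.comapDomain_inl_sumElim] using this
    · have := congrArg (fun d : Var2 →₀ ℕ => d.comapDomain Sum.inr Sum.inr_injective.injOn) h
      simpa only [Finsupp.comapDomain_inr_sumElim] using this
  · rintro ⟨rfl, rfl⟩; rfl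

theorem sum_antidiagonal_sumElim {A : Type*} [AddCommMonoid A] (a b : Var →₀ ℕ)
    (φ : (Var2 →₀ ℕ) × (Var2 →₀ ℕ) → A) :
    ∑ x ∈ antidiagonal (a.sumElim b), φ x = ∑ x ∈ antidiagonal a, ∑ y ∈ antidiagonal b,
      φ (x.1.sumElim y.1, x.2.sumElim y.2) := by
  rw [← Finset.sum_product', ← Finsupp.image_sumElim_product_antidiagonal, Finset.sum_image]
  rintro ⟨⟨x1, x2⟩, y1, y2⟩ _ ⟨⟨z1, z2⟩, t1, t2⟩ _ h
  simp only [Prod.mk.injEq, sumElim_inj] at h ⊢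
  tauto

theorem expCoeff_sumElim (p p' : Var → ℂ) (a b : Var →₀ ℕ) :
    expCoeff (Sum.elim p p') (a.sumElim b) = expCoeff p a * expCoeff p' b := by
  rw [expCoeff, Finsupp.prod_sumElim]
  rfl

theorem shiftCoeff_sumElim (q q' : Var → ℂ) (a b c e : Var →₀ ℕ) :
    shiftCoeff (Sum.elim q q') (a.sumElim b) (c.sumElim e) = shiftCoeff q a c * shiftCoeff q' b e := by
  rw [shiftCoeff, Finsupp.prod_sumElim]
  rfl

theorem weight_sumElim {w : Var → ℕ} {w2 : Var2 → ℕ} (hw : w2 = Sum.elim w w) (a b : Var →₀ ℕ) :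
    Finsupp.weight w2 (a.sumElim b) = Finsupp.weight w a + Finsupp.weight w b := by
  rw [Finsupp.weight_apply, Finsupp.weight_apply, Finsupp.weight_apply, Finsupp.sum_sumElim, hw]
  rfl

variable {w : Var → ℕ} [IsGrading w] {w2 : Var2 → ℕ} [IsGrading w2]

theorem sum_wtSet_sumElim (hw : w2 = Sum.elim w w) (n : ℕ) (φ : (Var2 →₀ ℕ) → ℂ) :
    ∑ e ∈ wtSet w2 n, φ e = ∑ i ∈ antidiagonal n, ∑ a ∈ wtSet w i.1, ∑ b ∈ wtSet w i.2,
      φ (a.sumElim b) := by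
  have h : ∀ i ∈ antidiagonal n, ∑ a ∈ wtSet w i.1, ∑ b ∈ wtSet w i.2, φ (a.sumElim b) =
      ∑ x ∈ wtSet w i.1 ×ˢ wtSet w i.2, φ (x.1.sumElim x.2) := fun i _ =>
    (Finset.sum_product' _ _ _).symm
  rw [Finset.sum_congr rfl h, Finset.sum_sigma']
  symm
  refine Finset.sum_bij (fun x _ => x.2.1.sumElim x.2.2) ?_ ?_ ?_ fun _ _ => rfl
  · rintro ⟨⟨i, j⟩, a, b⟩ h
    simp only [Finset.mem_sigma, Finset.HasAntidiagonal.mem_antidiagonal, Finset.mem_product,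
      mem_wtSet, Nat.cast_inj] at h
    rw [mem_wtSet, weight_sumElim hw, Nat.cast_inj, h.2.1, h.2.2, h.1]
  · rintro ⟨⟨i, j⟩, a, b⟩ h ⟨⟨i', j'⟩, a', b'⟩ h' hab
    simp only [Finset.mem_sigma, Finset.HasAntidiagonal.mem_antidiagonal, Finset.mem_product,
      mem_wtSet, Nat.cast_inj] at h h'
    obtain ⟨rfl, rfl⟩ := sumElim_inj.1 hab
    obtain ⟨_, rfl, rfl⟩ := h
    obtain ⟨_, rfl, rfl⟩ := h'
    rfl
  · intro d hd
    obtain ⟨a, b, rfl⟩ := exists_sumElim d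
    rw [mem_wtSet, weight_sumElim hw, Nat.cast_inj] at hd
    refine ⟨⟨(Finsupp.weight w a, Finsupp.weight w b), a, b⟩, ?_, rfl⟩
    simp only [Finset.mem_sigma, Finset.HasAntidiagonal.mem_antidiagonal, Finset.mem_product,
      mem_wtSet, and_true]
    exact hd

/-- Exponentials in disjoint sets of variables multiply to the exponential in their union, and
taking the coefficient of a power of `z` sums over the ways to split the degree between the two
copies. -/
theorem res_tensor_vertexOp (hw : w2 = Sum.elim w w) (p p' q q' : Var → ℂ) (k : ℤ) (f g : Fock)
    (d : Var2 →₀ ℕ) : res k (tensor (vertexOp w p q f) (vertexOp w p' q' g) d) =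
      modeCoeff w2 (Sum.elim p p') (Sum.elim q q') k
        (fun c => MvPowerSeries.coeff c (tensor f g)) d := by
  obtain ⟨a, b, rfl⟩ := exists_sumElim d
  rw [tensor_sumElim, vertexOp_apply, vertexOp_apply, Finset.sum_mul_sum, modeCoeff_def,
    sum_antidiagonal_sumElim, res, HahnSeries.coeff_sum]
  refine Finset.sum_congr rfl fun x _ => ?_
  rw [HahnSeries.coeff_sum]
  refine Finset.sum_congr rfl fun y _ => ?_
  rw [mul_mul_mul_comm, HahnSeries.single_mul_single, ← map_mul, ← neg_add, ← Nat.cast_add,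
    ← weight_sumElim hw, coeff_single_mul_ofPowerSeries, expCoeff_sumElim]
  split_ifs with h
  · congr 1
    obtain ⟨n, hn⟩ := Int.eq_ofNat_of_zero_le h
    rw [hn, Int.toNat_natCast, PowerSeries.coeff_mul, sum_wtSet_sumElim hw]
    refine Finset.sum_congr rfl fun i _ => ?_
    rw [shiftSeries, shiftSeries, PowerSeries.coeff_mk, PowerSeries.coeff_mk, Finset.sum_mul_sum]
    refine Finset.sum_congr rfl fun c _ => Finset.sum_congr rfl fun e _ => ?_
    rw [sumElim_add, coeff_tensor_sumElim, shiftCoeff_sumElim]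
    ring
  · rw [Finset.sum_eq_zero, mul_zero]
    intro e he
    have he' := mem_wtSet.1 he
    dsimp only at he'
    omega

end Tensor

/-! ### The substitution `z ↦ -z`. -/

section NegVar

theorem coeff_negVar (f : LaurentInv) (n : ℤ) : (negVar f).coeff n = (-1 : ℂ) ^ n * f.coeff n := rfl

theorem negVar_add (f g : LaurentInv) : negVar (f + g) = negVar f + negVar g := by
  ext n
  simp only [coeff_negVar, HahnSeries.coeff_add]
  ring

theorem negVar_zero : negVar 0 = 0 := by
  ext n
  simp [coeff_negVar]

theorem negVar_smul (c : ℂ) (f : LaurentInv) : negVar (c • f) = c • negVar f := by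
  ext n
  simp only [coeff_negVar, HahnSeries.coeff_smul, smul_eq_mul]
  ring

theorem negVar_sum {ι : Type*} (s : Finset ι) (f : ι → LaurentInv) :
    negVar (∑ i ∈ s, f i) = ∑ i ∈ s, negVar (f i) := by
  classical
  induction s using Finset.induction_on with
  | empty => simp [negVar_zero]
  | insert i s hi ih => rw [Finset.sum_insert hi, Finset.sum_insert hi, negVar_add, ih]

theorem support_negVar (f : LaurentInv) : (negVar f).support = f.support := by
  ext n
  simp [coeff_negVar, zpow_ne_zero]

theorem negVar_mul (f g : LaurentInv) : negVar (f * g) = negVar f * negVar g := by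
  ext n
  rw [coeff_negVar, HahnSeries.coeff_mul, HahnSeries.coeff_mul, Finset.mul_sum]
  refine Finset.sum_congr ?_ fun x hx => ?_
  · ext x
    simp only [Finset.mem_antidiagonal, support_negVar]
  · rw [← (Finset.mem_antidiagonal.1 hx).2.2, zpow_add₀ (by norm_num), coeff_negVar, coeff_negVar]
    ring

theorem negVar_single (n : ℤ) (c : ℂ) :
    negVar (HahnSeries.single n c) = HahnSeries.single n ((-1 : ℂ) ^ n * c) := by
  ext k
  rw [coeff_negVar, HahnSeries.coeff_single, HahnSeries.coeff_single]
  split_ifs with h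
  · rw [h]
  · simp

theorem coeff_ofPowerSeries (P : PowerSeries ℂ) (k : ℤ) :
    (HahnSeries.ofPowerSeries ℤ ℂ P).coeff k =
      if 0 ≤ k then PowerSeries.coeff k.toNat P else 0 := by
  have := coeff_single_mul_ofPowerSeries 0 1 P k
  simpa using this

variable (w : Var → ℕ) [IsGrading w] (p q : Var → ℂ)

theorem negVar_shiftSeries (f : Fock) (d : Var →₀ ℕ) :
    negVar (HahnSeries.ofPowerSeries ℤ ℂ (shiftSeries w q f d)) =
      HahnSeries.ofPowerSeries ℤ ℂ (shiftSeries w (fun s => (-1) ^ w s * q s) f d) := by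
  ext k
  rw [coeff_negVar, coeff_ofPowerSeries, coeff_ofPowerSeries]
  split_ifs with hk
  · obtain ⟨n, rfl⟩ := Int.eq_ofNat_of_zero_le hk
    rw [Int.toNat_natCast, shiftSeries, shiftSeries, PowerSeries.coeff_mk, PowerSeries.coeff_mk,
      Finset.mul_sum]
    refine Finset.sum_congr rfl fun e he => ?_
    rw [mem_wtSet] at he
    rw [← he, zpow_natCast, ← mul_assoc, shiftCoeff, shiftCoeff, ← prod_pow_weight]
    congr 1
    refine Finsupp.prod_congr fun s _ => by rw [mul_pow, mul_assoc]
  · simp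

theorem negVar_vertexOp (f : Fock) (d : Var →₀ ℕ) : negVar (vertexOp w p q f d) =
    vertexOp w (fun s => (-1) ^ w s * p s) (fun s => (-1) ^ w s * q s) f d := by
  rw [vertexOp_apply, vertexOp_apply, negVar_sum]
  refine Finset.sum_congr rfl fun x _ => ?_
  rw [negVar_mul, negVar_single, negVar_shiftSeries, zpow_neg, ← inv_zpow, zpow_natCast]
  congr 2
  rw [expCoeff, expCoeff, inv_neg_one, ← prod_pow_weight]
  refine Finsupp.prod_congr fun s _ => by rw [mul_pow, mul_div_assoc]

end NegVar

/-! ### Homogeneous components of power series. -/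

section Homogeneous

variable {σ : Type*} (w : σ → ℕ) [IsGrading w]

/-- The homogeneous component of degree `M` of the series with coefficients `T`. -/
def homPart (T : (σ →₀ ℕ) → ℂ) (M : ℕ) : MvPolynomial σ ℂ := ∑ d ∈ wtSet w M, monomial d (T d)

theorem coeff_homPart (T : (σ →₀ ℕ) → ℂ) (M : ℕ) (d : σ →₀ ℕ) :
    coeff d (homPart w T M) = if Finsupp.weight w d = M then T d else 0 := by
  classical
  simp [homPart, coeff_sum, coeff_monomial]

theorem wtLE_homPart (T : (σ →₀ ℕ) → ℂ) (M : ℕ) : WtLE w M (homPart w T M) := by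
  intro d hd
  rw [coeff_homPart, if_neg hd.ne']

theorem coeff_vertexMode_homPart (p q : σ → ℂ) (k : ℤ) (T : (σ →₀ ℕ) → ℂ) (M : ℕ) (d : σ →₀ ℕ) :
    coeff d (vertexMode w p q k (homPart w T M)) =
      if (Finsupp.weight w d : ℤ) + k = M then modeCoeff w p q k T d else 0 := by
  rw [coeff_vertexMode]
  split_ifs with h
  · refine modeCoeff_congr w p q fun c hc => ?_
    rw [coeff_homPart, if_pos (by omega)]
  · rw [modeCoeff_congr w p q (T' := fun _ => 0)]
    · simp [modeCoeff]
    · intro c hc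
      rw [coeff_homPart, if_neg (by omega)]

/-- An identity between operators on polynomials passes to series: a single coefficient of the
result involves finitely many coefficients, so the series can be truncated to the union `S` of those
needed on the two sides. -/
theorem modeCoeff_eq_of_vertexMode_eq {w' : σ → ℕ} [IsGrading w'] {p q p' q' : σ → ℂ} {k k' : ℤ}
    (h : ∀ F, vertexMode w p q k F = vertexMode w' p' q' k' F) (T : (σ →₀ ℕ) → ℂ) (d : σ →₀ ℕ) :
    modeCoeff w p q k T d = modeCoeff w' p' q' k' T d := by
  classical
  set S := wtSet w (Finsupp.weight w d + k) ∪ wtSet w' (Finsupp.weight w' d + k') with hS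
  have hF : ∀ c ∈ S, coeff c (∑ d ∈ S, monomial d (T d)) = T c := by
    intro c hc
    simp [coeff_sum, coeff_monomial, hc]
  have h1 := congrArg (coeff d) (h (∑ d ∈ S, monomial d (T d)))
  rw [coeff_vertexMode, coeff_vertexMode] at h1
  rw [modeCoeff_congr w p q (T' := T) fun c hc => hF c ?_,
    modeCoeff_congr w' p' q' (T' := T) fun c hc => hF c ?_] at h1
  · exact h1
  · rw [hS, Finset.mem_union]; right; simpa using hc
  · rw [hS, Finset.mem_union]; left; simpa using hc

end Homogeneous

/-! ### `Ω_m` on power series and on homogeneous components. -/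

section OmegaLink

instance isGrading_idx : IsGrading Var.idx where
  pos _ := Nat.succ_pos _
  fin n := (Set.Finite.preimage Sum.inl_injective.injOn (isGrading_idx2.fin n)).subset
    fun _ hs => hs

theorem isGrading_kwWeight {N : ℕ} (hN : 3 ≤ N) : IsGrading (kwWeight N) where
  pos s := (isGrading_kw2 hN).pos (Sum.inl s)
  fin n := (Set.Finite.preimage Sum.inl_injective.injOn ((isGrading_kw2 hN).fin n)).subset
    fun _ hs => hs

theorem idx2_eq : idx2 = Sum.elim Var.idx Var.idx := by
  funext s
  rcases s with s | s <;> rfl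

theorem kw2_eq (N : ℕ) : kw2 N = Sum.elim (kwWeight N) (kwWeight N) := by
  funext s
  rcases s with s | s <;> rfl

theorem odd_idx (s : Var) : Odd (Var.idx s) := ⟨s.2, rfl⟩

/-- The coefficients of `f ⊗ f`. -/
def sqCoeffs (f : Fock) (c : Var2 →₀ ℕ) : ℂ := MvPowerSeries.coeff c (tensor f f)

theorem gamRes_apply (a : Fin 2) (k : ℤ) (f : Fock) (d : Var2 →₀ ℕ) :
    gamRes a k f f d = modeCoeff idx2 (chargeP a) (chargeQ a) k (sqCoeffs f) d := by
  have h : gamRes a k f f d = res k (tensor (Gam a f) (vertexOp Var.idx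
      (fun s => (-1) ^ Var.idx s * if s.1 = a then 1 else 0)
      (fun s => (-1) ^ Var.idx s * if s.1 = a then -2 / (Var.idx s : ℂ) else 0) f) d) := by
    rw [gamRes]
    congr 2
    funext e
    exact negVar_vertexOp _ _ _ f e
  rw [h, Gam, res_tensor_vertexOp idx2_eq]
  congr 1
  · funext s
    rw [chargeP_eq]
    rcases s with s | s
    · by_cases hs : s.1 = a <;> simp [Var2.base, Var2.sign, hs]
    · by_cases hs : s.1 = a <;> simp [Var2.base, Var2.sign, hs, (odd_idx s).neg_one_pow]
  · funext s
    rw [chargeQ_eq]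
    rcases s with s | s
    · by_cases hs : s.1 = a <;> simp [Var2.base, Var2.sign, idx2, hs]
    · by_cases hs : s.1 = a <;> simp [Var2.base, Var2.sign, idx2, hs, (odd_idx s).neg_one_pow]

theorem Omega_apply {N : ℕ} (hN : 3 ≤ N) [IsGrading (kw2 N)] (m : ℤ) (f : Fock) (d : Var2 →₀ ℕ) :
    Omega N m f f d = modeCoeff (kw2 N) (chargeP 0) (chargeQ 0) (m * cox N) (sqCoeffs f) d -
      modeCoeff (kw2 N) (chargeP 1) (chargeQ 1) (m * cox N) (sqCoeffs f) d := by
  rw [modeCoeff_eq_of_vertexMode_eq (kw2 N) (vertexMode_kw_zero (N := N) (m * cox N)),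
    modeCoeff_eq_of_vertexMode_eq (kw2 N) (vertexMode_kw_one hN m), ← gamRes_apply, ← gamRes_apply]
  rfl

theorem coeff_omegaPoly_homPart {N : ℕ} (hN : 3 ≤ N) [IsGrading (kw2 N)] (m : ℤ) (f : Fock) (M : ℕ)
    (d : Var2 →₀ ℕ) : coeff d (omegaPoly N m (homPart (kw2 N) (sqCoeffs f) M)) =
      if (Finsupp.weight (kw2 N) d : ℤ) + m * cox N = M then Omega N m f f d else 0 := by
  rw [omegaPoly, LinearMap.sub_apply, ← vertexMode_kw_zero (N := N), ← vertexMode_kw_one hN,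
    coeff_sub, coeff_vertexMode_homPart, coeff_vertexMode_homPart, Omega_apply hN]
  split_ifs <;> simp

/-- In the weights of `ζ` both parts of `Ω_m` have degree `-m h`. The coefficient at `d` therefore
comes from the one component of degree `|d| + m h`, and components cannot cancel each other. -/
theorem Omega_eq_zero_iff {N : ℕ} (hN : 3 ≤ N) [IsGrading (kw2 N)] (m : ℕ) (f : Fock) :
    Omega N m f f = 0 ↔ ∀ M : ℕ, omegaPoly N m (homPart (kw2 N) (sqCoeffs f) M) = 0 := by
  constructor
  · intro h M
    ext d
    rw [coeff_omegaPoly_homPart hN, h, coeff_zero]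
    split_ifs <;> rfl
  · intro h
    funext d
    have := coeff_omegaPoly_homPart hN m f (Finsupp.weight (kw2 N) d + m * cox N) d
    rw [if_pos (by push_cast; ring), h, coeff_zero] at this
    exact this.symm

end OmegaLink

/-! ### The Heisenberg part of the Casimir. -/

section Heisenberg

/-- The coefficient of `tᵈ` in `tₛ ∂ₛ' f`, where `f` has the coefficients `T`. -/
def hopCoeff {σ : Type*} (s s' : σ) (T : (σ →₀ ℕ) → ℂ) (d : σ →₀ ℕ) : ℂ :=
  if d s = 0 then 0 else T (d - Finsupp.single s 1 + Finsupp.single s' 1) *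
    (((d - Finsupp.single s 1 : σ →₀ ℕ) s' : ℂ) + 1)

theorem coeff_X_mul_pderiv {σ : Type*} (s s' : σ) (F : MvPolynomial σ ℂ) (d : σ →₀ ℕ) :
    coeff d (X s * pderiv s' F) = hopCoeff s s' (fun c => coeff c F) d := by
  classical
  rw [coeff_X_mul', hopCoeff, coeff_pderiv]
  by_cases h : d s = 0 <;> simp [h]

theorem coeff_X_mul_series {σ : Type*} (s : σ) (f : MvPowerSeries σ ℂ) (d : σ →₀ ℕ) :
    MvPowerSeries.coeff d (MvPowerSeries.X s * f) =
      if d s = 0 then 0 else MvPowerSeries.coeff (d - Finsupp.single s 1) f := by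
  rw [MvPowerSeries.X, MvPowerSeries.coeff_monomial_mul]
  by_cases h : d s = 0 <;> simp [Finsupp.single_le_iff, h, Nat.one_le_iff_ne_zero]

theorem hopCoeff_congr {σ : Type*} (w : σ → ℕ) {s s' : σ} (hs : w s = w s') {T T' : (σ →₀ ℕ) → ℂ}
    {d : σ →₀ ℕ} (h : ∀ c, Finsupp.weight w c = Finsupp.weight w d → T c = T' c) :
    hopCoeff s s' T d = hopCoeff s s' T' d := by
  rw [hopCoeff, hopCoeff]
  split_ifs with h0
  · rfl
  · rw [h]
    have h1 : d - Finsupp.single s 1 + Finsupp.single s 1 = d :=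
      tsub_add_cancel_of_le (Finsupp.single_le_iff.2 (Nat.one_le_iff_ne_zero.2 h0))
    conv_rhs => rw [← h1]
    rw [weight_add_single, weight_add_single, hs]

/-- The coefficient of `tᵈ` in `(t'ₛ - t''ₛ) (∂'ₛ - ∂''ₛ) f`, where `f` has the coefficients `T`. -/
def heisCoeff (s : Var) (T : (Var2 →₀ ℕ) → ℂ) (d : Var2 →₀ ℕ) : ℂ :=
  hopCoeff (Sum.inl s) (Sum.inl s) T d + hopCoeff (Sum.inr s) (Sum.inr s) T d -
    hopCoeff (Sum.inl s) (Sum.inr s) T d - hopCoeff (Sum.inr s) (Sum.inl s) T d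

theorem sum_fiber_charge {A : Type*} [AddCommGroup A] (a : Fin 2) (l : ℕ) (φ : Var2 → A)
    (h : ∀ s : Var2, s.base.1 ≠ a → φ s = 0) : ∑ s ∈ fiber idx2 l, φ s =
      if Odd l then φ (Sum.inl (a, l / 2)) + φ (Sum.inr (a, l / 2)) else 0 := by
  rw [← Finset.sum_filter_of_ne (p := fun s : Var2 => s.base.1 = a)
    (fun s _ hs => by_contra fun hc => hs (h s hc)), fiber_filter]
  split_ifs
  · rw [Finset.sum_pair (by simp)]
  · simp

/-- For odd `l` only the two copies of `t^a_l` have weight `l` and a charge, with opposite signs;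
hence the differences `t' - t''` and `∂' - ∂''`. -/
theorem coeff_linPoly_mul_linDer (a : Fin 2) (l : ℕ) (F : MvPolynomial Var2 ℂ) (d : Var2 →₀ ℕ) :
    coeff d (linPoly idx2 (chargeP a) l * linDer idx2 (chargeQ a) l F) =
      if Odd l then -2 * l * heisCoeff (a, l / 2) (fun c => coeff c F) d else 0 := by
  rw [linDer_apply, linPoly, sum_fiber_charge a, sum_fiber_charge a]
  · split_ifs with h
    · have hl : ((l : ℕ) : ℂ) ≠ 0 := Nat.cast_ne_zero.2 (Nat.pos_of_ne_zero (by
        rintro rfl; simp at h)).ne'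
      have h1 : idx2 (Sum.inl (a, l / 2)) = l ∧ idx2 (Sum.inr (a, l / 2)) = l := by
        obtain ⟨k, rfl⟩ := h
        simp only [idx2, Var2.base, Var.idx, Sum.elim_inl, Sum.elim_inr, id]
        omega
      simp only [chargeP_eq, chargeQ_eq, h1.1, h1.2]
      simp only [Var2.base, Var2.sign, Sum.elim_inl, Sum.elim_inr, id, if_true]
      have e : (C ((l : ℂ) * ((1 : ℝ) : ℂ)) * X (Sum.inl (a, l / 2)) +
          C ((l : ℂ) * ((-1 : ℝ) : ℂ)) * X (Sum.inr (a, l / 2)) : MvPolynomial Var2 ℂ) *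
          (((l : ℂ) * (((1 : ℝ) : ℂ) * (-2 / l))) • pderiv (Sum.inl (a, l / 2)) F +
            ((l : ℂ) * (((-1 : ℝ) : ℂ) * (-2 / l))) • pderiv (Sum.inr (a, l / 2)) F) =
          C (-2 * l : ℂ) * (X (Sum.inl (a, l / 2)) * pderiv (Sum.inl (a, l / 2)) F +
            X (Sum.inr (a, l / 2)) * pderiv (Sum.inr (a, l / 2)) F -
            X (Sum.inl (a, l / 2)) * pderiv (Sum.inr (a, l / 2)) F -
            X (Sum.inr (a, l / 2)) * pderiv (Sum.inl (a, l / 2)) F) := by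
        have e1 : (l : ℂ) * (((1 : ℝ) : ℂ) * (-2 / l)) = -2 := by push_cast; field_simp
        have e2 : (l : ℂ) * (((-1 : ℝ) : ℂ) * (-2 / l)) = 2 := by push_cast; field_simp
        rw [e1, e2, smul_eq_C_mul, smul_eq_C_mul]
        simp only [map_mul, map_neg, Complex.ofReal_one, Complex.ofReal_neg, map_one]
        ring
      rw [e, coeff_C_mul]
      simp only [coeff_sub, coeff_add, coeff_X_mul_pderiv]
      rfl
    · simp
  · intro s hs
    rw [chargeQ_of_ne hs]; simp
  · intro s hs
    rw [chargeP_of_ne hs]; simp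

theorem JJ_pos (s : Var) (f : Fock) :
    JJ s.1 (Var.idx s : ℤ) f = (2 : ℂ) • MvPowerSeries.pderiv ℂ s f := by
  have h1 : Odd ((Var.idx s : ℕ) : ℤ) := by exact_mod_cast odd_idx s
  have h2 : (s.1, ((Var.idx s : ℕ) : ℤ).natAbs / 2) = s := by
    rw [Int.natAbs_natCast, Var.idx]
    ext
    · rfl
    · simp; omega
  rw [JJ, if_pos h1, if_pos (by unfold Var.idx; omega), h2]

theorem JJ_neg (s : Var) (f : Fock) :
    JJ s.1 (-(Var.idx s : ℤ)) f = (Var.idx s : ℂ) • (MvPowerSeries.X s * f) := by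
  have h1 : Odd (-((Var.idx s : ℕ) : ℤ)) := by
    rw [odd_neg]
    exact_mod_cast odd_idx s
  have h2 : (s.1, (-((Var.idx s : ℕ) : ℤ)).natAbs / 2) = s := by
    rw [Int.natAbs_neg, Int.natAbs_natCast, Var.idx]
    ext
    · rfl
    · simp; omega
  rw [JJ, if_pos h1, if_neg (by unfold Var.idx; omega), h2]
  push_cast
  rw [neg_neg]

theorem sumElim_sub_inl (a b : Var →₀ ℕ) (s : Var) :
    (a.sumElim b : Var2 →₀ ℕ) - Finsupp.single (Sum.inl s) 1 = (a - Finsupp.single s 1).sumElim b := by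
  ext (t | t)
  · simp [Finsupp.single_apply]
  · simp

theorem sumElim_sub_inr (a b : Var →₀ ℕ) (s : Var) :
    (a.sumElim b : Var2 →₀ ℕ) - Finsupp.single (Sum.inr s) 1 = a.sumElim (b - Finsupp.single s 1) := by
  ext (t | t)
  · simp
  · simp [Finsupp.single_apply]

theorem sumElim_add_inl (a b : Var →₀ ℕ) (s : Var) :
    (a.sumElim b : Var2 →₀ ℕ) + Finsupp.single (Sum.inl s) 1 = (a + Finsupp.single s 1).sumElim b := by
  ext (t | t)
  · simp [Finsupp.single_apply]
  · simp

theorem sumElim_add_inr (a b : Var →₀ ℕ) (s : Var) :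
    (a.sumElim b : Var2 →₀ ℕ) + Finsupp.single (Sum.inr s) 1 = a.sumElim (b + Finsupp.single s 1) := by
  ext (t | t)
  · simp
  · simp [Finsupp.single_apply]

theorem tensor_JJ_pos_neg (s : Var) (f : Fock) (d : Var2 →₀ ℕ) :
    tensor (JJ s.1 (Var.idx s : ℤ) f) (JJ s.1 (-(Var.idx s : ℤ)) f) d =
      2 * Var.idx s * hopCoeff (Sum.inr s) (Sum.inl s) (sqCoeffs f) d := by
  obtain ⟨a, b, rfl⟩ := exists_sumElim d
  change MvPowerSeries.coeff _ (tensor _ _) = _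
  rw [coeff_tensor_sumElim, JJ_pos, JJ_neg, hopCoeff, sumElim_sub_inr, sumElim_add_inl]
  simp only [map_smul, smul_eq_mul, MvPowerSeries.coeff_pderiv, coeff_X_mul_series,
    Finsupp.sumElim_inr, Finsupp.sumElim_inl, sqCoeffs, coeff_tensor_sumElim]
  split_ifs <;> ring

theorem tensor_JJ_neg_pos (s : Var) (f : Fock) (d : Var2 →₀ ℕ) :
    tensor (JJ s.1 (-(Var.idx s : ℤ)) f) (JJ s.1 (Var.idx s : ℤ) f) d =
      2 * Var.idx s * hopCoeff (Sum.inl s) (Sum.inr s) (sqCoeffs f) d := by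
  obtain ⟨a, b, rfl⟩ := exists_sumElim d
  change MvPowerSeries.coeff _ (tensor _ _) = _
  rw [coeff_tensor_sumElim, JJ_pos, JJ_neg, hopCoeff, sumElim_sub_inl, sumElim_add_inr]
  simp only [map_smul, smul_eq_mul, MvPowerSeries.coeff_pderiv, coeff_X_mul_series,
    Finsupp.sumElim_inr, Finsupp.sumElim_inl, sqCoeffs, coeff_tensor_sumElim]
  split_ifs <;> ring

theorem coeff_JJ_JJ (s : Var) (f : Fock) (a b : Var →₀ ℕ) :
    MvPowerSeries.coeff a (JJ s.1 (-(Var.idx s : ℤ)) (JJ s.1 (Var.idx s : ℤ) f)) *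
        MvPowerSeries.coeff b f =
      2 * Var.idx s * hopCoeff (Sum.inl s) (Sum.inl s) (sqCoeffs f) (a.sumElim b) ∧
    MvPowerSeries.coeff a f *
        MvPowerSeries.coeff b (JJ s.1 (-(Var.idx s : ℤ)) (JJ s.1 (Var.idx s : ℤ) f)) =
      2 * Var.idx s * hopCoeff (Sum.inr s) (Sum.inr s) (sqCoeffs f) (a.sumElim b) := by
  constructor
  · rw [JJ_pos, JJ_neg, hopCoeff, sumElim_sub_inl, sumElim_add_inl]
    simp only [map_smul, smul_eq_mul, MvPowerSeries.coeff_pderiv, coeff_X_mul_series,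
      Finsupp.sumElim_inl, sqCoeffs, coeff_tensor_sumElim, mul_smul_comm]
    split_ifs <;> ring
  · rw [JJ_pos, JJ_neg, hopCoeff, sumElim_sub_inr, sumElim_add_inr]
    simp only [map_smul, smul_eq_mul, MvPowerSeries.coeff_pderiv, coeff_X_mul_series,
      Finsupp.sumElim_inr, sqCoeffs, coeff_tensor_sumElim, mul_smul_comm]
    split_ifs <;> ring

theorem finsum_odd_multiples {c : ℤ} (hc : 0 < c) (g : ℤ → ℂ) (L : ℕ)
    (h : ∀ m, g m ≠ 0 → ∃ k < L, m = c * (2 * k + 1 : ℕ) ∨ m = c * -(2 * k + 1 : ℕ)) :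
    ∑ᶠ m, g m = ∑ k ∈ Finset.range L, (g (c * (2 * k + 1 : ℕ)) + g (c * -(2 * k + 1 : ℕ))) := by
  have hinj1 : Function.Injective fun k : ℕ => c * ((2 * k + 1 : ℕ) : ℤ) := by
    intro k l hkl
    have := mul_left_cancel₀ hc.ne' hkl
    push_cast at this
    omega
  have hinj2 : Function.Injective fun k : ℕ => c * -((2 * k + 1 : ℕ) : ℤ) := by
    intro k l hkl
    have := mul_left_cancel₀ hc.ne' hkl
    push_cast at this
    omega
  rw [finsum_eq_sum_of_support_subset g
    (s := (Finset.range L).image (fun k : ℕ => c * ((2 * k + 1 : ℕ) : ℤ)) ∪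
      (Finset.range L).image fun k : ℕ => c * -((2 * k + 1 : ℕ) : ℤ)),
    Finset.sum_union, Finset.sum_image hinj1.injOn, Finset.sum_image hinj2.injOn,
    Finset.sum_add_distrib]
  · rw [Finset.disjoint_left]
    intro m h1 h2
    obtain ⟨k, _, rfl⟩ := Finset.mem_image.1 h1
    obtain ⟨l, _, hl⟩ := Finset.mem_image.1 h2
    have := mul_left_cancel₀ hc.ne' hl
    push_cast at this
    omega
  · intro m hm
    obtain ⟨k, hk, h1 | h1⟩ := h m hm
    · rw [h1]
      simp only [Finset.coe_union, Set.mem_union, Finset.mem_coe]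
      exact Or.inl (Finset.mem_image.2 ⟨k, Finset.mem_range.2 hk, rfl⟩)
    · rw [h1]
      simp only [Finset.coe_union, Set.mem_union, Finset.mem_coe]
      exact Or.inr (Finset.mem_image.2 ⟨k, Finset.mem_range.2 hk, rfl⟩)

theorem tensor_JJ_ne_zero {a : Fin 2} {m : ℤ} {f : Fock} {d : Var2 →₀ ℕ} {L : ℕ}
    (hL : ∀ s : Var2, d s ≠ 0 → s.base.2 < L) (h : tensor (JJ a m f) (JJ a (-m) f) d ≠ 0) :
    ∃ k < L, m = (2 * k + 1 : ℕ) ∨ m = -((2 * k + 1 : ℕ) : ℤ) := by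
  by_cases hm : Odd m
  · obtain ⟨r, hr⟩ := hm
    rcases le_or_gt 0 r with h0 | h0
    · obtain ⟨k, rfl⟩ := Int.eq_ofNat_of_zero_le h0
      have e : m = (Var.idx (a, k) : ℤ) := by rw [hr, Var.idx]; push_cast; ring
      rw [e, tensor_JJ_pos_neg (a, k)] at h
      refine ⟨k, ?_, Or.inl (by rw [hr]; push_cast; ring)⟩
      refine hL (Sum.inr (a, k)) fun h' => h ?_
      rw [hopCoeff, if_pos h', mul_zero]
    · obtain ⟨k, hk⟩ := Int.eq_ofNat_of_zero_le (show 0 ≤ -r - 1 by omega)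
      have e : m = -(Var.idx (a, k) : ℤ) := by rw [hr, Var.idx]; push_cast; omega
      rw [e, neg_neg, tensor_JJ_neg_pos (a, k)] at h
      refine ⟨k, ?_, Or.inr (by rw [e, Var.idx])⟩
      refine hL (Sum.inl (a, k)) fun h' => h ?_
      rw [hopCoeff, if_pos h', mul_zero]
  · exfalso
    apply h
    obtain ⟨a', b', rfl⟩ := exists_sumElim d
    rw [tensor_sumElim, JJ, if_neg hm]
    change (0 : ℂ) * _ = 0
    rw [zero_mul]

/-- The sum over `n` of `Jₙ ⊗ J₋ₙ`. -/
theorem finsum_tensor_JJ (a : Fin 2) {c : ℤ} (hc : 0 < c) (f : Fock) {d : Var2 →₀ ℕ} {L : ℕ}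
    (hL : ∀ s : Var2, d s ≠ 0 → s.base.2 < L) :
    ∑ᶠ m : ℤ, (if c ∣ m then tensor (JJ a (m / c) f) (JJ a (-(m / c)) f) d else 0) =
      ∑ k ∈ Finset.range L, 2 * ((2 * k + 1 : ℕ) : ℂ) *
        (hopCoeff (Sum.inr (a, k)) (Sum.inl (a, k)) (sqCoeffs f) d +
          hopCoeff (Sum.inl (a, k)) (Sum.inr (a, k)) (sqCoeffs f) d) := by
  rw [finsum_odd_multiples hc _ L]
  · refine Finset.sum_congr rfl fun k _ => ?_
    rw [if_pos (dvd_mul_right _ _), if_pos (dvd_mul_right _ _), Int.mul_ediv_cancel_left _ hc.ne',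
      Int.mul_ediv_cancel_left _ hc.ne', neg_neg]
    have h1 := tensor_JJ_pos_neg (a, k) f d
    have h2 := tensor_JJ_neg_pos (a, k) f d
    rw [Var.idx] at h1 h2
    rw [h1, h2]
    ring
  · intro m hm
    split_ifs at hm with hd
    · obtain ⟨r, rfl⟩ := hd
      rw [Int.mul_ediv_cancel_left _ hc.ne'] at hm
      obtain ⟨k, hk, h1 | h1⟩ := tensor_JJ_ne_zero hL hm
      · exact ⟨k, hk, Or.inl (by rw [h1])⟩
      · exact ⟨k, hk, Or.inr (by rw [h1])⟩
    · exact absurd rfl hm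

theorem tensor_smul_smul (x y : ℂ) (f g : Fock) (d : Var2 →₀ ℕ) :
    tensor (x • f) (y • g) d = x * y * tensor f g d := by
  obtain ⟨a, b, rfl⟩ := exists_sumElim d
  change MvPowerSeries.coeff _ (tensor _ _) = _ * MvPowerSeries.coeff _ (tensor _ _)
  rw [coeff_tensor_sumElim, coeff_tensor_sumElim, map_smul, map_smul, smul_eq_mul, smul_eq_mul]
  ring

theorem tensor_zero_left (g : Fock) (d : Var2 →₀ ℕ) : tensor (0 : Fock) g d = 0 := by
  obtain ⟨a, b, rfl⟩ := exists_sumElim d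
  change MvPowerSeries.coeff _ (tensor _ _) = _
  rw [coeff_tensor_sumElim, map_zero, zero_mul]

theorem finsum_vMode_inner {N : ℕ} (hN : 3 ≤ N) {i : Fin N} (hi : i.1 + 1 < N) (f : Fock)
    {d : Var2 →₀ ℕ} {L : ℕ} (hL : ∀ s : Var2, d s ≠ 0 → s.base.2 < L) :
    ∑ᶠ m : ℤ, tensor (vMode N i m f) (vMode N i (-m) f) d =
      1 / (cox N : ℂ) ^ 2 * ∑ k ∈ Finset.range L, 2 * ((2 * k + 1 : ℕ) : ℂ) *
        (hopCoeff (Sum.inr (0, k)) (Sum.inl (0, k)) (sqCoeffs f) d +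
          hopCoeff (Sum.inl (0, k)) (Sum.inr (0, k)) (sqCoeffs f) d) := by
  rw [← finsum_tensor_JJ 0 one_pos f hL, ← smul_eq_mul, smul_finsum]
  refine finsum_congr fun m => ?_
  rw [vMode, vMode, if_pos hi, if_pos hi, tensor_smul_smul, if_pos (one_dvd _), Int.ediv_one,
    smul_eq_mul]
  congr 1
  -- The phases `η ^ (-i m)` and `η ^ (i m)` of the two tensor factors cancel, so all `v_i` with `i
  -- < N` contribute equally.
  have := zpow_ne_zero (-((i.1 + 1 : ℕ) : ℤ) * m) (eta_ne_zero hN)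
  rw [mul_neg, zpow_neg]
  field_simp

theorem finsum_vMode_last {N : ℕ} (hN : 3 ≤ N) {i : Fin N} (hi : i.1 + 1 = N) (f : Fock)
    {d : Var2 →₀ ℕ} {L : ℕ} (hL : ∀ s : Var2, d s ≠ 0 → s.base.2 < L) :
    ∑ᶠ m : ℤ, tensor (vMode N i m f) (vMode N i (-m) f) d =
      1 / 4 * ∑ k ∈ Finset.range L, 2 * ((2 * k + 1 : ℕ) : ℂ) *
        (hopCoeff (Sum.inr (1, k)) (Sum.inl (1, k)) (sqCoeffs f) d +
          hopCoeff (Sum.inl (1, k)) (Sum.inr (1, k)) (sqCoeffs f) d) := by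
  rw [← finsum_tensor_JJ 1 (c := ((N - 1 : ℕ) : ℤ)) (by omega) f hL, ← smul_eq_mul, smul_finsum]
  refine finsum_congr fun m => ?_
  rw [vMode, vMode, if_neg hi.not_lt, if_neg hi.not_lt]
  by_cases h : ((N - 1 : ℕ) : ℤ) ∣ m
  · rw [if_pos h, if_pos h, if_pos ((Int.dvd_neg).2 h), tensor_smul_smul, smul_eq_mul,
      Int.neg_ediv_of_dvd h]
    norm_num
  · rw [if_neg h, if_neg h, tensor_zero_left, smul_zero]

theorem D0_apply {N : ℕ} (f : Fock) {a : Var →₀ ℕ} {L : ℕ} (hL : ∀ s : Var, a s ≠ 0 → s.2 < L) :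
    MvPowerSeries.coeff a (D0 N f) =
      (N * (cox N + 1) / (24 * cox N) : ℂ) * MvPowerSeries.coeff a f +
      (1 / (2 * cox N : ℂ) * ∑ k ∈ Finset.range L, MvPowerSeries.coeff a
        (JJ 0 (-(Var.idx (0, k) : ℤ)) (JJ 0 (Var.idx (0, k) : ℤ) f)) +
      1 / 4 * ∑ k ∈ Finset.range L, MvPowerSeries.coeff a
        (JJ 1 (-(Var.idx (1, k) : ℤ)) (JJ 1 (Var.idx (1, k) : ℤ) f))) := by
  have h0 : MvPowerSeries.coeff a (D0 N f) =
      (N * (cox N + 1) / (24 * cox N) : ℂ) * MvPowerSeries.coeff a f +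
      ∑ᶠ s : Var, (1 / (2 * hh N s.1) : ℂ) *
        MvPowerSeries.coeff a (JJ s.1 (-(s.idx : ℤ)) (JJ s.1 (s.idx : ℤ) f)) := rfl
  rw [h0]
  congr 1
  rw [finsum_eq_sum_of_support_subset _ (s := Finset.univ ×ˢ Finset.range L), Finset.sum_product,
    Fin.sum_univ_two, Finset.mul_sum, Finset.mul_sum]
  · congr 1
    refine Finset.sum_congr rfl fun k _ => ?_
    simp only [hh]
    norm_num
  · intro s hs
    simp only [Finset.coe_product, Finset.coe_univ, Set.mem_prod, Set.mem_univ, true_and,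
      Finset.mem_coe, Finset.mem_range]
    refine hL s fun h0 => hs ?_
    simp only [JJ_neg, map_smul, coeff_X_mul_series, if_pos h0, smul_zero, mul_zero]

/-- The coefficients of the Casimir operator applied to `f ⊗ f`. -/
theorem casimirKW_apply {N : ℕ} (hN : 3 ≤ N) [IsGrading (kw2 N)] (f : Fock) {d : Var2 →₀ ℕ} {L : ℕ}
    (hL : ∀ s : Var2, d s ≠ 0 → s.base.2 < L) :
    casimirKW N f f d =
      -(∑ α ∈ roots N, uProd α * modeCoeff (kw2 N) (rootP α) (rootQ α) 0 (sqCoeffs f) d) -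
        (N * (cox N + 1) / (12 * cox N) : ℂ) * sqCoeffs f d -
        1 / (2 * cox N : ℂ) * ∑ k ∈ Finset.range L, 2 * ((2 * k + 1 : ℕ) : ℂ) *
          heisCoeff (0, k) (sqCoeffs f) d -
        1 / 4 * ∑ k ∈ Finset.range L, 2 * ((2 * k + 1 : ℕ) : ℂ) *
          heisCoeff (1, k) (sqCoeffs f) d := by
  have := isGrading_kwWeight hN
  have hroot : ∀ α ∈ roots N, uProd α * res 0 (tensor (rootVertex α f) (rootVertex (-α) f) d) =
      uProd α * modeCoeff (kw2 N) (rootP α) (rootQ α) 0 (sqCoeffs f) d := by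
    intro α _
    rw [rootVertex, rootVertex, res_tensor_vertexOp (kw2_eq N)]
    congr 2
    · funext s
      rcases s with s | s <;> simp [rootP, Var2.sign, Var2.base, rootCoeff_neg]
    · funext s
      rcases s with s | s <;> simp [rootQ, Var2.sign, Var2.base, rootCoeff_neg, idx2]
  have hcox : (cox N : ℂ) ≠ 0 := Nat.cast_ne_zero.2 (by unfold cox; omega)
  have hv : ∑ i : Fin N, ∑ᶠ m : ℤ, tensor (vMode N i m f) (vMode N i (-m) f) d =
      1 / (2 * cox N : ℂ) * ∑ k ∈ Finset.range L, 2 * ((2 * k + 1 : ℕ) : ℂ) *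
        (hopCoeff (Sum.inr (0, k)) (Sum.inl (0, k)) (sqCoeffs f) d +
          hopCoeff (Sum.inl (0, k)) (Sum.inr (0, k)) (sqCoeffs f) d) +
      1 / 4 * ∑ k ∈ Finset.range L, 2 * ((2 * k + 1 : ℕ) : ℂ) *
        (hopCoeff (Sum.inr (1, k)) (Sum.inl (1, k)) (sqCoeffs f) d +
          hopCoeff (Sum.inl (1, k)) (Sum.inr (1, k)) (sqCoeffs f) d) := by
    obtain ⟨n, rfl⟩ : ∃ n, N = n + 1 := ⟨N - 1, by omega⟩
    rw [Fin.sum_univ_castSucc, finsum_vMode_last hN rfl f hL]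
    rw [Finset.sum_congr rfl fun i _ =>
      finsum_vMode_inner hN (i := Fin.castSucc i) (Nat.succ_lt_succ i.2) f hL]
    -- The `N - 1` equal contributions with factor `1/h²` add up to `1/(2h)`.
    rw [Finset.sum_const, Finset.card_univ, Fintype.card_fin, nsmul_eq_mul, ← mul_assoc]
    congr 2
    have : (cox (n + 1) : ℂ) = 2 * n := by rw [cox_eq]; push_cast; simp
    rw [this] at hcox ⊢
    field_simp
  obtain ⟨a, b, rfl⟩ := exists_sumElim d
  have hD1 : tensor (D0 N f) f (a.sumElim b) = MvPowerSeries.coeff a (D0 N f) *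
      MvPowerSeries.coeff b f := coeff_tensor_sumElim _ _ _ _
  have hD2 : tensor f (D0 N f) (a.sumElim b) = MvPowerSeries.coeff a f *
      MvPowerSeries.coeff b (D0 N f) := coeff_tensor_sumElim _ _ _ _
  have hT : sqCoeffs f (a.sumElim b) = MvPowerSeries.coeff a f * MvPowerSeries.coeff b f :=
    coeff_tensor_sumElim _ _ _ _
  rw [casimirKW, Finset.sum_congr rfl hroot, hv, hD1, hD2,
    D0_apply f (a := a) (L := L) (fun s hs => hL (Sum.inl s) hs),
    D0_apply f (a := b) (L := L) (fun s hs => hL (Sum.inr s) hs)]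
  -- The terms of `ν_{(1)} ⊗ 1` and `1 ⊗ ν_{(1)}` supply the diagonal part of `(t' - t'')(∂' -
  -- ∂'')`, and the terms `J_n ⊗ J_{-n}` supply the off-diagonal part.
  have e : ∀ t : Fin 2, ∑ k ∈ Finset.range L, 2 * ((2 * k + 1 : ℕ) : ℂ) *
        heisCoeff (t, k) (sqCoeffs f) (a.sumElim b) =
      (∑ k ∈ Finset.range L, MvPowerSeries.coeff a
        (JJ t (-(Var.idx (t, k) : ℤ)) (JJ t (Var.idx (t, k) : ℤ) f))) * MvPowerSeries.coeff b f +
      MvPowerSeries.coeff a f * (∑ k ∈ Finset.range L, MvPowerSeries.coeff b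
        (JJ t (-(Var.idx (t, k) : ℤ)) (JJ t (Var.idx (t, k) : ℤ) f))) -
      ∑ k ∈ Finset.range L, 2 * ((2 * k + 1 : ℕ) : ℂ) *
        (hopCoeff (Sum.inr (t, k)) (Sum.inl (t, k)) (sqCoeffs f) (a.sumElim b) +
          hopCoeff (Sum.inl (t, k)) (Sum.inr (t, k)) (sqCoeffs f) (a.sumElim b)) := by
    intro t
    rw [Finset.sum_mul, Finset.mul_sum, ← Finset.sum_add_distrib, ← Finset.sum_sub_distrib]
    refine Finset.sum_congr rfl fun k _ => ?_
    have h1 := coeff_JJ_JJ (t, k) f a b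
    dsimp only at h1
    rw [h1.1, h1.2, heisCoeff, Var.idx]
    ring
  rw [e, e, hT]
  have hc2 : (N * (cox N + 1) / (12 * cox N) : ℂ) = 2 * (N * (cox N + 1) / (24 * cox N)) := by
    field_simp; ring
  rw [hc2]
  ring

end Heisenberg

/-! ### The Casimir as a sum of `Ω_{-m} Ω_m`, and part a). -/

section Casimir

theorem heisCoeff_homPart {N : ℕ} [IsGrading (kw2 N)] (s : Var) (T : (Var2 →₀ ℕ) → ℂ) (M : ℕ)
    (d : Var2 →₀ ℕ) : heisCoeff s (fun c => coeff c (homPart (kw2 N) T M)) d =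
      if Finsupp.weight (kw2 N) d = M then heisCoeff s T d else 0 := by
  have key : ∀ T' : (Var2 →₀ ℕ) → ℂ,
      (∀ c, Finsupp.weight (kw2 N) c = Finsupp.weight (kw2 N) d →
        coeff c (homPart (kw2 N) T M) = T' c) →
      heisCoeff s (fun c => coeff c (homPart (kw2 N) T M)) d = heisCoeff s T' d := by
    intro T' h
    have key2 : ∀ t t' : Var2, kw2 N t = kw2 N t' →
        hopCoeff t t' (fun c => coeff c (homPart (kw2 N) T M)) d = hopCoeff t t' T' d :=
      fun t t' ht => hopCoeff_congr (kw2 N) ht h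
    rw [heisCoeff, heisCoeff, key2 _ _ rfl, key2 _ _ rfl, key2 (Sum.inl s) (Sum.inr s) rfl,
      key2 (Sum.inr s) (Sum.inl s) rfl]
  split_ifs with h
  · refine key _ fun c hc => ?_
    rw [coeff_homPart, if_pos (hc.trans h)]
  · rw [key (fun _ => 0) fun c hc => by rw [coeff_homPart, if_neg fun h' => h (hc.symm.trans h')]]
    simp [heisCoeff, hopCoeff]

theorem sum_range_odd {A : Type*} [AddCommMonoid A] (M : ℕ) (φ : ℕ → A) :
    ∑ l ∈ Finset.range (2 * M + 1), (if Odd l then φ l else 0) =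
      ∑ k ∈ Finset.range M, φ (2 * k + 1) := by
  induction M with
  | zero => simp
  | succ M ih =>
    rw [show 2 * (M + 1) + 1 = 2 * M + 1 + 1 + 1 by ring, Finset.sum_range_succ,
      Finset.sum_range_succ, ih, Finset.sum_range_succ, if_pos (odd_two_mul_add_one M),
      if_neg (by rw [Nat.not_odd_iff_even]; exact ⟨M + 1, by ring⟩), add_zero]

theorem sum_linPoly_mul_linDer (a : Fin 2) (M : ℕ) (F : MvPolynomial Var2 ℂ) (d : Var2 →₀ ℕ) :
    coeff d (∑ l ∈ Finset.range (2 * M + 1),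
        linPoly idx2 (chargeP a) l * linDer idx2 (chargeQ a) l F) =
      -∑ k ∈ Finset.range M, 2 * ((2 * k + 1 : ℕ) : ℂ) *
        heisCoeff (a, k) (fun c => coeff c F) d := by
  rw [coeff_sum, Finset.sum_congr rfl fun l _ => coeff_linPoly_mul_linDer a l F d,
    sum_range_odd M fun l => -2 * (l : ℂ) * heisCoeff (a, l / 2) (fun c => coeff c F) d,
    ← Finset.sum_neg_distrib]
  refine Finset.sum_congr rfl fun k _ => ?_
  rw [show (2 * k + 1) / 2 = k by omega]
  ring

/-- The Casimir operator is `-(1/4) ∑ Ω_{-m} Ω_m`, the term of `m = 0` being halved. -/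
theorem coeff_sum_omegaPoly {N : ℕ} (hN : 3 ≤ N) [IsGrading (kw2 N)] {M K : ℕ} (hK : M ≤ K)
    (f : Fock) (d : Var2 →₀ ℕ) :
    coeff d (∑ m ∈ Finset.range (K + 1), C (halfOne m) *
      omegaPoly N (-m) (omegaPoly N m (homPart (kw2 N) (sqCoeffs f) M))) =
      if Finsupp.weight (kw2 N) d = M then -4 * casimirKW N f f d else 0 := by
  have hc : (cox N : ℂ) ≠ 0 := Nat.cast_ne_zero.2 (by unfold cox; omega)
  have h1 := sum_omegaPoly hN hK (wtLE_homPart (kw2 N) (sqCoeffs f) M)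
  have h2 := sum_roots hN (homPart (kw2 N) (sqCoeffs f) M)
  have e1 : (C (1 / (8 * cox N) : ℂ) : MvPolynomial Var2 ℂ) = C (1 / 8) * C (1 / (cox N : ℂ)) := by
    rw [← map_mul]; congr 1; field_simp
  have e2 : (C (1 / (4 * cox N) : ℂ) : MvPolynomial Var2 ℂ) = C (1 / 4) * C (1 / (cox N : ℂ)) := by
    rw [← map_mul]; congr 1; field_simp
  have e3 : (C 4 * C (1 / 8) : MvPolynomial Var2 ℂ) = C (1 / 2) := by
    rw [← map_mul]; congr 1; norm_num
  have e4 : (C 4 * C (1 / 4) : MvPolynomial Var2 ℂ) = 1 := by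
    rw [← map_mul, ← map_one C]; congr 1; norm_num
  set F := homPart (kw2 N) (sqCoeffs f) M with hF
  have h3 : ∑ m ∈ Finset.range (K + 1), C (halfOne m) * omegaPoly N (-m) (omegaPoly N m F) =
      C 4 * ∑ α ∈ roots N, C (uProd α) * vertexMode (kw2 N) (rootP α) (rootQ α) 0 F +
      C (N * (cox N + 1) / (3 * cox N) : ℂ) * F -
      C (2 / (cox N : ℂ)) * ∑ l ∈ Finset.range (2 * M + 1),
        linPoly idx2 (chargeP 0) l * linDer idx2 (chargeQ 0) l F -
      ∑ l ∈ Finset.range (2 * M + 1),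
        linPoly idx2 (chargeP 1) l * linDer idx2 (chargeQ 1) l F := by
    rw [h1, h2, e1, e2]
    simp only [map_mul, mul_assoc, ← Finset.mul_sum]
    linear_combination (-C (1 / (cox N : ℂ)) * ∑ j ∈ Finset.range (cox N), C (cayleySq (eta N ^ j)) *
        vertexMode idx2 (fun s => (eta N ^ j) ^ idx2 s * chargeP 0 s + chargeP 0 s)
          (fun s => (eta N ^ j)⁻¹ ^ idx2 s * chargeQ 0 s + chargeQ 0 s) 0 F) * e3 +
      (C (1 / (cox N : ℂ)) * ∑ j ∈ Finset.range (cox N),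
        vertexMode (kw2 N) (fun s => (eta N ^ j) ^ kw2 N s * chargeP 0 s + chargeP 1 s)
          (fun s => (eta N ^ j)⁻¹ ^ kw2 N s * chargeQ 0 s + chargeQ 1 s) 0 F) * e4
  rw [h3, coeff_sub, coeff_sub, coeff_add, coeff_C_mul, coeff_C_mul, coeff_C_mul,
    sum_linPoly_mul_linDer, sum_linPoly_mul_linDer, coeff_sum]
  simp only [hF, heisCoeff_homPart]
  simp only [coeff_C_mul, coeff_vertexMode_homPart, coeff_homPart, add_zero, Nat.cast_inj]
  split_ifs with h
  · rw [casimirKW_apply hN f (L := M)]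
    · field_simp
      ring
    · intro s hs
      have h4 := Finsupp.le_weight_of_ne_zero' (kw2 N) hs
      have h5 := idx2_le_kw2 hN s
      have h6 : idx2 s = 2 * s.base.2 + 1 := rfl
      omega
  · simp

/-- By `coeff_sum_omegaPoly` the vanishing of the Casimir kills the sum of `Ω_{-m} Ω_m` on every
homogeneous component, and positivity kills each `Ω_m` there. The converse is immediate from the
same identity. -/
theorem casimirKW_eq_zero_iff {N : ℕ} (hN : 3 ≤ N) (f : Fock) :
    casimirKW N f f = 0 ↔ ∀ m : ℕ, Omega N m f f = 0 := by
  have := isGrading_kw2 hN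
  constructor
  · intro h m
    rw [Omega_eq_zero_iff hN]
    intro M
    -- The cutoff has to be at least `M` for the identity to hold and at least `m` for `Ω_m` to
    -- occur in the sum.
    refine omegaPoly_eq_zero_of_sum (K := max M m) ?_ (le_max_right M m)
    ext d
    rw [coeff_sum_omegaPoly hN (le_max_left M m), h, coeff_zero]
    split_ifs
    · exact mul_zero _
    · rfl
  · intro h
    funext d
    have h1 := coeff_sum_omegaPoly hN le_rfl f (M := Finsupp.weight (kw2 N) d) d
    rw [if_pos rfl, Finset.sum_eq_zero, coeff_zero] at h1
    · have h2 : casimirKW N f f d = 0 := by linear_combination (1 / 4 : ℂ) * h1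
      exact h2
    · intro m _
      rw [(Omega_eq_zero_iff hN m f).1 (h m), map_zero, mul_zero]

end Casimir

/-! ### Isotropic subspaces that surject onto `V / V₀`. -/

section Grassmannian

theorem coeff_single_mul (n k : ℤ) (c : ℂ) (x : LaurentInv) :
    (HahnSeries.single n c * x).coeff k = c * x.coeff (k - n) := by
  have := HahnSeries.coeff_single_mul_add (r := c) (x := x) (a := k - n) (b := n)
  rwa [sub_add_cancel] at this

theorem mul_C_eq_smul (x : LaurentInv) (c : ℂ) : x * HahnSeries.C c = c • x := by
  rw [mul_comm]
  ext n
  rw [HahnSeries.C_apply, coeff_single_mul, sub_zero, HahnSeries.coeff_smul, smul_eq_mul]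

theorem negVar_negVar (f : LaurentInv) : negVar (negVar f) = f := by
  ext n
  rw [coeff_negVar, coeff_negVar, ← mul_assoc, ← mul_zpow]
  simp

theorem pairing_comm (f g : VV) : pairing f g = pairing g f := by
  have key : ∀ x y : LaurentInv, res 0 (x * negVar y) = res 0 (y * negVar x) := by
    intro x y
    have h : negVar (x * negVar y) = y * negVar x := by
      rw [negVar_mul, negVar_negVar, mul_comm]
    rw [← h, res, res, coeff_negVar, zpow_zero, one_mul]
  rw [pairing, pairing, key, key f.2]

theorem pairing_add_left (f f' g : VV) : pairing (f + f') g = pairing f g + pairing f' g := by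
  simp only [pairing, res, Prod.fst_add, Prod.snd_add, add_mul, HahnSeries.coeff_add]
  ring

theorem pairing_smul_left (c : ℂ) (f g : VV) : pairing (c • f) g = c * pairing f g := by
  have key : ∀ x y : LaurentInv, res 0 (c • x * y) = c * res 0 (x * y) := by
    intro x y
    rw [← mul_C_eq_smul, mul_right_comm, mul_C_eq_smul]
    rfl
  rw [pairing, pairing, Prod.smul_fst, Prod.smul_snd, key, key, mul_add]

/-- The pairing on `V` as a bilinear form. -/
def pairingForm : VV →ₗ[ℂ] VV →ₗ[ℂ] ℂ :=
  LinearMap.mk₂ ℂ pairing pairing_add_left pairing_smul_left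
    (fun f g g' => by rw [pairing_comm, pairing_add_left, pairing_comm g, pairing_comm g'])
    (fun c f g => by rw [pairing_comm, pairing_smul_left, pairing_comm g, smul_eq_mul])

theorem pairingForm_apply (f g : VV) : pairingForm f g = pairing f g := rfl

theorem coeff_mul_of_nonneg {x y : LaurentInv} (hx : ∀ n < 0, x.coeff n = 0)
    (hy : ∀ n < 0, y.coeff n = 0) : (x * y).coeff 0 = x.coeff 0 * y.coeff 0 := by
  rw [HahnSeries.coeff_mul]
  by_cases h : x.coeff 0 = 0 ∨ y.coeff 0 = 0
  · rw [Finset.sum_eq_zero, mul_eq_zero.2 h]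
    intro i hi
    obtain ⟨-, -, hi⟩ := Finset.mem_antidiagonal.1 hi
    rcases lt_trichotomy i.1 0 with h1 | h1 | h1
    · rw [hx _ h1, zero_mul]
    · rw [h1, show i.2 = 0 by omega]
      exact mul_eq_zero.2 h
    · rw [hy _ (by omega), mul_zero]
  · rw [not_or] at h
    rw [Finset.sum_eq_single_of_mem ((0 : ℤ), (0 : ℤ))]
    · rw [Finset.mem_antidiagonal]
      exact ⟨h.1, h.2, add_zero 0⟩
    · intro i hi hne
      obtain ⟨-, -, hi⟩ := Finset.mem_antidiagonal.1 hi
      rcases lt_trichotomy i.1 0 with h1 | h1 | h1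
      · rw [hx _ h1, zero_mul]
      · exact absurd (Prod.ext h1 (by omega)) hne
      · rw [hy _ (by omega), mul_zero]

/-- Only the constant terms meet, and `1 + (-i)² = 0`. -/
theorem pairing_V0 {f g : VV} (hf : f ∈ V0) (hg : g ∈ V0) : pairing f g = 0 := by
  obtain ⟨hf, hf'⟩ := hf
  obtain ⟨hg, hg'⟩ := hg
  rw [pairing, res, res, coeff_mul_of_nonneg (fun n hn => (hf n hn).1)
    (fun n hn => by rw [coeff_negVar, (hg n hn).1, mul_zero]),
    coeff_mul_of_nonneg (fun n hn => (hf n hn).2)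
    (fun n hn => by rw [coeff_negVar, (hg n hn).2, mul_zero]), coeff_negVar, coeff_negVar, hf', hg',
    zpow_zero]
  linear_combination f.1.coeff 0 * g.1.coeff 0 * Complex.I_sq

/-- Every vector is a sum of elements of `U` and `V₀`, both orthogonal to `v`. Pairing `v` with
monomials then shows that all its coefficients vanish. -/
theorem eq_zero_of_pairing {U : Submodule ℂ VV} (hU : ∀ f : VV, ∃ u ∈ U, u - f ∈ V0) {v : VV}
    (hv : v ∈ V0) (h : ∀ u ∈ U, pairing u v = 0) : v = 0 := by
  have key : ∀ f : VV, pairing f v = 0 := by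
    intro f
    obtain ⟨u, hu, huf⟩ := hU f
    have h1 : pairingForm f v = pairingForm u v - pairingForm (u - f) v := by
      rw [map_sub, LinearMap.sub_apply]; ring
    rw [pairingForm_apply, pairingForm_apply, pairingForm_apply, h u hu, pairing_V0 huf hv] at h1
    rw [h1, sub_zero]
  refine Prod.ext (HahnSeries.ext (funext fun n => ?_)) (HahnSeries.ext (funext fun n => ?_))
  · have h1 := key (HahnSeries.single (-n) 1, 0)
    rw [pairing, res, res, coeff_single_mul, coeff_negVar] at h1
    simpa [zpow_ne_zero] using h1
  · have h1 := key (0, HahnSeries.single (-n) 1)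
    rw [pairing, res, res, coeff_single_mul, coeff_negVar] at h1
    simpa [zpow_ne_zero] using h1

theorem projU0_eq_zero_iff {f : VV} : projU0 f = 0 ↔ f ∈ V0 :=
  Submodule.projectionOnto_apply_eq_zero_iff isCompl_U0_V0

/-- A vector of `U ∩ V₀` is orthogonal to `U` and to `V₀`, hence zero. If `u'` is orthogonal to `U`,
the same applies to its difference from an element of `U` with the same class modulo `V₀`. -/
theorem mem_Gr_of_isotropic {U : Submodule ℂ VV} (hU : ∀ f : VV, ∃ u ∈ U, u - f ∈ V0)
    (hiso : ∀ u ∈ U, ∀ u' ∈ U, pairing u u' = 0) : U ∈ Gr := by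
  refine ⟨⟨?_, ?_⟩, hiso, ?_⟩
  · rintro ⟨u, hu⟩ ⟨v, hv⟩ h
    have h0 : projU0 (u - v) = 0 := (map_sub projU0 u v).trans (sub_eq_zero.2 h)
    exact Subtype.ext (sub_eq_zero.1 (eq_zero_of_pairing hU (projU0_eq_zero_iff.1 h0)
      fun u' hu' => hiso u' hu' _ (U.sub_mem hu hv)))
  · intro x
    obtain ⟨u, hu, hux⟩ := hU x
    refine ⟨⟨u, hu⟩, ?_⟩
    have h1 := projU0_eq_zero_iff.2 hux
    have h2 : projU0 (x : VV) = x := Submodule.projectionOnto_apply_left isCompl_U0_V0 x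
    rw [map_sub, h2, sub_eq_zero] at h1
    exact h1
  · intro u' hu'
    by_contra hc
    push Not at hc
    obtain ⟨u, hu, huu⟩ := hU u'
    apply hu'
    have h1 : u - u' = 0 := by
      refine eq_zero_of_pairing hU huu fun u1 hu1 => ?_
      rw [← pairingForm_apply, map_sub, pairingForm_apply, pairingForm_apply, hiso u1 hu1 u hu,
        hc u1 hu1, sub_zero]
    rwa [← sub_eq_zero.1 h1]

theorem eq_of_le_of_isotropic {U W : Submodule ℂ VV} (hU : ∀ f : VV, ∃ u ∈ U, u - f ∈ V0)
    (hUW : U ≤ W) (hiso : ∀ u ∈ W, ∀ u' ∈ W, pairing u u' = 0) : U = W := by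
  refine le_antisymm hUW fun x hx => ?_
  obtain ⟨u, hu, hux⟩ := hU x
  have h1 : u - x = 0 := eq_zero_of_pairing hU hux fun u' hu' =>
    hiso u' (hUW hu') _ (W.sub_mem (hUW hu) hx)
  rwa [← sub_eq_zero.1 h1]

end Grassmannian

/-! ### The wave function and the leading terms of its Taylor coefficients. -/

section Wave

/-- The coefficient of `tᵈ` in `(Γ(𝐭¹, z₁) τ, i Γ(𝐭², z₂) τ)`. -/
def gamCoeff (τ : Fock) (d : Var →₀ ℕ) : VV := (Gam 0 τ d, Complex.I • Gam 1 τ d)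

theorem waveComp_eq_sum (τ : Fock) (a : Fin 2) (e : Fin 2 →₀ ℕ) : waveComp τ a e =
    ∑ x ∈ antidiagonal (e.mapDomain fun b => ((b, 0) : Var)),
      MvPowerSeries.coeff x.2 τ⁻¹ • Gam a τ x.1 := by
  have h : waveComp τ a e = MvPowerSeries.coeff (e.mapDomain fun b => ((b, 0) : Var))
      (Gam a τ * MvPowerSeries.map (HahnSeries.C : ℂ →+* LaurentInv) τ⁻¹) := rfl
  rw [h, MvPowerSeries.coeff_mul]
  refine Finset.sum_congr rfl fun x _ => ?_
  rw [MvPowerSeries.coeff_map, mul_C_eq_smul]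
  rfl

theorem waveCoeff_eq_sum (τ : Fock) (e : Fin 2 →₀ ℕ) : waveCoeff τ e =
    ∑ x ∈ antidiagonal (e.mapDomain fun b => ((b, 0) : Var)),
      MvPowerSeries.coeff x.2 τ⁻¹ • gamCoeff τ x.1 := by
  rw [waveCoeff, waveComp_eq_sum, waveComp_eq_sum]
  refine Prod.ext ?_ ?_
  · simp [Prod.fst_sum, gamCoeff]
  · simp only [Prod.snd_sum, gamCoeff, Prod.smul_snd, Finset.smul_sum]
    refine Finset.sum_congr rfl fun x _ => smul_comm _ _ _

/-- The coefficients of `τ⁻¹` do not depend on `z`, so division by `τ` only forms linear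
combinations. -/
theorem grPoint_le (τ : Fock) : grPoint τ ≤ Submodule.span ℂ (Set.range (gamCoeff τ)) := by
  rw [grPoint, Submodule.span_le]
  rintro _ ⟨e, rfl⟩
  rw [waveCoeff_eq_sum]
  exact Submodule.sum_mem _ fun x _ =>
    Submodule.smul_mem _ _ (Submodule.subset_span (Set.mem_range_self _))

/-- The coefficients of `τ⁻¹ exp (∑ₛ qₛ z ^ (-wₛ) ∂ₛ) τ`. -/
def derQuot (a : Fin 2) (τ : Fock) : MvPowerSeries Var LaurentInv :=
  expDer Var.idx (fun s => if s.1 = a then -2 / (Var.idx s : ℂ) else 0) τ *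
    MvPowerSeries.map (HahnSeries.C : ℂ →+* LaurentInv) τ⁻¹

theorem coeff_derQuot (a : Fin 2) (τ : Fock) (y : Var →₀ ℕ) (n : ℤ) :
    (MvPowerSeries.coeff y (derQuot a τ)).coeff n = ∑ z ∈ antidiagonal y,
      MvPowerSeries.coeff z.2 τ⁻¹ * if 0 ≤ n then PowerSeries.coeff n.toNat (shiftSeries Var.idx
        (fun s => if s.1 = a then -2 / (Var.idx s : ℂ) else 0) τ z.1) else 0 := by
  rw [derQuot, MvPowerSeries.coeff_mul, HahnSeries.coeff_sum]
  refine Finset.sum_congr rfl fun z _ => ?_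
  rw [MvPowerSeries.coeff_map, mul_C_eq_smul, HahnSeries.coeff_smul, smul_eq_mul]
  congr 1
  rw [← coeff_ofPowerSeries, ← expDer_eq]
  rfl

theorem coeff_derQuot_of_neg (a : Fin 2) (τ : Fock) (y : Var →₀ ℕ) {n : ℤ} (hn : n < 0) :
    (MvPowerSeries.coeff y (derQuot a τ)).coeff n = 0 := by
  rw [coeff_derQuot]
  refine Finset.sum_eq_zero fun z _ => ?_
  rw [if_neg (by omega), mul_zero]

theorem wtSet_zero {σ : Type*} (w : σ → ℕ) [IsGrading w] : wtSet w ((0 : ℕ) : ℤ) = {0} := by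
  ext e
  simp only [mem_wtSet, Finset.mem_singleton]
  constructor
  · intro h
    ext s
    have := Finsupp.le_weight w (IsGrading.pos (w := w) s).ne' e
    simp
    omega
  · rintro rfl; simp

theorem coeff_derQuot_zero (a : Fin 2) {τ : Fock} (hτ : MvPowerSeries.constantCoeff τ ≠ 0) :
    (MvPowerSeries.coeff 0 (derQuot a τ)).coeff 0 = 1 := by
  have h0 : (antidiagonal (0 : Var →₀ ℕ)) = {(0, 0)} := by
    simp
  rw [coeff_derQuot, h0, Finset.sum_singleton, if_pos le_rfl, Int.toNat_zero, shiftSeries,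
    PowerSeries.coeff_mk, wtSet_zero, Finset.sum_singleton, shiftCoeff_zero, one_mul, add_zero]
  rw [MvPowerSeries.coeff_zero_eq_constantCoeff_apply, MvPowerSeries.coeff_zero_eq_constantCoeff_apply,
    MvPowerSeries.constantCoeff_inv, inv_mul_cancel₀ hτ]

theorem waveComp_apply (τ : Fock) (a : Fin 2) (e : Fin 2 →₀ ℕ) (n : ℤ) : (waveComp τ a e).coeff n =
    ∑ x ∈ antidiagonal (e.mapDomain fun b => ((b, 0) : Var)),
      expCoeff (fun s : Var => if s.1 = a then 1 else 0) x.1 *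
        (MvPowerSeries.coeff x.2 (derQuot a τ)).coeff (n + Finsupp.weight Var.idx x.1) := by
  have h : waveComp τ a e = MvPowerSeries.coeff (e.mapDomain fun b => ((b, 0) : Var))
      (expMul Var.idx (fun s => if s.1 = a then 1 else 0) * derQuot a τ) := by
    rw [derQuot, ← mul_assoc]
    rfl
  rw [h, MvPowerSeries.coeff_mul, HahnSeries.coeff_sum]
  refine Finset.sum_congr rfl fun x _ => ?_
  have h2 : MvPowerSeries.coeff x.1 (expMul Var.idx (fun s => if s.1 = a then 1 else 0)) =
    HahnSeries.single (-(Finsupp.weight Var.idx x.1 : ℤ))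
      (expCoeff (fun s : Var => if s.1 = a then 1 else 0) x.1) := rfl
  rw [h2, coeff_single_mul, sub_neg_eq_add]

theorem mapDomain_single_zero (b : Fin 2) (k : ℕ) :
    (Finsupp.single b k).mapDomain (fun b => ((b, 0) : Var)) = Finsupp.single ((b, 0) : Var) k :=
  Finsupp.mapDomain_single

theorem weight_single_idx (b : Fin 2) (k : ℕ) :
    Finsupp.weight Var.idx (Finsupp.single ((b, 0) : Var) k) = k := by
  simp [Finsupp.weight_single, Var.idx]

theorem coeff_waveComp_of_lt (τ : Fock) (a b : Fin 2) (k : ℕ) {n : ℤ} (hn : n < -k) :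
    (waveComp τ a (Finsupp.single b k)).coeff n = 0 := by
  rw [waveComp_apply, mapDomain_single_zero]
  refine Finset.sum_eq_zero fun x hx => ?_
  have h1 := congrArg (Finsupp.weight Var.idx) (Finset.HasAntidiagonal.mem_antidiagonal.1 hx)
  rw [map_add, weight_single_idx] at h1
  rw [coeff_derQuot_of_neg _ _ _ (by omega), mul_zero]

theorem coeff_waveComp_same {τ : Fock} (hτ : MvPowerSeries.constantCoeff τ ≠ 0) (a : Fin 2) (k : ℕ) :
    (waveComp τ a (Finsupp.single a k)).coeff (-k) = 1 / (k.factorial : ℂ) := by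
  rw [waveComp_apply, mapDomain_single_zero,
    Finset.sum_eq_single_of_mem (Finsupp.single ((a, 0) : Var) k, 0)]
  · rw [weight_single_idx, neg_add_cancel, coeff_derQuot_zero a hτ, mul_one, expCoeff,
      Finsupp.prod_single_index] <;> simp
  · simp [Finset.HasAntidiagonal.mem_antidiagonal]
  · intro x hx hne
    have hx' := Finset.HasAntidiagonal.mem_antidiagonal.1 hx
    have h1 := congrArg (Finsupp.weight Var.idx) hx'
    rw [map_add, weight_single_idx] at h1
    by_cases h2 : x.2 = 0
    · refine absurd (Prod.ext ?_ h2) hne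
      rw [h2, add_zero] at hx'
      exact hx'
    · have h3 : Finsupp.weight Var.idx x.2 ≠ 0 := by
        obtain ⟨s, hs⟩ := Finsupp.ne_iff.1 h2
        have := Finsupp.le_weight Var.idx (IsGrading.pos (w := Var.idx) s).ne' x.2
        simp at hs
        omega
      rw [coeff_derQuot_of_neg _ _ _ (by omega), mul_zero]

/-- The multiplication exponential of the component `a` does not contain `x_b`, and the remaining
factor has no positive powers of `z`. -/
theorem coeff_waveComp_of_ne (τ : Fock) {a b : Fin 2} (hab : b ≠ a) (k : ℕ) {n : ℤ} (hn : n < 0) :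
    (waveComp τ a (Finsupp.single b k)).coeff n = 0 := by
  rw [waveComp_apply, mapDomain_single_zero]
  refine Finset.sum_eq_zero fun x hx => ?_
  have hx' := Finset.HasAntidiagonal.mem_antidiagonal.1 hx
  by_cases h : x.1 = 0
  · rw [h, map_zero, coeff_derQuot_of_neg _ _ _ (by simpa using hn), mul_zero]
  · obtain ⟨s, hs⟩ := Finsupp.ne_iff.1 h
    have hs' : s = (b, 0) := by
      by_contra hc
      have := DFunLike.congr_fun hx' s
      rw [Finsupp.add_apply, Finsupp.single_eq_of_ne hc] at this
      simp at hs
      omega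
    have h0 : expCoeff (fun s : Var => if s.1 = a then (1 : ℂ) else 0) x.1 = 0 := by
      rw [expCoeff, Finsupp.prod]
      refine Finset.prod_eq_zero (Finsupp.mem_support_iff.2 hs) ?_
      rw [if_neg (by rw [hs']; exact hab), zero_pow hs, zero_div]
    rw [h0, zero_mul]

/-- The space `U_τ` projects onto `V / V₀`. -/
theorem grPoint_surj {τ : Fock} (hτ : MvPowerSeries.constantCoeff τ ≠ 0) (f : VV) :
    ∃ u ∈ grPoint τ, u - f ∈ V0 := by
  have key : ∀ (k : ℕ) (f : VV), (∀ n : ℤ, n < -k → f.1.coeff n = 0 ∧ f.2.coeff n = 0) →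
      ∃ u ∈ grPoint τ, u - f ∈ V0 := by
    intro k
    induction k with
    | zero =>
      intro f hf
      -- This is the coefficient of `e₁ + i e₂` in the constant term of `f`, written in the basis
      -- `e₁ ± i e₂`; at `x = 0` the wave function equals `e₁ + i e₂` modulo negative powers.
      set c : ℂ := (f.1.coeff 0 - Complex.I * f.2.coeff 0) / 2 with hc
      have h1 : ∀ (a : Fin 2) (n : ℤ), n < 0 → (waveComp τ a 0).coeff n = 0 := by
        intro a n hn
        have := coeff_waveComp_of_lt τ a 0 0 (n := n) (by simpa using hn)
        rwa [Finsupp.single_zero] at this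
      have h2 : ∀ a : Fin 2, (waveComp τ a 0).coeff 0 = 1 := by
        intro a
        have := coeff_waveComp_same hτ a 0
        rw [Finsupp.single_zero] at this
        simpa using this
      refine ⟨c • waveCoeff τ 0, Submodule.smul_mem _ _ (Submodule.subset_span ⟨0, rfl⟩), ?_, ?_⟩
      · intro n hn
        have hf' := hf n (by simpa using hn)
        simp [waveCoeff, h1 _ n hn, hf'.1, hf'.2]
      · simp [waveCoeff, h2]
        rw [hc]
        linear_combination -f.2.coeff 0 * Complex.I_sq
    | succ k ih =>
      intro f hf
      have hmem : ∀ b, waveCoeff τ (Finsupp.single b (k + 1)) ∈ grPoint τ := fun b =>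
        Submodule.subset_span ⟨_, rfl⟩
      set F : ℂ := ((k + 1).factorial : ℂ) with hF
      have hF0 : F ≠ 0 := Nat.cast_ne_zero.2 (Nat.factorial_ne_zero _)
      -- The coefficient of `x_a ^ (k+1)` has leading term `z_a ^ (k+1) / (k+1)!` in the component
      -- `a`, up to the factor `i` for the second, and no positive power in the other. So `F` and
      -- `-i` normalise it, and subtracting `v` lowers the order of the poles of `f` at infinity.
      set v : VV := (F * f.1.coeff (-(k + 1 : ℕ))) • waveCoeff τ (Finsupp.single 0 (k + 1)) +
        (-Complex.I * F * f.2.coeff (-(k + 1 : ℕ))) • waveCoeff τ (Finsupp.single 1 (k + 1)) with hv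
      have hvm : v ∈ grPoint τ := Submodule.add_mem _ (Submodule.smul_mem _ _ (hmem 0))
        (Submodule.smul_mem _ _ (hmem 1))
      obtain ⟨u, hu, huf⟩ := ih (f - v) (by
        intro n hn
        rcases lt_or_eq_of_le (show n ≤ -(k + 1 : ℕ) by push_cast; omega) with h | h
        · have h1 := fun a b => coeff_waveComp_of_lt τ a b (k + 1) h
          have hf' := hf n h
          simp only [hv, waveCoeff, Prod.fst_sub, Prod.fst_add, Prod.smul_fst, Prod.snd_sub,
            Prod.snd_add, Prod.smul_snd, HahnSeries.coeff_sub, HahnSeries.coeff_add,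
            HahnSeries.coeff_smul, h1, hf'.1, hf'.2, smul_eq_mul, mul_zero, add_zero, sub_zero,
            and_self]
        · have h01 := coeff_waveComp_of_ne τ (a := 0) (b := 1) (by decide) (k + 1) (n := n) (by omega)
          have h10 := coeff_waveComp_of_ne τ (a := 1) (b := 0) (by decide) (k + 1) (n := n) (by omega)
          have h00 := coeff_waveComp_same hτ 0 (k + 1)
          have h11 := coeff_waveComp_same hτ 1 (k + 1)
          rw [← h, ← hF] at h00 h11
          rw [hv, ← h]
          constructor
          · simp only [waveCoeff, Prod.fst_sub, Prod.fst_add, Prod.smul_fst, HahnSeries.coeff_sub,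
              HahnSeries.coeff_add, HahnSeries.coeff_smul, h01, h00, smul_eq_mul]
            field_simp
            ring
          · simp only [waveCoeff, Prod.snd_sub, Prod.snd_add, Prod.smul_snd, HahnSeries.coeff_sub,
              HahnSeries.coeff_add, HahnSeries.coeff_smul, h10, h11, smul_eq_mul]
            field_simp
            linear_combination f.2.coeff n * Complex.I_sq)
      refine ⟨u + v, Submodule.add_mem _ hu hvm, ?_⟩
      convert huf using 1
      abel
  refine key (max (-f.1.order).toNat (-f.2.order).toNat) f fun n hn => ⟨?_, ?_⟩
  · exact HahnSeries.coeff_eq_zero_of_lt_order (by omega)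
  · exact HahnSeries.coeff_eq_zero_of_lt_order (by omega)

end Wave

/-! ### The bilinear equations as orthogonality relations, and part b). -/

section Reduction

/-- Multiplication by `(z₁ ^ h, z₂ ^ 2)` as a linear map. -/
def mulZLin (N : ℕ) : VV →ₗ[ℂ] VV where
  toFun := mulZ N
  map_add' f g := by
    simp only [mulZ, Prod.fst_add, Prod.snd_add, mul_add, Prod.mk_add_mk]
  map_smul' c f := by
    have key : ∀ x y : LaurentInv, x * (c • y) = c • (x * y) := by
      intro x y
      rw [← mul_C_eq_smul, ← mul_assoc, mul_C_eq_smul]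
    simp only [mulZ, Prod.smul_fst, Prod.smul_snd, key, Prod.smul_mk, RingHom.id_apply]

theorem mulZLin_pow_apply (N m : ℕ) (f : VV) : (mulZLin N ^ m) f =
    (HahnSeries.single (-((m : ℤ) * cox N)) 1 * f.1, HahnSeries.single (-(2 * (m : ℤ))) 1 * f.2) := by
  induction m with
  | zero =>
    refine Prod.ext ?_ ?_
    · simp
    · simp
  | succ m ih =>
    rw [pow_succ', Module.End.mul_apply, ih]
    change mulZ N _ = _
    rw [mulZ, ← mul_assoc, ← mul_assoc, HahnSeries.single_mul_single, HahnSeries.single_mul_single,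
      mul_one, show -(cox N : ℤ) + -((m : ℤ) * cox N) = -(((m + 1 : ℕ) : ℤ) * cox N) by
        push_cast; ring,
      show (-2 : ℤ) + -(2 * (m : ℤ)) = -(2 * ((m + 1 : ℕ) : ℤ)) by push_cast; ring]

/-- The factors `i` in the second components of both arguments produce `i² = -1`, the sign between
the two residues of `Ω_m`. -/
theorem Omega_sumElim (N m : ℕ) (τ : Fock) (a b : Var →₀ ℕ) :
    Omega N m τ τ (a.sumElim b) = pairing ((mulZLin N ^ m) (gamCoeff τ a)) (gamCoeff τ b) := by
  have h : Omega N m τ τ (a.sumElim b) =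
      res (m * cox N) (Gam 0 τ a * negVar (Gam 0 τ b)) -
        res (2 * m) (Gam 1 τ a * negVar (Gam 1 τ b)) := by
    have h0 := fun c : Fin 2 => tensor_sumElim (Gam c τ) (fun e => negVar (Gam c τ e)) a b
    exact congrArg₂ (· - ·) (congrArg (res (m * cox N)) (h0 0)) (congrArg (res (2 * m)) (h0 1))
  rw [h, mulZLin_pow_apply, pairing, gamCoeff, gamCoeff]
  dsimp only
  rw [negVar_smul, mul_assoc, mul_assoc, res, res, res, res, coeff_single_mul, coeff_single_mul,
    ← mul_C_eq_smul, ← mul_C_eq_smul, mul_right_comm, ← mul_assoc, mul_C_eq_smul, mul_C_eq_smul,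
    HahnSeries.coeff_smul, HahnSeries.coeff_smul]
  simp only [zero_sub, neg_neg, one_mul, smul_eq_mul]
  linear_combination -(Gam 1 τ a * negVar (Gam 1 τ b)).coeff (2 * (m : ℤ)) * Complex.I_sq

theorem Omega_eq_zero_iff_pairing (N m : ℕ) (τ : Fock) : Omega N m τ τ = 0 ↔
    ∀ u ∈ Submodule.span ℂ (Set.range (gamCoeff τ)),
      ∀ v ∈ Submodule.span ℂ (Set.range (gamCoeff τ)), pairing ((mulZLin N ^ m) u) v = 0 := by
  constructor
  · intro h
    have h1 : ∀ a, ∀ v ∈ Submodule.span ℂ (Set.range (gamCoeff τ)),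
        pairingForm ((mulZLin N ^ m) (gamCoeff τ a)) v = 0 := by
      intro a
      have : Submodule.span ℂ (Set.range (gamCoeff τ)) ≤
          LinearMap.ker (pairingForm ((mulZLin N ^ m) (gamCoeff τ a))) := by
        rw [Submodule.span_le]
        rintro _ ⟨b, rfl⟩
        rw [SetLike.mem_coe, LinearMap.mem_ker, pairingForm_apply, ← Omega_sumElim, h]
        rfl
      exact fun v hv => LinearMap.mem_ker.1 (this hv)
    intro u hu v hv
    have : Submodule.span ℂ (Set.range (gamCoeff τ)) ≤
        LinearMap.ker ((pairingForm.flip v) ∘ₗ (mulZLin N ^ m)) := by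
      rw [Submodule.span_le]
      rintro _ ⟨a, rfl⟩
      exact LinearMap.mem_ker.2 (h1 a v hv)
    exact LinearMap.mem_ker.1 (this hu)
  · intro h
    funext d
    obtain ⟨a, b, rfl⟩ := exists_sumElim d
    rw [Omega_sumElim]
    exact h _ (Submodule.subset_span ⟨a, rfl⟩) _ (Submodule.subset_span ⟨b, rfl⟩)

theorem isBKPTau_iff (N : ℕ) (τ : Fock) : IsBKPTau τ ↔ Omega N (0 : ℕ) τ τ = 0 := by
  rw [IsBKPTau, Omega, Nat.cast_zero, zero_mul, mul_zero]

theorem IsBKPTau.isotropic {τ : Fock} (h : IsBKPTau τ) :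
    ∀ u ∈ Submodule.span ℂ (Set.range (gamCoeff τ)),
      ∀ v ∈ Submodule.span ℂ (Set.range (gamCoeff τ)), pairing u v = 0 := by
  have := (Omega_eq_zero_iff_pairing 0 0 τ).1 ((isBKPTau_iff 0 τ).1 h)
  simpa only [pow_zero, Module.End.one_apply] using this

/-- The coefficients in all time variables span an isotropic space, while those in `x₁`, `x₂` alone
already surject onto `V / V₀`. There is no room between the two. -/
theorem IsBKPTau.grPoint_eq {τ : Fock} (hτ : MvPowerSeries.constantCoeff τ ≠ 0) (h : IsBKPTau τ) :
    grPoint τ = Submodule.span ℂ (Set.range (gamCoeff τ)) :=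
  eq_of_le_of_isotropic (grPoint_surj hτ) (grPoint_le τ) h.isotropic

theorem IsBKPTau.grPoint_mem_Gr {τ : Fock} (hτ : MvPowerSeries.constantCoeff τ ≠ 0)
    (h : IsBKPTau τ) : grPoint τ ∈ Gr := by
  refine mem_Gr_of_isotropic (grPoint_surj hτ) ?_
  rw [h.grPoint_eq hτ]
  exact h.isotropic

/-- Only `Ω₀` and `Ω₁` are needed for the forward direction: `Ω₁ = 0` makes `z u` orthogonal to
`U_τ`, and maximal isotropy puts it into `U_τ`. Conversely `z^m U_τ ⊆ U_τ` and isotropy give all the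
equations. -/
theorem casimirKW_eq_zero_iff_mulZ {N : ℕ} (hN : 3 ≤ N) {τ : Fock}
    (hτ : MvPowerSeries.constantCoeff τ ≠ 0) :
    casimirKW N τ τ = 0 ↔ IsBKPTau τ ∧ ∀ u ∈ grPoint τ, mulZ N u ∈ grPoint τ := by
  rw [casimirKW_eq_zero_iff hN]
  constructor
  · intro h
    have hB : IsBKPTau τ := (isBKPTau_iff N τ).2 (h 0)
    refine ⟨hB, fun u hu => ?_⟩
    by_contra hc
    obtain ⟨v, hv, hne⟩ := (hB.grPoint_mem_Gr hτ).2.2 _ hc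
    rw [hB.grPoint_eq hτ] at hu hv
    apply hne
    rw [pairing_comm]
    have := (Omega_eq_zero_iff_pairing N 1 τ).1 (h 1) u hu v hv
    rwa [pow_one] at this
  · rintro ⟨hB, hz⟩ m
    rw [Omega_eq_zero_iff_pairing, ← hB.grPoint_eq hτ]
    intro u hu v hv
    have hm : (mulZLin N ^ m) u ∈ grPoint τ := by
      induction m with
      | zero => simpa using hu
      | succ m ih =>
        rw [pow_succ', Module.End.mul_apply]
        exact hz _ ih
    exact (hB.grPoint_mem_Gr hτ).2.1 _ hm v hv

end Reduction

end KacWakimotoD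

end

theorem corollary1 (N : ℕ) (hN : 3 ≤ N) (τ : KacWakimotoD.Fock) :
    (KacWakimotoD.casimirKW N τ τ = 0 ↔ ∀ m : ℕ, KacWakimotoD.Omega N m τ τ = 0) ∧
    (MvPowerSeries.constantCoeff τ ≠ 0 →
      (KacWakimotoD.IsBKPTau τ → KacWakimotoD.grPoint τ ∈ KacWakimotoD.Gr) ∧
      (KacWakimotoD.casimirKW N τ τ = 0 ↔
        KacWakimotoD.IsBKPTau τ ∧
          ∀ u ∈ KacWakimotoD.grPoint τ,
            KacWakimotoD.mulZ N u ∈ KacWakimotoD.grPoint τ)) := by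
  exact ⟨KacWakimotoD.casimirKW_eq_zero_iff hN τ, fun hτ =>
    ⟨fun h => h.grPoint_mem_Gr hτ, KacWakimotoD.casimirKW_eq_zero_iff_mulZ hN hτ⟩⟩
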